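/- Let $d\ge 1$, let $J\subset\mathbb Z^d$ be finite, and let $m\ge 1$ be an integer. Let $\{X_i,\ i\in J\}$ be random variables with values in $\{0,1,2,\dots\}$ and $\mathbb E X_i^4<\infty$. Assume they form an $m$-dependent random field: $\{X_i, i\in M\}$ and $\{X_i, i\in N\}$ are independent whenever $M,N\subset J$ and $\max_{1\le l\le d}|i_l-j_l|>m$ for all $i\in M$, $j\in N$. Put $W=\sum_{i\in J}X_i$, $C_j=\{l\in J:\max_k|l_k-j_k|\le 3m\}$, and $$D(W\mid X_{C_j})=\sum_{k\ge 0}|p_{k-2}-2p_{k-1}+p_k|,\qquad p_k=\mathbb P(W=k\mid X_{C_j}),$$ $$S=\sup_{i,j\in J}\mathbb E\big[X_i^4\,D(W\mid X_{C_j})\big].$$ With $\vartheta_k=\mathbb E[W(W-1)\cdots(W-k+1)]$, let $$\Gamma_1=\vartheta_1,\qquad \Gamma_2=\vartheta_2-\vartheta_1^2,\qquad \Gamma_3=\tfrac12(\vartheta_3-3\vartheta_1\vartheta_2+2\vartheta_1^3).$$ For real $\lambda$, let $\mathcal P(\lambda)$ be the (signed, if $\lambda<0$) measure with weights $e^{-\lambda}\lambda^k/k!$,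 and let $d_{TV}(W,M)=\sup_{A\subset\mathbb Z_+}|\mathbb P(W\in A)-M(A)|$. Let $M_2=NB(r,\bar p)*\mathcal P(\lambda)$, where $NB(r,\bar p)$ has weights $\binom{r+k-1}{k}\bar p^r\bar q^k$, $\bar q=1-\bar p$, and $r>0$, $0<\bar p<1$, $\lambda\in\mathbb R$ satisfy $$\frac{r\bar q}{\bar p}+\lambda=\Gamma_1,\qquad \frac{r\bar q^2}{\bar p^2}=\Gamma_2,\qquad \frac{r\bar q^3}{\bar p^3}=\Gamma_3 .$$ Assumption (H2) is $|\lambda|\bar q<\frac12(r\bar q+\lambda\bar p)$, and $\theta_2=\dfrac{|\lambda|\bar q}{r\bar q+\lambda\bar p}$. Let $M_1=B(n,p)*\mathcal P(\lambda)$, where $n\in\mathbb Z_+$, $0<p<1$, $q=1-p$, $\lambda\in\mathbb R$ satisfy, for some $\delta\in[0,1)$, $$np+\lambda=\Gamma_1,\qquad -(n+\delta)p^2=\Gamma_2,\qquad (n+\delta)p^3=\Gamma_3 .$$ Assumption (H1) is $\dfrac{|\lambda| p}{q}<\dfrac p2\lfloor n+\lambda/p\rfloor$, and $\theta_1=\dfrac{|\lambda|}{\lfloor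 n+\lambda/p\rfloor q}$. Then there is a constant $C$ depending only on $d$ such that the following hold. (i) If $\mathbb EW<\operatorname{Var}W$ and (H2) holds, then $$d_{TV}(W,M_2)\le\frac{C m^{3d}|J|\,(\Gamma_2\vee\Gamma_3)}{(1-2\theta_2)\,\Gamma_1\Gamma_2}\,S .$$ (ii) If $\mathbb EW>\operatorname{Var}W$ and (H1) holds, then $$d_{TV}(W,M_1)\le\frac{C m^{3d}|J|\,(|\Gamma_2|\vee|\Gamma_3|)}{(1-2\theta_1)\,\Gamma_1|\Gamma_2+\Gamma_3|}\,S+\frac{\Gamma_3^2}{(1-2\theta_1)\,\Gamma_1\Gamma_2(\Gamma_2+\Gamma_3)} .$$ Moreover, for every $K>0$ there is a constant $C$ depending only on $d$ and $K$ such that, if $|\Gamma_1|,|\Gamma_2|,|\Gamma_3|\le K|J|$ and $|J|\le K|\Gamma_1|$, the following hold. (i') If $\mathbb EW<\operatorname{Var}W$, (H2) holds and $|J|\le K|\Gamma_2|$, then $\displaystyle d_{TV}(W,M_2)\le\frac{Cm^{3d}}{1-2\theta_2}\,S$. (ii') If $\mathbb EW>\operatorname{Var}W$, (H1) holds and $|J|\le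 K|\Gamma_2+\Gamma_3|$, then $\displaystyle d_{TV}(W,M_1)\le\frac{Cm^{3d}}{1-2\theta_1}\,S+\frac{1}{(1-2\theta_1)|J|}$. -/

import Mathlib

open MeasureTheory

universe u

noncomputable section

/-! ### Integer lattice, random fields -/

/-- The maximum distance `max_l |i_l - j_l|` on `ℤ^d`. -/
def latticeDist {d : ℕ} (i j : Fin d → ℤ) : ℕ :=
  Finset.univ.sup fun l => (i l - j l).natAbs

/-- `{X_i, i ∈ J}` is an `m`-dependent random field: the subfamilies indexed by `M` and by `N`
are independent whenever all points of `M` are at distance more than `m` from all points of `N`. -/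
def IsMDependent {d : ℕ} {J : Finset (Fin d → ℤ)} {Ω : Type*} [MeasurableSpace Ω]
    (m : ℕ) (X : J → Ω → ℕ) (μ : Measure Ω) : Prop :=
  ∀ M N : Finset J, (∀ i ∈ M, ∀ j ∈ N, m < latticeDist (i : Fin d → ℤ) j) →
    ProbabilityTheory.IndepFun (fun ω (i : M) => X i ω) (fun ω (j : N) => X j ω) μ

/-- The neighbourhood `C_j = {l ∈ J : |l - j| ≤ 3m}` of `j`. -/
def nbhdC {d : ℕ} {J : Finset (Fin d → ℤ)} (m : ℕ) (j : J) : Finset J :=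
  Finset.univ.filter fun l => latticeDist (l : Fin d → ℤ) j ≤ 3 * m

/-- The sum `W = ∑_{i ∈ J} X_i`. -/
def fieldSum {d : ℕ} {J : Finset (Fin d → ℤ)} {Ω : Type*} (X : J → Ω → ℕ) (ω : Ω) : ℕ :=
  ∑ i, X i ω

/-! ### Smoothness of (conditional) distributions -/

/-- `∑_{k ≥ 0} |p_{k-2} - 2 p_{k-1} + p_k|`, which for `p` vanishing on the negative integers is the
total variation norm of `p * (I_1 - I_0)^{*2}`. -/
def secondDiffNorm (p : ℤ → ℝ) : ℝ :=
  ∑' k : ℕ, |p ((k : ℤ) - 2) - 2 * p ((k : ℤ) - 1) + p (k : ℤ)|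

/-- `D(W | X_S)` at `ω`, computed from the conditional distribution of `W` given that `X_S` takes the
value `X_S(ω)`. As `X_S` has countably many values, this is the usual conditional distribution. -/
def condSmoothness {d : ℕ} {J : Finset (Fin d → ℤ)} {Ω : Type*} [MeasurableSpace Ω]
    (μ : Measure Ω) (X : J → Ω → ℕ) (S : Finset J) (ω : Ω) : ℝ :=
  secondDiffNorm fun k =>
    (ProbabilityTheory.cond μ {ω' | ∀ l ∈ S, X l ω' = X l ω}).real {ω' | (fieldSum X ω' : ℤ) = k}

/-- `sup_{i, j ∈ J} E[X_i^4 D(W | X_{C_j})]`. -/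
def supFourthSmooth {d : ℕ} {J : Finset (Fin d → ℤ)} {Ω : Type*} [MeasurableSpace Ω]
    (m : ℕ) (X : J → Ω → ℕ) (μ : Measure Ω) : ℝ :=
  ⨆ i : J, ⨆ j : J, ∫ ω, (X i ω : ℝ) ^ 4 * condSmoothness μ X (nbhdC m j) ω ∂μ

/-! ### Factorial moments and cumulants -/

/-- The factorial moment `E[W (W-1) ⋯ (W-k+1)]`. -/
def factMoment {Ω : Type*} [MeasurableSpace Ω] (μ : Measure Ω) (W : Ω → ℕ) (k : ℕ) : ℝ :=
  ∫ ω, ((W ω).descFactorial k : ℝ) ∂μ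

/-- `Γ₁(W)`, the mean. -/
def Gam1 {Ω : Type*} [MeasurableSpace Ω] (μ : Measure Ω) (W : Ω → ℕ) : ℝ :=
  factMoment μ W 1

/-- `Γ₂(W)`. -/
def Gam2 {Ω : Type*} [MeasurableSpace Ω] (μ : Measure Ω) (W : Ω → ℕ) : ℝ :=
  factMoment μ W 2 - factMoment μ W 1 ^ 2

/-- `Γ₃(W)`, normalised with the factor `1/2` (so that it equals `n p³` for `B(n,p)`). -/
def Gam3 {Ω : Type*} [MeasurableSpace Ω] (μ : Measure Ω) (W : Ω → ℕ) : ℝ :=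
  (factMoment μ W 3 - 3 * factMoment μ W 1 * factMoment μ W 2 + 2 * factMoment μ W 1 ^ 3) / 2

/-! ### The target (signed) distributions on `ℕ` -/

/-- Poisson weights; for `lam < 0` they form a signed measure of total mass one. -/
def poissonWeight (lam : ℝ) (k : ℕ) : ℝ :=
  Real.exp (-lam) * lam ^ k / (k.factorial : ℝ)

/-- Weights of `B(n, p)`. -/
def binomialWeight (n : ℕ) (p : ℝ) (k : ℕ) : ℝ :=
  (n.choose k : ℝ) * p ^ k * (1 - p) ^ (n - k)

/-- Weights of `NB(r, pbar)` with real `r`: `binom(r+k-1, k) pbar^r (1-pbar)^k`. -/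
def negBinomialWeight (r pbar : ℝ) (k : ℕ) : ℝ :=
  (∏ i ∈ Finset.range k, (r + i)) / (k.factorial : ℝ) * pbar ^ r * (1 - pbar) ^ k

/-- Convolution of weights on `ℕ`. -/
def convWeight (f g : ℕ → ℝ) (k : ℕ) : ℝ :=
  ∑ j ∈ Finset.range (k + 1), f j * g (k - j)

/-- `M₁ = B(n, p) * Poisson(lam)`. -/
def M1Weight (n : ℕ) (p lam : ℝ) : ℕ → ℝ :=
  convWeight (binomialWeight n p) (poissonWeight lam)

/-- `M₂ = NB(r, pbar) * Poisson(lam)`. -/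
def M2Weight (r pbar lam : ℝ) : ℕ → ℝ :=
  convWeight (negBinomialWeight r pbar) (poissonWeight lam)

/-- The total variation distance `sup_A |P(W ∈ A) - Q(A)|` between the law of `W` and the (possibly
signed) measure `Q` on `ℕ` with the absolutely summable weights `f`. -/
def dTV {Ω : Type*} [MeasurableSpace Ω] (μ : Measure Ω) (W : Ω → ℕ) (f : ℕ → ℝ) : ℝ :=
  ⨆ A : Set ℕ, |μ.real {ω | W ω ∈ A} - ∑' k, A.indicator f k|

/-! ### Choice of the parameters -/

/-- `(n, p, lam)` are the parameters of `M₁` matched to `G₁, G₂, G₃`, where `δ` is the fractional part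
lost by taking `n` to be an integer. -/
def MatchM1 (G₁ G₂ G₃ : ℝ) (n : ℕ) (p lam : ℝ) : Prop :=
  0 < p ∧ p < 1 ∧ ∃ δ : ℝ, 0 ≤ δ ∧ δ < 1 ∧
    n * p + lam = G₁ ∧ -((n + δ) * p ^ 2) = G₂ ∧ (n + δ) * p ^ 3 = G₃

/-- `(r, pbar, lam)` are the parameters of `M₂` matched to `G₁, G₂, G₃`. -/
def MatchM2 (G₁ G₂ G₃ r pbar lam : ℝ) : Prop :=
  0 < r ∧ 0 < pbar ∧ pbar < 1 ∧
    r * (1 - pbar) / pbar + lam = G₁ ∧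
    r * (1 - pbar) ^ 2 / pbar ^ 2 = G₂ ∧
    r * (1 - pbar) ^ 3 / pbar ^ 3 = G₃

/-- Assumption (H1). The absolute value only matters when `lam < 0`. -/
def H1 (n : ℕ) (p lam : ℝ) : Prop :=
  |lam| * p / (1 - p) < p / 2 * (⌊(n : ℝ) + lam / p⌋ : ℝ)

/-- Assumption (H2). The absolute value only matters when `lam < 0`. -/
def H2 (r pbar lam : ℝ) : Prop :=
  |lam| * (1 - pbar) < (r * (1 - pbar) + lam * pbar) / 2

/-- `θ₁`. -/
def theta1 (n : ℕ) (p lam : ℝ) : ℝ :=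
  |lam| / ((⌊(n : ℝ) + lam / p⌋ : ℝ) * (1 - p))

/-- `θ₂`. -/
def theta2 (r pbar lam : ℝ) : ℝ :=
  |lam| * (1 - pbar) / (r * (1 - pbar) + lam * pbar)

end

/-!
The proof is Stein's method with local expansions.

Let `W` be the sum of the field. Around each index, the sums over the balls of radius `m`, `2m` and
`3m` are nested so that every difference of `g` produced by Newton's formula can be evaluated at a
variable independent of the factor in front of it. This expands `E[W g(W)]` in terms of `E g(W + 1)`,
`E Δg(W + 1)` and `E Δ²g(W + 1)`; inserting polynomials identifies the coefficients as `Γ₁`, `Γ₂`, `Γ₃`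
(`field_expansion_three`, `field_expansion_two`). The remainder is a second difference of a bounded
function of `W`, whose conditional expectation given `X_{C_i}` is bounded by `D(W | X_{C_i})`
(`abs_integral_secondDiff_le`).

The remainders contain moments of lower degree, and moments of `X_j` that are not weighted by the
smoothness. Up to a constant depending on `d`, they are nevertheless at most `m^{3d} |J| S`, and this
quantity is at least one, unless it already dominates the mean (`errors_dichotomy`). Lower moments are
handled by integrality and by Hölder's inequality, unweighted ones by the fact that the moments of `X_a`
factor out of `E[X_a^4 D(W | X_{C_i})]` when `a` is far from `i`. If instead one summand dominates all
others, `S` is bounded below by testing the conditional law against a cosine (`fourth_moment_le`).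

On the side of the approximating measures, the negative binomial law is reversible for a birth-death
chain whose birth rates grow at most as fast as its death rates, and monotonicity of the tail ratios
gives sharp bounds for the increments of the Stein solution. Convolution with a Poisson weight perturbs
the Stein operator by a multiple `η` of the first difference, and the perturbed equation is solved by a
contraction; this is where the factor `1 - 2 θ` originates (`BirthDeath.exists_perturbed_solution`). In
the negative binomial case the operator kills all terms of the expansion of `E[W g(W)]` (`dTV_M2_le`).

In the binomial case the rates are those of a chain stopped at `N = ⌊n + λ / p⌋`, which need
not carry the approximating measure. The masses beyond `N` are estimated by Chebyshev's inequality for `W`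
and, for the signed measure, by Cauchy's estimate for the generating function (`dTV_M1_le`). They are of
order `1 / (q Γ₁)`, as is the effect of rounding `n + δ` to the integer `n`, and the lower bound for
`m^{3d} |J| S` absorbs them. In particular the last summands of the bounds for `M₁` are not needed. The
bounds in terms of cumulants follow from `1 / p̄ = (Γ₂ + Γ₃) / Γ₂` and `1 / q = |Γ₂| / |Γ₂ + Γ₃|`. When
`m^{3d} |J| S` dominates the mean, the trivial bound for solutions of the perturbed equation suffices.
-/

open ProbabilityTheory (IndepFun)

set_option linter.unusedSectionVars false

local notation "Δ" => fwdDiff (1 : ℤ)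

/-! ### Second differences of bounded functions -/

/-- `Φ` is the second forward difference of a function on `ℤ` bounded by `b`. -/
def IsSecondDiff (b : ℝ) (Φ : ℤ → ℝ) : Prop :=
  ∃ G : ℤ → ℝ, (∀ k, |G k| ≤ b) ∧ ∀ k, Φ k = Δ (Δ G) k

namespace IsSecondDiff

variable {b c : ℝ} {Φ Ψ : ℤ → ℝ}

lemma nonneg (h : IsSecondDiff b Φ) : 0 ≤ b := by
  obtain ⟨G, hG, -⟩ := h
  exact (abs_nonneg _).trans (hG 0)

lemma zero (hb : 0 ≤ b) : IsSecondDiff b (fun _ => 0) :=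
  ⟨fun _ => 0, by simpa using hb, by simp [fwdDiff]⟩

lemma of_bounded (h : ∀ k, |Φ k| ≤ b) : IsSecondDiff b (Δ (Δ Φ)) :=
  ⟨Φ, h, fun _ => rfl⟩

lemma mono (h : IsSecondDiff b Φ) (hbc : b ≤ c) : IsSecondDiff c Φ := by
  obtain ⟨G, hG, hΦ⟩ := h
  exact ⟨G, fun k => (hG k).trans hbc, hΦ⟩

lemma congr (h : IsSecondDiff b Φ) (hΨ : ∀ k, Ψ k = Φ k) : IsSecondDiff b Ψ := by
  obtain ⟨G, hG, hΦ⟩ := h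
  exact ⟨G, hG, fun k => (hΨ k).trans (hΦ k)⟩

lemma add (h : IsSecondDiff b Φ) (h' : IsSecondDiff c Ψ) :
    IsSecondDiff (b + c) (fun k => Φ k + Ψ k) := by
  obtain ⟨G, hG, hΦ⟩ := h
  obtain ⟨G', hG', hΨ⟩ := h'
  refine ⟨fun k => G k + G' k, fun k => (abs_add_le _ _).trans (add_le_add (hG k) (hG' k)),
    fun k => ?_⟩
  simp only [hΦ, hΨ, fwdDiff]
  ring

lemma const_mul (h : IsSecondDiff b Φ) {r : ℝ} (hr : 0 ≤ r) :
    IsSecondDiff (r * b) (fun k => r * Φ k) := by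
  obtain ⟨G, hG, hΦ⟩ := h
  refine ⟨fun k => r * G k, fun k => ?_, fun k => ?_⟩
  · rw [abs_mul, abs_of_nonneg hr]
    exact mul_le_mul_of_nonneg_left (hG k) hr
  · simp only [hΦ, fwdDiff]
    ring

lemma shift (h : IsSecondDiff b Φ) (s : ℤ) : IsSecondDiff b (fun k => Φ (k + s)) := by
  obtain ⟨G, hG, hΦ⟩ := h
  refine ⟨fun k => G (k + s), fun k => hG _, fun k => ?_⟩
  simp only [hΦ, fwdDiff, add_right_comm _ s]

lemma abs_le (h : IsSecondDiff b Φ) (k : ℤ) : |Φ k| ≤ 4 * b := by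
  obtain ⟨G, hG, hΦ⟩ := h
  rw [hΦ]
  have h0 := _root_.abs_le.1 (hG k)
  have h1 := _root_.abs_le.1 (hG (k + 1))
  have h2 := _root_.abs_le.1 (hG (k + 1 + 1))
  simp only [fwdDiff]
  rw [_root_.abs_le]
  constructor <;> linarith

/-- Newton's formula of order one: the remainder is a second difference. -/
lemma newton_one {F : ℤ → ℝ} (h : IsSecondDiff b (Δ F)) (u : ℕ) :
    IsSecondDiff (u * b) (fun w => F (w + u) - F w) := by
  induction u with
  | zero => simpa using zero le_rfl
  | succ u ih =>
    refine ((ih.add (h.shift u)).mono (le_of_eq ?_)).congr fun w => ?_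
    · push_cast; ring
    · simp only [fwdDiff]; push_cast; rw [add_assoc w]; ring

/-- Newton's formula of order two: the remainder is a second difference. -/
lemma newton_two {F : ℤ → ℝ} (h : IsSecondDiff b (Δ (Δ F))) (u : ℕ) :
    IsSecondDiff (u.choose 2 * b) (fun w => F (w + u) - F w - u * Δ F w) := by
  induction u with
  | zero => simpa using zero le_rfl
  | succ u ih =>
    refine ((ih.add (newton_one h u)).mono (le_of_eq ?_)).congr fun w => ?_
    · rw [Nat.choose_succ_succ' u 1]; push_cast; rw [Nat.choose_one_right]; ring
    · simp only [fwdDiff]; push_cast; rw [← add_assoc w]; ring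

/-- Newton's formula of order three: the remainder is a second difference. -/
lemma newton_three {F : ℤ → ℝ} (h : IsSecondDiff b (Δ (Δ (Δ F)))) (u : ℕ) :
    IsSecondDiff (u.choose 3 * b)
      (fun w => F (w + u) - F w - u * Δ F w - u.choose 2 * Δ (Δ F) w) := by
  induction u with
  | zero => simpa using zero le_rfl
  | succ u ih =>
    refine ((ih.add (newton_two h u)).mono (le_of_eq ?_)).congr fun w => ?_
    · rw [Nat.choose_succ_succ' u 2]; push_cast; ring
    · rw [Nat.choose_succ_succ' u 1, Nat.choose_one_right]
      simp only [fwdDiff]; push_cast; rw [← add_assoc w]; ring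

end IsSecondDiff

lemma HasSum.of_eq {β : Type*} {f g : β → ℝ} {a : ℝ} (h : HasSum f a) (hfg : ∀ k, g k = f k) :
    HasSum g a := by
  rwa [funext hfg]

/-! ### Smoothness of conditional laws -/

/-- Summation by parts moves the second difference from a bounded function onto `p`. There are no
boundary terms because `p` vanishes on the negative integers. -/
lemma abs_tsum_mul_le_secondDiffNorm {p : ℤ → ℝ} (hp0 : ∀ k, 0 ≤ p k) (hneg : ∀ k < 0, p k = 0)
    (hp : Summable fun k : ℕ => p k) {b : ℝ} {Φ : ℤ → ℝ} (hΦ : IsSecondDiff b Φ) :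
    |∑' k : ℕ, p k * Φ k| ≤ b * secondDiffNorm p := by
  have hb := hΦ.nonneg
  obtain ⟨G, hG, hΦ⟩ := hΦ
  have hm1 : p (-1) = 0 := hneg _ (by norm_num)
  have hm2 : p (-2) = 0 := hneg _ (by norm_num)
  have hsum : ∀ s : ℕ, Summable fun k : ℕ => p k * G (k + s) := fun s => by
    refine Summable.of_norm_bounded (hp.mul_right b) fun k => ?_
    rw [Real.norm_eq_abs, abs_mul, abs_of_nonneg (hp0 k)]
    exact mul_le_mul_of_nonneg_left (hG _) (hp0 k)
  have h0 : HasSum (fun k : ℕ => p k * G k) (∑' k : ℕ, p k * G k) := by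
    simpa using (hsum 0).hasSum
  have h1 : HasSum (fun k : ℕ => p ((k : ℤ) - 1) * G k) (∑' k : ℕ, p k * G (k + 1)) := by
    have := (hasSum_nat_add_iff (f := fun k : ℕ => p ((k : ℤ) - 1) * G k) 1
      (g := ∑' k : ℕ, p k * G (k + 1))).1 (by simpa using (hsum 1).hasSum)
    simpa [hm1] using this
  have h2 : HasSum (fun k : ℕ => p ((k : ℤ) - 2) * G k) (∑' k : ℕ, p k * G (k + 2)) := by
    have := (hasSum_nat_add_iff (f := fun k : ℕ => p ((k : ℤ) - 2) * G k) 2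
      (g := ∑' k : ℕ, p k * G (k + 2))).1 (by simpa using (hsum 2).hasSum)
    simpa [Finset.sum_range_succ, hm1, hm2] using this
  have hs1 : Summable fun k : ℕ => p ((k : ℤ) - 1) :=
    (summable_nat_add_iff 1).1 (by simpa using hp)
  have hs2 : Summable fun k : ℕ => p ((k : ℤ) - 2) :=
    (summable_nat_add_iff 2).1 (by simpa using hp)
  have hD : Summable fun k : ℕ =>
      |p ((k : ℤ) - 2) - 2 * p ((k : ℤ) - 1) + p (k : ℤ)| :=
    (((hs2.sub (hs1.mul_left 2)).add hp).abs)
  have key : ∑' k : ℕ, p k * Φ k =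
      ∑' k : ℕ, (p ((k : ℤ) - 2) - 2 * p ((k : ℤ) - 1) + p (k : ℤ)) * G k := by
    have e1 := ((h2.sub (h1.mul_left 2)).add h0)
    have e2 := (((hsum 2).hasSum.sub ((hsum 1).hasSum.mul_left 2)).add h0)
    have f1 : HasSum (fun k : ℕ =>
        (p ((k : ℤ) - 2) - 2 * p ((k : ℤ) - 1) + p (k : ℤ)) * G k) _ :=
      e1.of_eq fun k => by ring
    have f2 : HasSum (fun k : ℕ => p k * Φ k) _ := e2.of_eq fun k => by
      rw [hΦ]
      simp only [fwdDiff]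
      push_cast
      rw [add_assoc (k : ℤ) 1 1]
      norm_num
      ring
    rw [f1.tsum_eq, f2.tsum_eq]
    norm_num
  rw [key, secondDiffNorm, ← tsum_mul_left, ← Real.norm_eq_abs]
  refine tsum_of_norm_bounded (hD.mul_left b).hasSum fun k => ?_
  rw [Real.norm_eq_abs, abs_mul, mul_comm]
  exact mul_le_mul_of_nonneg_right (hG k) (abs_nonneg _)

lemma secondDiffNorm_nonneg (p : ℤ → ℝ) : 0 ≤ secondDiffNorm p :=
  tsum_nonneg fun _ => abs_nonneg _

lemma secondDiffNorm_le {p : ℤ → ℝ} (hp0 : ∀ k, 0 ≤ p k) (hneg : ∀ k < 0, p k = 0)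
    (hp : Summable fun k : ℕ => p k) : secondDiffNorm p ≤ 4 * ∑' k : ℕ, p k := by
  have hm1 : p (-1) = 0 := hneg _ (by norm_num)
  have hm2 : p (-2) = 0 := hneg _ (by norm_num)
  have h1 : HasSum (fun k : ℕ => p ((k : ℤ) - 1)) (∑' k : ℕ, p k) := by
    have := (hasSum_nat_add_iff (f := fun k : ℕ => p ((k : ℤ) - 1)) 1
      (g := ∑' k : ℕ, p k)).1 (by simpa using hp.hasSum)
    simpa [hm1] using this
  have h2 : HasSum (fun k : ℕ => p ((k : ℤ) - 2)) (∑' k : ℕ, p k) := by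
    have := (hasSum_nat_add_iff (f := fun k : ℕ => p ((k : ℤ) - 2)) 2
      (g := ∑' k : ℕ, p k)).1 (by simpa using hp.hasSum)
    simpa [Finset.sum_range_succ, hm1, hm2] using this
  have h3 := (h2.add (h1.mul_left 2)).add hp.hasSum
  have e : ∀ k : ℕ, |p ((k : ℤ) - 2) - 2 * p ((k : ℤ) - 1) + p (k : ℤ)| ≤
      p ((k : ℤ) - 2) + 2 * p ((k : ℤ) - 1) + p (k : ℤ) := fun k => by
    have a0 := hp0 (k : ℤ)
    have a1 := hp0 ((k : ℤ) - 1)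
    have a2 := hp0 ((k : ℤ) - 2)
    rw [abs_le]; constructor <;> linarith
  have := (Summable.of_nonneg_of_le (fun k => abs_nonneg _) e h3.summable).tsum_le_tsum e
    h3.summable
  rw [h3.tsum_eq] at this
  calc secondDiffNorm p ≤ _ := this
    _ = _ := by ring

section Conditioning

variable {Ω : Type*} [MeasurableSpace Ω] {α : Type*}

/-- The smoothness `D(W | x)` of the conditional law of `W` given a discrete variable `x`,
at the outcome `ω`. -/
noncomputable def condSmooth (μ : Measure Ω) (x : Ω → α) (W : Ω → ℕ) (ω : Ω) : ℝ :=
  secondDiffNorm fun k =>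
    (ProbabilityTheory.cond μ {ω' | x ω' = x ω}).real {ω' | (W ω' : ℤ) = k}

variable [Countable α] [MeasurableSpace α] [MeasurableSingletonClass α]
  {μ : Measure Ω} [IsProbabilityMeasure μ] {x : Ω → α} {W : Ω → ℕ}

lemma condSmooth_nonneg (ω : Ω) : 0 ≤ condSmooth μ x W ω := secondDiffNorm_nonneg _

lemma measureReal_int_eq_zero (ν : Measure Ω) (k : ℤ) (hk : k < 0) :
    ν.real {ω' | (W ω' : ℤ) = k} = 0 := by
  have : {ω' | (W ω' : ℤ) = k} = ∅ := by
    ext ω'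
    simp only [Set.mem_ofPred_eq, Set.mem_empty_iff_false, iff_false]
    omega
  simp [this]

/-- On a countable space an integral is the sum over the atoms. This replaces conditional
expectations by conditional probabilities given the values of a discrete variable. -/
lemma hasSum_integral_of_countable {β : Type*} [Countable β] [MeasurableSpace β]
    [MeasurableSingletonClass β] {ν : Measure β} {f : β → ℝ} (hf : Integrable f ν) :
    HasSum (fun a => ν.real {a} * f a) (∫ a, f a ∂ν) := by
  have h := hf
  rw [← Measure.sum_smul_dirac ν] at h
  have := hasSum_integral_measure h
  rw [Measure.sum_smul_dirac] at this
  refine this.of_eq fun a => ?_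
  rw [integral_smul_measure, integral_dirac, measureReal_def, smul_eq_mul]

lemma hasSum_measureReal_fiber (hW : Measurable W) (ν : Measure Ω) [IsFiniteMeasure ν] :
    HasSum (fun k : ℕ => ν.real {ω' | (W ω' : ℤ) = (k : ℤ)}) (ν.real Set.univ) := by
  have h := hasSum_integral_of_countable (ν := ν.map W) (f := fun _ => (1 : ℝ))
    (integrable_const _)
  have e : ∫ _, (1 : ℝ) ∂(ν.map W) = ν.real Set.univ := by
    rw [integral_const, smul_eq_mul, mul_one, map_measureReal_apply hW MeasurableSet.univ,
      Set.preimage_univ]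
  rw [e] at h
  refine h.of_eq fun k => ?_
  rw [map_measureReal_apply hW (measurableSet_singleton k), mul_one]
  congr 1
  ext ω'
  simp

/-- The trivial bound: the law of `W` has mass at most one and the second difference has
coefficients `1, -2, 1`. -/
lemma condSmooth_le (hW : Measurable W) (ω : Ω) :
    condSmooth μ x W ω ≤ 4 := by
  have hs := hasSum_measureReal_fiber hW (ProbabilityTheory.cond μ {ω' | x ω' = x ω})
  refine (secondDiffNorm_le (fun k => measureReal_nonneg)
    (fun k hk => measureReal_int_eq_zero _ k hk) hs.summable).trans ?_
  rw [hs.tsum_eq]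
  have : (ProbabilityTheory.cond μ {ω' | x ω' = x ω}).real Set.univ ≤ 1 := measureReal_le_one
  linarith

lemma measurable_condSmooth (hx : Measurable x) : Measurable (condSmooth μ x W) :=
  (Measurable.of_discrete (f := fun a : α => secondDiffNorm fun k =>
    (ProbabilityTheory.cond μ {ω' | x ω' = a}).real {ω' | (W ω' : ℤ) = k})).comp hx

lemma integrable_mul_condSmooth (hx : Measurable x) (hW : Measurable W) {Y : Ω → ℝ}
    (hY : Integrable Y μ) : Integrable (fun ω => Y ω * condSmooth μ x W ω) μ :=
  hY.mul_bdd (c := 4) (measurable_condSmooth hx).aestronglyMeasurable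
    (Filter.Eventually.of_forall fun ω => by
      rw [Real.norm_eq_abs, abs_of_nonneg (condSmooth_nonneg ω)]
      exact condSmooth_le hW ω)

lemma integrable_secondDiff (hx : Measurable x) (hW : Measurable W) {Φ : α → ℤ → ℝ} {b : α → ℝ}
    (hΦ : ∀ a, IsSecondDiff (b a) (Φ a)) (hb : Integrable (fun ω => b (x ω)) μ) :
    Integrable (fun ω => Φ (x ω) (W ω)) μ := by
  refine (hb.const_mul 4).mono' ?_ (Filter.Eventually.of_forall fun ω => (hΦ (x ω)).abs_le _)
  exact ((Measurable.of_discrete (f := fun z : α × ℕ => Φ z.1 z.2)).comp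
    (hx.prodMk hW)).aestronglyMeasurable

/-- Conditionally on `x`, the expectation of a second difference of a bounded function of `W` is at
most the bound times the smoothness of the conditional law of `W`. -/
lemma abs_integral_secondDiff_le (hx : Measurable x) (hW : Measurable W) {Φ : α → ℤ → ℝ}
    {b : α → ℝ} (hΦ : ∀ a, IsSecondDiff (b a) (Φ a)) (hb : Integrable (fun ω => b (x ω)) μ) :
    |∫ ω, Φ (x ω) (W ω) ∂μ| ≤ ∫ ω, b (x ω) * condSmooth μ x W ω ∂μ := by
  have hxW : Measurable fun ω => (x ω, W ω) := hx.prodMk hW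
  set d : α → ℝ := fun a => secondDiffNorm fun k =>
    (ProbabilityTheory.cond μ {ω' | x ω' = a}).real {ω' | (W ω' : ℤ) = k} with hd
  have hR : ∫ ω, b (x ω) * condSmooth μ x W ω ∂μ = ∫ a, b a * d a ∂(μ.map x) := by
    rw [integral_map hx.aemeasurable
      (Measurable.of_discrete (f := fun a => b a * d a)).aestronglyMeasurable]
    rfl
  have hL : ∫ ω, Φ (x ω) (W ω) ∂μ = ∫ z, Φ z.1 z.2 ∂(μ.map fun ω => (x ω, W ω)) := by
    rw [integral_map hxW.aemeasurable
      (Measurable.of_discrete (f := fun z : α × ℕ => Φ z.1 z.2)).aestronglyMeasurable]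
  have hiR : Integrable (fun a => b a * d a) (μ.map x) := by
    rw [integrable_map_measure
      (Measurable.of_discrete (f := fun a => b a * d a)).aestronglyMeasurable hx.aemeasurable]
    exact integrable_mul_condSmooth hx hW hb
  have hiL : Integrable (fun z : α × ℕ => Φ z.1 z.2) (μ.map fun ω => (x ω, W ω)) := by
    rw [integrable_map_measure
      (Measurable.of_discrete (f := fun z : α × ℕ => Φ z.1 z.2)).aestronglyMeasurable
      hxW.aemeasurable]
    exact integrable_secondDiff hx hW hΦ hb
  have hsL := hasSum_integral_of_countable hiL
  have hsR := hasSum_integral_of_countable hiR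
  rw [hR, hL, ← hsL.tsum_eq, hsL.summable.tsum_prod' fun a => hsL.summable.comp_injective
    (Prod.mk_right_injective a), ← Real.norm_eq_abs]
  refine tsum_of_norm_bounded hsR fun a => ?_
  set κ := ProbabilityTheory.cond μ {ω' | x ω' = a} with hκ
  have hms : MeasurableSet {ω' | x ω' = a} := hx (measurableSet_singleton a)
  have hP : ∀ k : ℕ, (μ.map fun ω => (x ω, W ω)).real {(a, k)} =
      (μ.map x).real {a} * κ.real {ω' | (W ω' : ℤ) = (k : ℤ)} := fun k => by
    rw [map_measureReal_apply hxW (measurableSet_singleton _),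
      map_measureReal_apply hx (measurableSet_singleton _), measureReal_def, measureReal_def,
      measureReal_def, ← ENNReal.toReal_mul, mul_comm]
    congr 1
    rw [hκ]
    have := ProbabilityTheory.cond_mul_eq_inter hms {ω' | (W ω' : ℤ) = (k : ℤ)} μ
    refine Eq.trans ?_ this.symm
    congr 1
    ext ω'
    simp [Prod.ext_iff]
  have hk := hasSum_measureReal_fiber hW κ
  have hmain := abs_tsum_mul_le_secondDiffNorm (p := fun k : ℤ => κ.real {ω' | (W ω' : ℤ) = k})
    (fun k => measureReal_nonneg) (fun k hk => measureReal_int_eq_zero _ k hk) hk.summable (hΦ a)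
  calc ‖∑' k : ℕ, (μ.map fun ω => (x ω, W ω)).real {(a, k)} * Φ a k‖
      = ‖(μ.map x).real {a} * ∑' k : ℕ, κ.real {ω' | (W ω' : ℤ) = (k : ℤ)} * Φ a k‖ := by
        rw [← tsum_mul_left]
        congr 2
        funext k
        rw [hP, mul_assoc]
    _ = (μ.map x).real {a} * |∑' k : ℕ, κ.real {ω' | (W ω' : ℤ) = (k : ℤ)} * Φ a k| := by
        rw [norm_mul, Real.norm_eq_abs, Real.norm_eq_abs, abs_of_nonneg measureReal_nonneg]
    _ ≤ _ := mul_le_mul_of_nonneg_left hmain measureReal_nonneg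

end Conditioning

/-! ### Local expansions -/

/-- `F` grows at most like `k ^ s` on the nonnegative integers. -/
def HasPolyGrowth (s : ℕ) (F : ℤ → ℝ) : Prop :=
  ∃ C : ℝ, 0 ≤ C ∧ ∀ k : ℕ, |F k| ≤ C * (1 + k) ^ s

/-- Discrete integration raises the order of growth by one. Hence a function whose third difference is
a second difference of a bounded function grows at most cubically, which the fourth moment allows. -/
lemma HasPolyGrowth.of_fwdDiff {s : ℕ} {F : ℤ → ℝ} (h : HasPolyGrowth s (Δ F)) :
    HasPolyGrowth (s + 1) F := by
  obtain ⟨C, hC, h⟩ := h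
  have key : ∀ k : ℕ, |F k| ≤ |F 0| + k * (C * (1 + k) ^ s) := by
    intro k
    induction k with
    | zero => simp
    | succ k ih =>
      have h1 : F ((k + 1 : ℕ) : ℤ) = F k + Δ F k := by simp [fwdDiff]
      have h2 : C * (1 + (k : ℝ)) ^ s ≤ C * (1 + ((k + 1 : ℕ) : ℝ)) ^ s := by
        push_cast; gcongr; linarith
      have h3 := mul_le_mul_of_nonneg_left h2 (Nat.cast_nonneg (α := ℝ) k)
      rw [h1]
      refine (abs_add_le _ _).trans ((add_le_add ih (h k)).trans ?_)
      push_cast at h2 h3 ⊢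
      nlinarith
  refine ⟨|F 0| + C, by positivity, fun k => (key k).trans ?_⟩
  have h1 : (1 : ℝ) ≤ (1 + k) ^ (s + 1) := one_le_pow₀ (by linarith [Nat.cast_nonneg (α := ℝ) k])
  have h2 : (k : ℝ) * (C * (1 + k) ^ s) ≤ C * (1 + k) ^ (s + 1) := by
    rw [pow_succ]
    have : 0 ≤ C * (1 + (k : ℝ)) ^ s := by positivity
    nlinarith
  have h3 := mul_le_mul_of_nonneg_left h1 (abs_nonneg (F 0))
  rw [add_mul]
  linarith

lemma HasPolyGrowth.of_isSecondDiff {b : ℝ} {F : ℤ → ℝ} (h : IsSecondDiff b F) :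
    HasPolyGrowth 0 F :=
  ⟨4 * b, by have := h.nonneg; positivity, fun k => by simpa using h.abs_le k⟩

lemma HasPolyGrowth.mono {s t : ℕ} {F : ℤ → ℝ} (h : HasPolyGrowth s F) (hst : s ≤ t) :
    HasPolyGrowth t F := by
  obtain ⟨C, hC, h⟩ := h
  refine ⟨C, hC, fun k => (h k).trans ?_⟩
  gcongr
  linarith [Nat.cast_nonneg (α := ℝ) k]

/-- A nonnegative integer variable `W` with fourth moment together with three nested partial sums
`U₁ ≤ U₂ ≤ U₃ ≤ W`. The partial sums are functions of the value of one discrete variable `x`, the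
field on the largest neighbourhood, so that conditioning on `x` fixes all of them. -/
structure NestedSums {Ω : Type*} [MeasurableSpace Ω] {α : Type*} [MeasurableSpace α]
    (μ : Measure Ω) (x : Ω → α) (W : Ω → ℕ) (U₁ U₂ U₃ : α → ℕ) : Prop where
  measurable_x : Measurable x
  measurable_W : Measurable W
  integrable_pow : Integrable (fun ω => (1 + (W ω : ℝ)) ^ 4) μ
  le₁₂ : ∀ a, U₁ a ≤ U₂ a
  le₂₃ : ∀ a, U₂ a ≤ U₃ a
  le_W : ∀ ω, U₃ (x ω) ≤ W ω

lemma integral_add_five {Ω : Type*} [MeasurableSpace Ω] {μ : Measure Ω} {f₀ f₁ f₂ f₃ f₄ : Ω → ℝ}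
    (h₀ : Integrable f₀ μ) (h₁ : Integrable f₁ μ) (h₂ : Integrable f₂ μ) (h₃ : Integrable f₃ μ)
    (h₄ : Integrable f₄ μ) :
    ∫ ω, (f₀ ω + (f₁ ω + f₂ ω + f₃ ω + f₄ ω)) ∂μ = (∫ ω, f₀ ω ∂μ) +
      ((∫ ω, f₁ ω ∂μ) + (∫ ω, f₂ ω ∂μ) + (∫ ω, f₃ ω ∂μ) + ∫ ω, f₄ ω ∂μ) := by
  have h₁₂ : Integrable (fun ω => f₁ ω + f₂ ω) μ := h₁.add h₂
  have h₁₃ : Integrable (fun ω => f₁ ω + f₂ ω + f₃ ω) μ := h₁₂.add h₃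
  have h₁₄ : Integrable (fun ω => f₁ ω + f₂ ω + f₃ ω + f₄ ω) μ := h₁₃.add h₄
  rw [integral_add h₀ h₁₄, integral_add h₁₃ h₄, integral_add h₁₂ h₃, integral_add h₁ h₂]

namespace NestedSums

variable {Ω : Type*} [MeasurableSpace Ω] {α : Type*} [Countable α] [MeasurableSpace α]
  [MeasurableSingletonClass α] {μ : Measure Ω} [IsProbabilityMeasure μ] {x : Ω → α} {W : Ω → ℕ}
  {U₁ U₂ U₃ : α → ℕ} (N : NestedSums μ x W U₁ U₂ U₃)

include N in
lemma integrable_mul {r s : ℕ} (hrs : r + s ≤ 4) {Y : α → ℝ} {F : ℤ → ℝ}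
    (hY : ∀ a, |Y a| ≤ (1 + (U₃ a : ℝ)) ^ r) (hF : HasPolyGrowth s F) {V : α → ℕ}
    (hV : ∀ a, V a ≤ U₃ a) :
    Integrable (fun ω => Y (x ω) * F ((W ω : ℤ) - V (x ω) + 1)) μ := by
  obtain ⟨C, hC, hF⟩ := hF
  refine (N.integrable_pow.const_mul (C * 2 ^ s)).mono' ?_ (Filter.Eventually.of_forall fun ω => ?_)
  · exact ((Measurable.of_discrete (f := fun z : α × ℕ => Y z.1 * F ((z.2 : ℤ) - V z.1 + 1))).comp
      (N.measurable_x.prodMk N.measurable_W)).aestronglyMeasurable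
  · have hle := (hV (x ω)).trans (N.le_W ω)
    have e : (W ω : ℤ) - V (x ω) + 1 = ((W ω - V (x ω) + 1 : ℕ) : ℤ) := by
      push_cast [Nat.cast_sub hle]; ring
    have hW0 : (0 : ℝ) ≤ W ω := Nat.cast_nonneg _
    have h1 : |F ((W ω : ℤ) - V (x ω) + 1)| ≤ C * (2 * (1 + (W ω : ℝ))) ^ s := by
      rw [e]
      refine (hF _).trans ?_
      have : ((W ω - V (x ω) + 1 : ℕ) : ℝ) ≤ W ω + 1 := by exact_mod_cast by omega
      gcongr
      linarith
    have h2 : |Y (x ω)| ≤ (1 + (W ω : ℝ)) ^ r := by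
      refine (hY _).trans ?_
      have : (U₃ (x ω) : ℝ) ≤ W ω := by exact_mod_cast N.le_W ω
      gcongr
    rw [Real.norm_eq_abs, abs_mul]
    calc |Y (x ω)| * |F ((W ω : ℤ) - V (x ω) + 1)|
        ≤ (1 + (W ω : ℝ)) ^ r * (C * (2 * (1 + (W ω : ℝ))) ^ s) := by gcongr
      _ = C * 2 ^ s * (1 + (W ω : ℝ)) ^ (r + s) := by rw [mul_pow, pow_add]; ring
      _ ≤ C * 2 ^ s * (1 + (W ω : ℝ)) ^ 4 := by
        gcongr
        linarith

include N in
lemma integrable_left {r : ℕ} (hr : r ≤ 4) {Y : α → ℝ}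
    (hY : ∀ a, |Y a| ≤ (1 + (U₃ a : ℝ)) ^ r) : Integrable (fun ω => Y (x ω)) μ := by
  have := N.integrable_mul (r := r) (s := 0) (by omega) hY (F := fun _ => 1)
    ⟨1, zero_le_one, fun k => by simp⟩ (V := U₃) fun a => le_rfl
  simpa using this

include N in
lemma integral_mul_of_indep {Y : α → ℝ} {F : ℤ → ℝ} {V : α → ℕ}
    (h : IndepFun (fun ω => Y (x ω)) (fun ω => (W ω : ℤ) - V (x ω)) μ) :
    ∫ ω, Y (x ω) * F ((W ω : ℤ) - V (x ω) + 1) ∂μ =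
      (∫ ω, Y (x ω) ∂μ) * ∫ ω, F ((W ω : ℤ) - V (x ω) + 1) ∂μ := by
  have h' : IndepFun (fun ω => Y (x ω)) (fun ω => F ((W ω : ℤ) - V (x ω) + 1)) μ :=
    h.comp measurable_id (ψ := fun k => F (k + 1)) Measurable.of_discrete
  refine h'.integral_fun_mul_eq_mul_integral ?_ ?_
  · exact (Measurable.of_discrete.comp N.measurable_x).aestronglyMeasurable
  · exact ((Measurable.of_discrete (f := fun z : α × ℕ => F ((z.2 : ℤ) - V z.1 + 1))).comp
      (N.measurable_x.prodMk N.measurable_W)).aestronglyMeasurable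

include N in
/-- The third order expansion of `E[Y g(W - U₁ + 1 + u)]`, for `Y` and `u` depending on a small
neighbourhood: each difference of `g` is evaluated at a variable independent of its factor. -/
lemma expansion_three {g : ℤ → ℝ} {H : ℝ} (hg : IsSecondDiff H (Δ (Δ (Δ g)))) {Y u : α → ℕ}
    (hY : ∀ a, Y a ≤ 1 + U₃ a) (hu : ∀ a, u a ≤ U₁ a)
    (h₁ : IndepFun (fun ω => Y (x ω)) (fun ω => (W ω : ℤ) - U₁ (x ω)) μ)
    (h₂ : IndepFun (fun ω => (Y (x ω), u (x ω))) (fun ω => (W ω : ℤ) - U₂ (x ω)) μ)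
    (h₃ : IndepFun (fun ω => (Y (x ω), u (x ω), U₂ (x ω) - U₁ (x ω)))
      (fun ω => (W ω : ℤ) - U₃ (x ω)) μ) :
    |(∫ ω, (Y (x ω) : ℝ) * g ((W ω : ℤ) - U₁ (x ω) + 1 + u (x ω)) ∂μ) -
      ((∫ ω, (Y (x ω) : ℝ) ∂μ) * (∫ ω, g ((W ω : ℤ) - U₁ (x ω) + 1) ∂μ)
      + (∫ ω, (Y (x ω) * u (x ω) : ℝ) ∂μ) * (∫ ω, Δ g ((W ω : ℤ) - U₂ (x ω) + 1) ∂μ)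
      + (∫ ω, (Y (x ω) * u (x ω) * ((U₂ (x ω) - U₁ (x ω) : ℕ) : ℝ) : ℝ) ∂μ) *
          (∫ ω, Δ (Δ g) ((W ω : ℤ) - U₃ (x ω) + 1) ∂μ)
      + (∫ ω, (Y (x ω) * ((u (x ω)).choose 2 : ℝ) : ℝ) ∂μ) *
          (∫ ω, Δ (Δ g) ((W ω : ℤ) - U₂ (x ω) + 1) ∂μ))|
    ≤ 4 * H * ∫ ω, (Y (x ω) : ℝ) * (U₃ (x ω) : ℝ) ^ 3 * condSmooth μ x W ω ∂μ := by
  have hH := hg.nonneg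
  have hY' : ∀ a, |(Y a : ℝ)| ≤ (1 + (U₃ a : ℝ)) ^ 1 := fun a => by
    rw [Nat.abs_cast, pow_one]; exact_mod_cast hY a
  have hU1 : ∀ a, (U₁ a : ℝ) ≤ 1 + U₃ a := fun a => by
    have : (U₁ a : ℝ) ≤ U₃ a := by exact_mod_cast (N.le₁₂ a).trans (N.le₂₃ a)
    linarith
  have hu' : ∀ a, (u a : ℝ) ≤ 1 + U₃ a := fun a => by
    have : (u a : ℝ) ≤ U₁ a := by exact_mod_cast hu a
    linarith [hU1 a]
  have hv' : ∀ a, ((U₂ a - U₁ a : ℕ) : ℝ) ≤ 1 + U₃ a := fun a => by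
    have h := N.le₂₃ a
    have : ((U₂ a - U₁ a : ℕ) : ℝ) ≤ U₃ a := by exact_mod_cast by omega
    linarith
  have hYn : ∀ a, (Y a : ℝ) ≤ 1 + U₃ a := fun a => by exact_mod_cast hY a
  have b1 : ∀ a, |(Y a * u a : ℝ)| ≤ (1 + (U₃ a : ℝ)) ^ 2 := fun a => by
    rw [abs_of_nonneg (by positivity), pow_two]
    exact mul_le_mul (hYn a) (hu' a) (by positivity) (by positivity)
  have b2 : ∀ a, |(Y a * u a * ((U₂ a - U₁ a : ℕ) : ℝ) : ℝ)| ≤ (1 + (U₃ a : ℝ)) ^ 3 := fun a => by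
    rw [abs_of_nonneg (by positivity), pow_succ]
    refine mul_le_mul ((le_abs_self _).trans (b1 a)) (hv' a) (by positivity) (by positivity)
  have b3 : ∀ a, |(Y a * ((u a).choose 2 : ℝ) : ℝ)| ≤ (1 + (U₃ a : ℝ)) ^ 3 := fun a => by
    have : ((u a).choose 2 : ℝ) ≤ (1 + (U₃ a : ℝ)) ^ 2 := by
      refine le_trans (b := ((u a : ℝ)) ^ 2) (by exact_mod_cast Nat.choose_le_pow _ _) ?_
      exact pow_le_pow_left₀ (by positivity) (hu' a) 2
    rw [abs_of_nonneg (by positivity), pow_succ']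
    exact mul_le_mul (hYn a) this (by positivity) (by positivity)
  have g0 : HasPolyGrowth 1 (Δ (Δ g)) := (HasPolyGrowth.of_isSecondDiff hg).of_fwdDiff
  have g1 : HasPolyGrowth 2 (Δ g) := g0.of_fwdDiff
  have g2 : HasPolyGrowth 3 g := g1.of_fwdDiff
  have i0 := N.integrable_mul (by norm_num) hY' g2 (V := U₁) fun a => (N.le₁₂ a).trans (N.le₂₃ a)
  have i1 := N.integrable_mul (by norm_num) b1 g1 (V := U₂) N.le₂₃
  have i2 := N.integrable_mul (by norm_num) b2 g0 (V := U₃) fun a => le_rfl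
  have i3 := N.integrable_mul (by norm_num) b3 g0 (V := U₂) N.le₂₃
  have e0 := N.integral_mul_of_indep (Y := fun a => (Y a : ℝ)) (F := g) (V := U₁)
    (h₁.comp (φ := fun n : ℕ => (n : ℝ)) Measurable.of_discrete measurable_id)
  have e1 := N.integral_mul_of_indep (Y := fun a => (Y a * u a : ℝ)) (F := Δ g) (V := U₂)
    (h₂.comp (φ := fun n : ℕ × ℕ => (n.1 * n.2 : ℝ)) Measurable.of_discrete measurable_id)
  have e2 := N.integral_mul_of_indep (Y := fun a => (Y a * u a * ((U₂ a - U₁ a : ℕ) : ℝ) : ℝ))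
    (F := Δ (Δ g)) (V := U₃)
    (h₃.comp (φ := fun n : ℕ × ℕ × ℕ => (n.1 * n.2.1 * n.2.2 : ℝ)) Measurable.of_discrete
      measurable_id)
  have e3 := N.integral_mul_of_indep (Y := fun a => (Y a * ((u a).choose 2 : ℝ) : ℝ))
    (F := Δ (Δ g)) (V := U₂)
    (h₂.comp (φ := fun n : ℕ × ℕ => (n.1 * (n.2.choose 2 : ℝ) : ℝ)) Measurable.of_discrete
      measurable_id)
  set Φ : α → ℤ → ℝ := fun a w => Y a * g (w - U₁ a + 1 + u a) -
    (Y a * g (w - U₁ a + 1) + Y a * u a * Δ g (w - U₂ a + 1)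
      + Y a * u a * ((U₂ a - U₁ a : ℕ) : ℝ) * Δ (Δ g) (w - U₃ a + 1)
      + Y a * ((u a).choose 2 : ℝ) * Δ (Δ g) (w - U₂ a + 1)) with hΦdef
  have hΦ : ∀ a, IsSecondDiff (4 * H * (Y a * (U₃ a : ℝ) ^ 3)) (Φ a) := by
    intro a
    have p1 := (hg.newton_three (u a)).shift (-(U₁ a : ℤ) + 1)
    have p2 := ((IsSecondDiff.newton_two (F := Δ g) hg (U₂ a - U₁ a)).shift
      (-(U₂ a : ℤ) + 1)).const_mul (Nat.cast_nonneg (u a))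
    have p3 := ((IsSecondDiff.newton_one (F := Δ (Δ g)) hg (U₃ a - U₂ a)).shift
      (-(U₃ a : ℤ) + 1)).const_mul (r := u a * ((U₂ a - U₁ a : ℕ) : ℝ)) (by positivity)
    have p4 := ((IsSecondDiff.newton_one (F := Δ (Δ g)) hg (U₂ a - U₁ a)).shift
      (-(U₂ a : ℤ) + 1)).const_mul (r := ((u a).choose 2 : ℝ)) (by positivity)
    have p := (((p1.add p2).add p3).add p4).const_mul (Nat.cast_nonneg (α := ℝ) (Y a))
    have h12 := N.le₁₂ a
    have h23 := N.le₂₃ a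
    refine (p.mono ?_).congr fun w => ?_
    · have c0 : (u a : ℝ) ≤ U₃ a := by exact_mod_cast (hu a).trans (h12.trans h23)
      have c1 : ((U₂ a - U₁ a : ℕ) : ℝ) ≤ U₃ a := by exact_mod_cast by omega
      have c2 : ((U₃ a - U₂ a : ℕ) : ℝ) ≤ U₃ a := by exact_mod_cast by omega
      have d1 : ((u a).choose 3 : ℝ) ≤ (U₃ a : ℝ) ^ 3 :=
        le_trans (b := ((u a : ℝ)) ^ 3) (by exact_mod_cast Nat.choose_le_pow _ _)
          (pow_le_pow_left₀ (by positivity) c0 3)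
      have d2 : ((u a).choose 2 : ℝ) ≤ (U₃ a : ℝ) ^ 2 :=
        le_trans (b := ((u a : ℝ)) ^ 2) (by exact_mod_cast Nat.choose_le_pow _ _)
          (pow_le_pow_left₀ (by positivity) c0 2)
      have d3 : (((U₂ a - U₁ a).choose 2 : ℕ) : ℝ) ≤ (U₃ a : ℝ) ^ 2 :=
        le_trans (b := (((U₂ a - U₁ a : ℕ) : ℝ)) ^ 2) (by exact_mod_cast Nat.choose_le_pow _ _)
          (pow_le_pow_left₀ (by positivity) c1 2)
      have f1 : (u a : ℝ) * ((U₂ a - U₁ a).choose 2 : ℝ) ≤ (U₃ a : ℝ) ^ 3 := by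
        rw [pow_succ']; gcongr
      have f2 : (u a : ℝ) * ((U₂ a - U₁ a : ℕ) : ℝ) * ((U₃ a - U₂ a : ℕ) : ℝ) ≤
          (U₃ a : ℝ) ^ 3 := by
        rw [pow_succ, pow_two]; gcongr
      have f3 : ((u a).choose 2 : ℝ) * ((U₂ a - U₁ a : ℕ) : ℝ) ≤ (U₃ a : ℝ) ^ 3 := by
        rw [pow_succ]; gcongr
      have : ((u a).choose 3 : ℝ) * H + u a * (((U₂ a - U₁ a).choose 2 : ℝ) * H)
          + u a * ((U₂ a - U₁ a : ℕ) : ℝ) * (((U₃ a - U₂ a : ℕ) : ℝ) * H)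
          + ((u a).choose 2 : ℝ) * (((U₂ a - U₁ a : ℕ) : ℝ) * H) ≤ 4 * (U₃ a : ℝ) ^ 3 * H := by
        nlinarith
      calc _ ≤ (Y a : ℝ) * (4 * (U₃ a : ℝ) ^ 3 * H) :=
            mul_le_mul_of_nonneg_left this (by positivity)
        _ = _ := by ring
    · have s1 : w + (-(U₂ a : ℤ) + 1) + ((U₂ a - U₁ a : ℕ) : ℤ) = w - U₁ a + 1 := by
        push_cast [Nat.cast_sub h12]; ring
      have s2 : w + (-(U₃ a : ℤ) + 1) + ((U₃ a - U₂ a : ℕ) : ℤ) = w - U₂ a + 1 := by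
        push_cast [Nat.cast_sub h23]; ring
      have s3 : w + (-(U₁ a : ℤ) + 1) = w - U₁ a + 1 := by ring
      have s4 : w + (-(U₂ a : ℤ) + 1) = w - U₂ a + 1 := by ring
      have s5 : w + (-(U₃ a : ℤ) + 1) = w - U₃ a + 1 := by ring
      simp only [hΦdef, s1, s2]
      rw [s3, s4, s5]
      ring
  have hb : Integrable (fun ω => 4 * H * (Y (x ω) * (U₃ (x ω) : ℝ) ^ 3)) μ := by
    refine (N.integrable_left (r := 4) le_rfl (Y := fun a => Y a * (U₃ a : ℝ) ^ 3)
      fun a => ?_).const_mul (4 * H)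
    rw [abs_of_nonneg (by positivity)]
    calc (Y a : ℝ) * (U₃ a : ℝ) ^ 3 ≤ (1 + (U₃ a : ℝ)) * (1 + (U₃ a : ℝ)) ^ 3 := by
          gcongr
          · exact hYn a
          · linarith
      _ = _ := by ring
  have hI := integrable_secondDiff N.measurable_x N.measurable_W hΦ hb
  have hle := abs_integral_secondDiff_le N.measurable_x N.measurable_W hΦ hb
  have hmain : (∫ ω, (Y (x ω) : ℝ) * g ((W ω : ℤ) - U₁ (x ω) + 1 + u (x ω)) ∂μ) =
      (∫ ω, Φ (x ω) (W ω) ∂μ) + ((∫ ω, (Y (x ω) : ℝ) * g ((W ω : ℤ) - U₁ (x ω) + 1) ∂μ)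
      + (∫ ω, (Y (x ω) * u (x ω) : ℝ) * Δ g ((W ω : ℤ) - U₂ (x ω) + 1) ∂μ)
      + (∫ ω, (Y (x ω) * u (x ω) * ((U₂ (x ω) - U₁ (x ω) : ℕ) : ℝ) : ℝ) *
          Δ (Δ g) ((W ω : ℤ) - U₃ (x ω) + 1) ∂μ)
      + (∫ ω, (Y (x ω) * ((u (x ω)).choose 2 : ℝ) : ℝ) *
          Δ (Δ g) ((W ω : ℤ) - U₂ (x ω) + 1) ∂μ)) := by
    rw [← integral_add_five hI i0 i1 i2 i3]
    refine integral_congr_ae (Filter.Eventually.of_forall fun ω => ?_)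
    simp only [hΦdef]
    ring
  rw [e0, e1, e2, e3] at hmain
  rw [hmain, add_sub_cancel_right]
  refine hle.trans (le_of_eq ?_)
  rw [← integral_const_mul]
  refine integral_congr_ae (Filter.Eventually.of_forall fun ω => ?_)
  simp only
  ring

include N in
/-- The second order expansion of `E[Y g(W - U₁ + 1 + u)]`. -/
lemma expansion_two {g : ℤ → ℝ} {H : ℝ} (hg : IsSecondDiff H (Δ (Δ g))) {Y u : α → ℕ}
    (hY : ∀ a, Y a ≤ 1 + U₃ a) (hu : ∀ a, u a ≤ U₁ a)
    (h₁ : IndepFun (fun ω => Y (x ω)) (fun ω => (W ω : ℤ) - U₁ (x ω)) μ)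
    (h₂ : IndepFun (fun ω => (Y (x ω), u (x ω))) (fun ω => (W ω : ℤ) - U₂ (x ω)) μ) :
    |(∫ ω, (Y (x ω) : ℝ) * g ((W ω : ℤ) - U₁ (x ω) + 1 + u (x ω)) ∂μ) -
      ((∫ ω, (Y (x ω) : ℝ) ∂μ) * (∫ ω, g ((W ω : ℤ) - U₁ (x ω) + 1) ∂μ)
      + (∫ ω, (Y (x ω) * u (x ω) : ℝ) ∂μ) * (∫ ω, Δ g ((W ω : ℤ) - U₂ (x ω) + 1) ∂μ))|
    ≤ 2 * H * ∫ ω, (Y (x ω) : ℝ) * (U₃ (x ω) : ℝ) ^ 2 * condSmooth μ x W ω ∂μ := by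
  have hH := hg.nonneg
  have hYn : ∀ a, (Y a : ℝ) ≤ 1 + U₃ a := fun a => by exact_mod_cast hY a
  have hY' : ∀ a, |(Y a : ℝ)| ≤ (1 + (U₃ a : ℝ)) ^ 1 := fun a => by
    rw [Nat.abs_cast, pow_one]; exact hYn a
  have hu' : ∀ a, (u a : ℝ) ≤ U₃ a := fun a => by
    exact_mod_cast (hu a).trans ((N.le₁₂ a).trans (N.le₂₃ a))
  have b1 : ∀ a, |(Y a * u a : ℝ)| ≤ (1 + (U₃ a : ℝ)) ^ 2 := fun a => by
    rw [abs_of_nonneg (by positivity), pow_two]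
    exact mul_le_mul (hYn a) (by linarith [hu' a]) (by positivity) (by positivity)
  have g1 : HasPolyGrowth 1 (Δ g) := (HasPolyGrowth.of_isSecondDiff hg).of_fwdDiff
  have g2 : HasPolyGrowth 2 g := g1.of_fwdDiff
  have i0 := N.integrable_mul (by norm_num) hY' g2 (V := U₁) fun a => (N.le₁₂ a).trans (N.le₂₃ a)
  have i1 := N.integrable_mul (by norm_num) b1 g1 (V := U₂) N.le₂₃
  have e0 := N.integral_mul_of_indep (Y := fun a => (Y a : ℝ)) (F := g) (V := U₁)
    (h₁.comp (φ := fun n : ℕ => (n : ℝ)) Measurable.of_discrete measurable_id)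
  have e1 := N.integral_mul_of_indep (Y := fun a => (Y a * u a : ℝ)) (F := Δ g) (V := U₂)
    (h₂.comp (φ := fun n : ℕ × ℕ => (n.1 * n.2 : ℝ)) Measurable.of_discrete measurable_id)
  set Φ : α → ℤ → ℝ := fun a w => Y a * g (w - U₁ a + 1 + u a) -
    (Y a * g (w - U₁ a + 1) + Y a * u a * Δ g (w - U₂ a + 1)) with hΦdef
  have hΦ : ∀ a, IsSecondDiff (2 * H * (Y a * (U₃ a : ℝ) ^ 2)) (Φ a) := by
    intro a
    have p1 := (IsSecondDiff.newton_two (F := g) hg (u a)).shift (-(U₁ a : ℤ) + 1)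
    have p2 := ((IsSecondDiff.newton_one (F := Δ g) hg (U₂ a - U₁ a)).shift
      (-(U₂ a : ℤ) + 1)).const_mul (Nat.cast_nonneg (u a))
    have p := (p1.add p2).const_mul (Nat.cast_nonneg (α := ℝ) (Y a))
    have h12 := N.le₁₂ a
    have h23 := N.le₂₃ a
    refine (p.mono ?_).congr fun w => ?_
    · have c0 := hu' a
      have c1 : ((U₂ a - U₁ a : ℕ) : ℝ) ≤ U₃ a := by exact_mod_cast by omega
      have d2 : ((u a).choose 2 : ℝ) ≤ (U₃ a : ℝ) ^ 2 :=
        le_trans (b := ((u a : ℝ)) ^ 2) (by exact_mod_cast Nat.choose_le_pow _ _)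
          (pow_le_pow_left₀ (by positivity) c0 2)
      have f2 : (u a : ℝ) * ((U₂ a - U₁ a : ℕ) : ℝ) ≤ (U₃ a : ℝ) ^ 2 := by
        rw [pow_two]; gcongr
      have : ((u a).choose 2 : ℝ) * H + u a * (((U₂ a - U₁ a : ℕ) : ℝ) * H)
          ≤ 2 * (U₃ a : ℝ) ^ 2 * H := by nlinarith
      calc _ ≤ (Y a : ℝ) * (2 * (U₃ a : ℝ) ^ 2 * H) :=
            mul_le_mul_of_nonneg_left this (by positivity)
        _ = _ := by ring
    · have s1 : w + (-(U₂ a : ℤ) + 1) + ((U₂ a - U₁ a : ℕ) : ℤ) = w - U₁ a + 1 := by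
        push_cast [Nat.cast_sub h12]; ring
      have s3 : w + (-(U₁ a : ℤ) + 1) = w - U₁ a + 1 := by ring
      have s4 : w + (-(U₂ a : ℤ) + 1) = w - U₂ a + 1 := by ring
      simp only [hΦdef, s1]
      rw [s3, s4]
      ring
  have hb : Integrable (fun ω => 2 * H * (Y (x ω) * (U₃ (x ω) : ℝ) ^ 2)) μ := by
    refine (N.integrable_left (r := 3) (by norm_num) (Y := fun a => Y a * (U₃ a : ℝ) ^ 2)
      fun a => ?_).const_mul (2 * H)
    rw [abs_of_nonneg (by positivity)]
    calc (Y a : ℝ) * (U₃ a : ℝ) ^ 2 ≤ (1 + (U₃ a : ℝ)) * (1 + (U₃ a : ℝ)) ^ 2 := by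
          gcongr
          · exact hYn a
          · linarith
      _ = _ := by ring
  have hI := integrable_secondDiff N.measurable_x N.measurable_W hΦ hb
  have hle := abs_integral_secondDiff_le N.measurable_x N.measurable_W hΦ hb
  have hmain : (∫ ω, (Y (x ω) : ℝ) * g ((W ω : ℤ) - U₁ (x ω) + 1 + u (x ω)) ∂μ) =
      (∫ ω, Φ (x ω) (W ω) ∂μ) + ((∫ ω, (Y (x ω) : ℝ) * g ((W ω : ℤ) - U₁ (x ω) + 1) ∂μ)
      + (∫ ω, (Y (x ω) * u (x ω) : ℝ) * Δ g ((W ω : ℤ) - U₂ (x ω) + 1) ∂μ)) := by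
    have i01 : Integrable (fun ω => (Y (x ω) : ℝ) * g ((W ω : ℤ) - U₁ (x ω) + 1) +
      (Y (x ω) * u (x ω) : ℝ) * Δ g ((W ω : ℤ) - U₂ (x ω) + 1)) μ := i0.add i1
    rw [← integral_add i0 i1, ← integral_add hI i01]
    refine integral_congr_ae (Filter.Eventually.of_forall fun ω => ?_)
    simp only [hΦdef]
    ring
  rw [e0, e1] at hmain
  rw [hmain, add_sub_cancel_right]
  refine hle.trans (le_of_eq ?_)
  rw [← integral_const_mul]
  refine integral_congr_ae (Filter.Eventually.of_forall fun ω => ?_)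
  simp only
  ring

include N in
/-- The expansion of order one, comparing `E g(W - V + 1)` with `E g(W + 1)`. -/
lemma expansion_one {g : ℤ → ℝ} {H : ℝ} (hg : IsSecondDiff H (Δ g)) {V : α → ℕ}
    (hV : ∀ a, V a ≤ U₃ a) :
    |(∫ ω, g ((W ω : ℤ) + 1) ∂μ) - ∫ ω, g ((W ω : ℤ) - V (x ω) + 1) ∂μ|
    ≤ H * ∫ ω, (U₃ (x ω) : ℝ) * condSmooth μ x W ω ∂μ := by
  have hH := hg.nonneg
  have g1 : HasPolyGrowth 1 g := (HasPolyGrowth.of_isSecondDiff hg).of_fwdDiff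
  have i0 : Integrable (fun ω => g ((W ω : ℤ) + 1)) μ := by
    have := N.integrable_mul (r := 0) (Y := fun _ => 1) (by norm_num) (by simp) g1
      (V := fun _ => 0) (fun a => Nat.zero_le _)
    simpa using this
  have i1 : Integrable (fun ω => g ((W ω : ℤ) - V (x ω) + 1)) μ := by
    have := N.integrable_mul (r := 0) (Y := fun _ => 1) (by norm_num) (by simp) g1 hV
    simpa using this
  have hΦ : ∀ a, IsSecondDiff (H * (U₃ a : ℝ)) (fun w => g (w + 1) - g (w - V a + 1)) := by
    intro a
    have hc : (V a : ℝ) ≤ U₃ a := by exact_mod_cast hV a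
    refine (((IsSecondDiff.newton_one (F := g) hg (V a)).shift (-(V a : ℤ) + 1)).mono
      (by nlinarith)).congr fun w => ?_
    have s1 : w + (-(V a : ℤ) + 1) + V a = w + 1 := by ring
    have s2 : w + (-(V a : ℤ) + 1) = w - V a + 1 := by ring
    simp only [s1]
    rw [s2]
  have hb : Integrable (fun ω => H * (U₃ (x ω) : ℝ)) μ :=
    (N.integrable_left (r := 1) (by norm_num) (Y := fun a => (U₃ a : ℝ))
      fun a => by rw [Nat.abs_cast, pow_one]; linarith).const_mul H
  have hle := abs_integral_secondDiff_le N.measurable_x N.measurable_W hΦ hb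
  rw [← integral_sub i0 i1]
  refine hle.trans (le_of_eq ?_)
  rw [← integral_const_mul]
  refine integral_congr_ae (Filter.Eventually.of_forall fun ω => ?_)
  simp only
  ring

/-- The error of the third order local expansion around one summand `X`, where `U` is the sum over the
largest neighbourhood. In every product of expectations exactly one factor carries the weight
`condSmooth`. -/
noncomputable def errorThree (μ : Measure Ω) (x : Ω → α) (W : Ω → ℕ) (X U : α → ℕ) : ℝ :=
  4 * (∫ ω, (X (x ω) : ℝ) * (U (x ω) : ℝ) ^ 3 * condSmooth μ x W ω ∂μ)
  + (∫ ω, (X (x ω) : ℝ) ∂μ) * (4 * ∫ ω, (U (x ω) : ℝ) ^ 3 * condSmooth μ x W ω ∂μ)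
  + ((∫ ω, (X (x ω) * U (x ω) : ℝ) ∂μ) + (∫ ω, (X (x ω) : ℝ) ∂μ) * ∫ ω, (U (x ω) : ℝ) ∂μ) *
      (2 * ∫ ω, (U (x ω) : ℝ) ^ 2 * condSmooth μ x W ω ∂μ)
  + (2 * ((∫ ω, (X (x ω) * (U (x ω) : ℝ) ^ 2 : ℝ) ∂μ)
        + (∫ ω, (X (x ω) : ℝ) ∂μ) * ∫ ω, (U (x ω) : ℝ) ^ 2 ∂μ)
      + ((∫ ω, (X (x ω) * U (x ω) : ℝ) ∂μ) + (∫ ω, (X (x ω) : ℝ) ∂μ) * ∫ ω, (U (x ω) : ℝ) ∂μ)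
        * ∫ ω, (U (x ω) : ℝ) ∂μ) *
      (∫ ω, (U (x ω) : ℝ) * condSmooth μ x W ω ∂μ)

/-- The error of the second order local expansion around one summand `X`, in the same notation as
`errorThree`. -/
noncomputable def errorTwo (μ : Measure Ω) (x : Ω → α) (W : Ω → ℕ) (X U : α → ℕ) : ℝ :=
  2 * (∫ ω, (X (x ω) : ℝ) * (U (x ω) : ℝ) ^ 2 * condSmooth μ x W ω ∂μ)
  + (∫ ω, (X (x ω) : ℝ) ∂μ) * (2 * ∫ ω, (U (x ω) : ℝ) ^ 2 * condSmooth μ x W ω ∂μ)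
  + ((∫ ω, (X (x ω) * U (x ω) : ℝ) ∂μ) + (∫ ω, (X (x ω) : ℝ) ∂μ) * ∫ ω, (U (x ω) : ℝ) ∂μ) *
      (∫ ω, (U (x ω) : ℝ) * condSmooth μ x W ω ∂μ)

lemma abs_sub_mul_le {p x q P : ℝ} (hp : 0 ≤ p) (hx : 0 ≤ x) (hq : 0 ≤ q) (hpP : p ≤ P)
    {Q : ℝ} (hqQ : q ≤ Q) : |p - x * q| ≤ P + x * Q := by
  have h1 := mul_nonneg hx hq
  have h2 := mul_le_mul_of_nonneg_left hqQ hx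
  rw [abs_le]
  constructor <;> linarith

include N in
lemma integral_mono_left {r : ℕ} (hr : r ≤ 4) {Y Z : α → ℝ} (hY : ∀ a, 0 ≤ Y a)
    (hYZ : ∀ a, Y a ≤ Z a) (hZ : ∀ a, Z a ≤ (1 + (U₃ a : ℝ)) ^ r) :
    ∫ ω, Y (x ω) ∂μ ≤ ∫ ω, Z (x ω) ∂μ := by
  refine integral_mono (N.integrable_left hr fun a => ?_) (N.integrable_left hr fun a => ?_)
    fun ω => hYZ _
  · rw [abs_of_nonneg (hY a)]; exact (hYZ a).trans (hZ a)
  · rw [abs_of_nonneg ((hY a).trans (hYZ a))]; exact hZ a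

include N in
/-- Rewrites `W` as `(W - U₁ + 1) + (U₁ - 1)` on the event `X ≠ 0`. Elsewhere the truncated
subtraction `U₁ - 1` is harmless because the factor `X` vanishes. -/
lemma integral_summand_eq {X : α → ℕ} (hX : ∀ a, X a ≤ U₁ a) (g : ℤ → ℝ) :
    ∫ ω, (X (x ω) : ℝ) * g (W ω) ∂μ =
      ∫ ω, (X (x ω) : ℝ) * g ((W ω : ℤ) - U₁ (x ω) + 1 + (U₁ (x ω) - 1 : ℕ)) ∂μ := by
  refine integral_congr_ae (Filter.Eventually.of_forall fun ω => ?_)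
  simp only
  rcases Nat.eq_zero_or_pos (X (x ω)) with h | h
  · simp [h]
  · have : 1 ≤ U₁ (x ω) := h.trans_le (hX _)
    congr 2
    push_cast [Nat.cast_sub this]
    ring

include N in
/-- The second order local expansion: up to the error, `E[X g(W)]` is a combination, with
coefficients not depending on `g`, of `E g(W+1)` and `E Δg(W+1)`. -/
lemma exists_expansion_two {X : α → ℕ} (hX : ∀ a, X a ≤ U₁ a)
    (h₁ : IndepFun (fun ω => X (x ω)) (fun ω => (W ω : ℤ) - U₁ (x ω)) μ)
    (h₂ : IndepFun (fun ω => (X (x ω), U₁ (x ω))) (fun ω => (W ω : ℤ) - U₂ (x ω)) μ) :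
    ∃ a₁ a₂ : ℝ, ∀ (g : ℤ → ℝ) (H : ℝ), IsSecondDiff H (Δ (Δ g)) →
      |(∫ ω, (X (x ω) : ℝ) * g (W ω) ∂μ) - (a₁ * (∫ ω, g ((W ω : ℤ) + 1) ∂μ)
        + a₂ * (∫ ω, Δ g ((W ω : ℤ) + 1) ∂μ))| ≤ H * errorTwo μ x W X U₃ := by
  have hX3 : ∀ a, X a ≤ 1 + U₃ a := fun a => by
    have := hX a; have := N.le₁₂ a; have := N.le₂₃ a; omega
  have hXr : ∀ a, (X a : ℝ) ≤ 1 + U₃ a := fun a => by exact_mod_cast hX3 a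
  have h1Ω : ∫ _ : Ω, (1 : ℝ) ∂μ = 1 := by simp
  refine ⟨∫ ω, (X (x ω) : ℝ) ∂μ, (∫ ω, (X (x ω) * ((U₁ (x ω) - 1 : ℕ) : ℝ) : ℝ) ∂μ) -
    (∫ ω, (X (x ω) : ℝ) ∂μ) * ∫ ω, (U₁ (x ω) : ℝ) ∂μ, fun g H hg => ?_⟩
  have hH := hg.nonneg
  have E1 := N.expansion_two hg (Y := X) (u := fun a => U₁ a - 1) hX3 (fun a => Nat.sub_le _ _) h₁
    (h₂.comp (φ := fun n : ℕ × ℕ => (n.1, n.2 - 1)) Measurable.of_discrete measurable_id)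
  rw [← N.integral_summand_eq hX] at E1
  have E2 := N.expansion_two hg (Y := fun _ => 1) (u := U₁) (fun a => by omega) (fun a => le_rfl)
    (ProbabilityTheory.indepFun_const_left _ _)
    (h₂.comp (φ := fun n : ℕ × ℕ => (1, n.2)) Measurable.of_discrete measurable_id)
  have E3 := N.expansion_one (g := Δ g) hg (V := U₂) N.le₂₃
  simp only [Nat.cast_one, one_mul, h1Ω] at E2
  have e : ∀ ω, (W ω : ℤ) - U₁ (x ω) + 1 + U₁ (x ω) = W ω + 1 := fun ω => by ring
  simp only [e] at E2
  have hxn : 0 ≤ ∫ ω, (X (x ω) : ℝ) ∂μ := integral_nonneg fun ω => by positivity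
  have hU1r : ∀ a, (U₁ a : ℝ) ≤ U₃ a := fun a => by
    exact_mod_cast (N.le₁₂ a).trans (N.le₂₃ a)
  have hU0r : ∀ a, ((U₁ a - 1 : ℕ) : ℝ) ≤ U₃ a := fun a =>
    le_trans (by exact_mod_cast Nat.sub_le _ _) (hU1r a)
  have hc := abs_sub_mul_le
    (p := ∫ ω, (X (x ω) * ((U₁ (x ω) - 1 : ℕ) : ℝ) : ℝ) ∂μ) (q := ∫ ω, (U₁ (x ω) : ℝ) ∂μ)
    (integral_nonneg fun ω => by positivity) hxn (integral_nonneg fun ω => by positivity)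
    (N.integral_mono_left (r := 2) (by norm_num)
      (Y := fun a => (X a * ((U₁ a - 1 : ℕ) : ℝ) : ℝ)) (Z := fun a => (X a * U₃ a : ℝ))
      (fun a => by positivity) (fun a => mul_le_mul_of_nonneg_left (hU0r a) (by positivity))
      (fun a => by rw [pow_two]; exact mul_le_mul (hXr a) (by linarith) (by positivity)
                    (by positivity)))
    (N.integral_mono_left (r := 1) (by norm_num)
      (Y := fun a => (U₁ a : ℝ)) (Z := fun a => (U₃ a : ℝ))
      (fun a => by positivity) hU1r (fun a => by rw [pow_one]; linarith))
  set x₀ := ∫ ω, (X (x ω) : ℝ) ∂μ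
  set c := (∫ ω, (X (x ω) * ((U₁ (x ω) - 1 : ℕ) : ℝ) : ℝ) ∂μ) - x₀ * ∫ ω, (U₁ (x ω) : ℝ) ∂μ
  have T2 := (abs_mul x₀ _).le.trans (mul_le_mul_of_nonneg_left E2 (abs_nonneg x₀))
  have T3 := (abs_mul c _).le.trans (mul_le_mul hc E3 (abs_nonneg _) ((abs_nonneg _).trans hc))
  rw [abs_of_nonneg hxn] at T2
  refine le_trans (b := _) (le_of_eq ?_) ((abs_add_three _ _ _).trans
    ((add_le_add (add_le_add E1 ((abs_neg _).le.trans T2)) ((abs_neg _).le.trans T3)).trans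
      (le_of_eq ?_)))
  · congr 1
    simp only [c]
    ring
  · rw [errorTwo]; ring

/-- Eliminates the expectations `t₁, t₂, t₂', t₃` at the variables `W - U + 1` in favour of the
expectations `I₀, I₁, I₂` at `W + 1`. Here `h₁` is the expansion around the summand, `h₂` the same
expansion with the constant weight `1`, and `h₃, h₄, h₅` are expansions of lower order. -/
lemma abs_combine_expansions {L I₀ I₁ I₂ t₁ t₂ t₂' t₃ x₀ p p' q q' r r' u e₁ e₂ e₃ e₄ P Q R : ℝ}
    (hx : 0 ≤ x₀) (hc : |p - x₀ * p'| ≤ P) (hd : |r - x₀ * r'| ≤ Q)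
    (hf : |q - x₀ * q' - (p - x₀ * p') * u| ≤ R)
    (h₁ : |L - (x₀ * t₁ + p * t₂ + q * t₃ + r * t₂')| ≤ e₁)
    (h₂ : |I₀ - (t₁ + p' * t₂ + q' * t₃ + r' * t₂')| ≤ e₂)
    (h₃ : |I₁ - (t₂ + u * t₃)| ≤ e₃) (h₄ : |I₂ - t₂'| ≤ e₄) (h₅ : |I₂ - t₃| ≤ e₄) :
    |L - (x₀ * I₀ + (p - x₀ * p') * I₁
      + ((q - x₀ * q' - (p - x₀ * p') * u) + (r - x₀ * r')) * I₂)|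
      ≤ e₁ + x₀ * e₂ + P * e₃ + (R + Q) * e₄ := by
  have k₂ := mul_le_mul_of_nonneg_left h₂ hx
  have k₃ := mul_le_mul hc h₃ (abs_nonneg _) ((abs_nonneg _).trans hc)
  have k₄ := mul_le_mul hd h₄ (abs_nonneg _) ((abs_nonneg _).trans hd)
  have k₅ := mul_le_mul hf h₅ (abs_nonneg _) ((abs_nonneg _).trans hf)
  rw [← abs_mul] at k₃ k₄ k₅
  nth_rewrite 1 [← abs_of_nonneg hx] at k₂
  rw [← abs_mul] at k₂
  rw [abs_le] at h₁ k₂ k₃ k₄ k₅ ⊢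
  constructor <;> linarith [h₁.1, h₁.2, k₂.1, k₂.2, k₃.1, k₃.2, k₄.1, k₄.2, k₅.1, k₅.2]

include N in
/-- Dropping the innermost sum, so that `Δ g` can be expanded around `U₂`. -/
lemma tail : NestedSums μ x W U₂ U₃ U₃ where
  measurable_x := N.measurable_x
  measurable_W := N.measurable_W
  integrable_pow := N.integrable_pow
  le₁₂ := N.le₂₃
  le₂₃ _ := le_rfl
  le_W := N.le_W

include N in
/-- The third order local expansion: up to the error, `E[X g(W)]` is a combination, with
coefficients not depending on `g`, of `E g(W+1)`, `E Δg(W+1)` and `E Δ²g(W+1)`. -/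
lemma exists_expansion_three {X : α → ℕ} (hX : ∀ a, X a ≤ U₁ a)
    (h₁ : IndepFun (fun ω => X (x ω)) (fun ω => (W ω : ℤ) - U₁ (x ω)) μ)
    (h₂ : IndepFun (fun ω => (X (x ω), U₁ (x ω))) (fun ω => (W ω : ℤ) - U₂ (x ω)) μ)
    (h₃ : IndepFun (fun ω => (X (x ω), U₁ (x ω), U₂ (x ω))) (fun ω => (W ω : ℤ) - U₃ (x ω)) μ) :
    ∃ a₁ a₂ a₃ : ℝ, ∀ (g : ℤ → ℝ) (H : ℝ), IsSecondDiff H (Δ (Δ (Δ g))) →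
      |(∫ ω, (X (x ω) : ℝ) * g (W ω) ∂μ) - (a₁ * (∫ ω, g ((W ω : ℤ) + 1) ∂μ)
        + a₂ * (∫ ω, Δ g ((W ω : ℤ) + 1) ∂μ) + a₃ * (∫ ω, Δ (Δ g) ((W ω : ℤ) + 1) ∂μ))|
      ≤ H * errorThree μ x W X U₃ := by
  have hX3 : ∀ a, X a ≤ 1 + U₃ a := fun a => by
    have := hX a; have := N.le₁₂ a; have := N.le₂₃ a; omega
  have hXr : ∀ a, (X a : ℝ) ≤ 1 + U₃ a := fun a => by exact_mod_cast hX3 a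
  have h1Ω : ∫ _ : Ω, (1 : ℝ) ∂μ = 1 := by simp
  have e : ∀ ω, (W ω : ℤ) - U₁ (x ω) + 1 + U₁ (x ω) = W ω + 1 := fun ω => by ring
  have e' : ∀ ω, (W ω : ℤ) - U₂ (x ω) + 1 + U₂ (x ω) = W ω + 1 := fun ω => by ring
  have hU1r : ∀ a, (U₁ a : ℝ) ≤ U₃ a := fun a => by
    exact_mod_cast (N.le₁₂ a).trans (N.le₂₃ a)
  have hU2r : ∀ a, (U₂ a : ℝ) ≤ U₃ a := fun a => by exact_mod_cast N.le₂₃ a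
  have hU0r : ∀ a, ((U₁ a - 1 : ℕ) : ℝ) ≤ U₃ a := fun a =>
    le_trans (by exact_mod_cast Nat.sub_le _ _) (hU1r a)
  have hvr : ∀ a, ((U₂ a - U₁ a : ℕ) : ℝ) ≤ U₃ a := fun a =>
    le_trans (by exact_mod_cast Nat.sub_le _ _) (hU2r a)
  have hch : ∀ {n : ℕ} {a}, (n : ℝ) ≤ U₃ a → ((n.choose 2 : ℕ) : ℝ) ≤ (U₃ a : ℝ) ^ 2 := fun {n : ℕ} {a} h =>
    le_trans (b := (n : ℝ) ^ 2) (by exact_mod_cast Nat.choose_le_pow _ _)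
      (pow_le_pow_left₀ (by positivity) h 2)
  set x₀ := ∫ ω, (X (x ω) : ℝ) ∂μ with hx₀
  set p := ∫ ω, (X (x ω) * ((U₁ (x ω) - 1 : ℕ) : ℝ) : ℝ) ∂μ with hp
  set p' := ∫ ω, (U₁ (x ω) : ℝ) ∂μ with hp'
  set q := ∫ ω, (X (x ω) * ((U₁ (x ω) - 1 : ℕ) : ℝ) * ((U₂ (x ω) - U₁ (x ω) : ℕ) : ℝ) : ℝ) ∂μ
    with hq
  set q' := ∫ ω, (U₁ (x ω) * ((U₂ (x ω) - U₁ (x ω) : ℕ) : ℝ) : ℝ) ∂μ with hq'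
  set r := ∫ ω, (X (x ω) * ((U₁ (x ω) - 1).choose 2 : ℝ) : ℝ) ∂μ with hr
  set r' := ∫ ω, ((U₁ (x ω)).choose 2 : ℝ) ∂μ with hr'
  set u := ∫ ω, (U₂ (x ω) : ℝ) ∂μ with hu
  set EU := ∫ ω, (U₃ (x ω) : ℝ) ∂μ with hEU
  set EU2 := ∫ ω, (U₃ (x ω) : ℝ) ^ 2 ∂μ with hEU2
  set EXU := ∫ ω, (X (x ω) * U₃ (x ω) : ℝ) ∂μ with hEXU
  set EXU2 := ∫ ω, (X (x ω) * (U₃ (x ω) : ℝ) ^ 2 : ℝ) ∂μ with hEXU2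
  refine ⟨x₀, p - x₀ * p', (q - x₀ * q' - (p - x₀ * p') * u) + (r - x₀ * r'),
    fun g H hg => ?_⟩
  have hH := hg.nonneg
  have E1 := N.expansion_three hg (Y := X) (u := fun a => U₁ a - 1) hX3 (fun a => Nat.sub_le _ _) h₁
    (h₂.comp (φ := fun n : ℕ × ℕ => (n.1, n.2 - 1)) Measurable.of_discrete measurable_id)
    (h₃.comp (φ := fun n : ℕ × ℕ × ℕ => (n.1, n.2.1 - 1, n.2.2 - n.2.1)) Measurable.of_discrete
      measurable_id)
  rw [← N.integral_summand_eq hX] at E1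
  have E2 := N.expansion_three hg (Y := fun _ => 1) (u := U₁) (fun a => by omega) (fun a => le_rfl)
    (ProbabilityTheory.indepFun_const_left _ _)
    (h₂.comp (φ := fun n : ℕ × ℕ => (1, n.2)) Measurable.of_discrete measurable_id)
    (h₃.comp (φ := fun n : ℕ × ℕ × ℕ => (1, n.2.1, n.2.2 - n.2.1)) Measurable.of_discrete
      measurable_id)
  have E3 := N.tail.expansion_two (g := Δ g) hg (Y := fun _ => 1) (u := U₂) (fun a => by omega)
    (fun a => le_rfl) (ProbabilityTheory.indepFun_const_left _ _)
    (h₃.comp (φ := fun n : ℕ × ℕ × ℕ => (1, n.2.2)) Measurable.of_discrete measurable_id)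
  have E4 := N.expansion_one (g := Δ (Δ g)) hg (V := U₂) N.le₂₃
  have E5 := N.expansion_one (g := Δ (Δ g)) hg (V := U₃) fun _ => le_rfl
  simp only [Nat.cast_one, one_mul, h1Ω, e] at E2
  simp only [Nat.cast_one, one_mul, h1Ω, e'] at E3
  have hxn : 0 ≤ x₀ := integral_nonneg fun ω => by positivity
  have bXU : ∀ a, (X a * U₃ a : ℝ) ≤ (1 + (U₃ a : ℝ)) ^ 2 := fun a => by
    rw [pow_two (1 + (U₃ a : ℝ))]
    exact mul_le_mul (hXr a) (by linarith) (by positivity) (by positivity)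
  have bXU2 : ∀ a, (X a * (U₃ a : ℝ) ^ 2 : ℝ) ≤ (1 + (U₃ a : ℝ)) ^ 3 := fun a => by
    rw [pow_succ' (1 + (U₃ a : ℝ)) 2]
    exact mul_le_mul (hXr a) (pow_le_pow_left₀ (by positivity) (by linarith) 2) (by positivity)
      (by positivity)
  have bU2 : ∀ a, ((U₃ a : ℝ) ^ 2 : ℝ) ≤ (1 + (U₃ a : ℝ)) ^ 2 := fun a =>
    pow_le_pow_left₀ (by positivity) (by linarith) 2
  have lp : p ≤ EXU := N.integral_mono_left (r := 2) (by norm_num)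
      (Y := fun a => (X a * ((U₁ a - 1 : ℕ) : ℝ) : ℝ)) (Z := fun a => (X a * U₃ a : ℝ))
      (fun a => by positivity) (fun a => mul_le_mul_of_nonneg_left (hU0r a) (by positivity)) bXU
  have lp' : p' ≤ EU := N.integral_mono_left (r := 1) (by norm_num)
      (Y := fun a => (U₁ a : ℝ)) (Z := fun a => (U₃ a : ℝ))
      (fun a => by positivity) hU1r (fun a => by rw [pow_one]; linarith)
  have lu : u ≤ EU := N.integral_mono_left (r := 1) (by norm_num)
      (Y := fun a => (U₂ a : ℝ)) (Z := fun a => (U₃ a : ℝ))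
      (fun a => by positivity) hU2r (fun a => by rw [pow_one]; linarith)
  have lq : q ≤ EXU2 := N.integral_mono_left (r := 3) (by norm_num)
      (Y := fun a => (X a * ((U₁ a - 1 : ℕ) : ℝ) * ((U₂ a - U₁ a : ℕ) : ℝ) : ℝ))
      (Z := fun a => (X a * (U₃ a : ℝ) ^ 2 : ℝ))
      (fun a => by positivity) (fun a => by
        rw [pow_two, mul_assoc]
        exact mul_le_mul_of_nonneg_left (mul_le_mul (hU0r a) (hvr a) (by positivity)
          (by positivity)) (by positivity)) bXU2
  have lq' : q' ≤ EU2 := N.integral_mono_left (r := 2) (by norm_num)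
      (Y := fun a => (U₁ a * ((U₂ a - U₁ a : ℕ) : ℝ) : ℝ))
      (Z := fun a => ((U₃ a : ℝ) ^ 2 : ℝ))
      (fun a => by positivity) (fun a => by
        rw [pow_two]
        exact mul_le_mul (hU1r a) (hvr a) (by positivity) (by positivity)) bU2
  have lr : r ≤ EXU2 := N.integral_mono_left (r := 3) (by norm_num)
      (Y := fun a => (X a * ((U₁ a - 1).choose 2 : ℝ) : ℝ))
      (Z := fun a => (X a * (U₃ a : ℝ) ^ 2 : ℝ))
      (fun a => by positivity) (fun a => mul_le_mul_of_nonneg_left (hch (hU0r a)) (by positivity))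
      bXU2
  have lr' : r' ≤ EU2 := N.integral_mono_left (r := 2) (by norm_num)
      (Y := fun a => ((U₁ a).choose 2 : ℝ))
      (Z := fun a => ((U₃ a : ℝ) ^ 2 : ℝ))
      (fun a => by positivity) (fun a => hch (hU1r a)) bU2
  have hun : 0 ≤ u := integral_nonneg fun ω => by positivity
  have hc := abs_sub_mul_le (integral_nonneg fun ω => by positivity) hxn
    (integral_nonneg fun ω => by positivity) lp lp'
  have hd := abs_sub_mul_le (integral_nonneg fun ω => by positivity) hxn
    (integral_nonneg fun ω => by positivity) lr lr'
  have hf : |q - x₀ * q' - (p - x₀ * p') * u| ≤ (EXU2 + x₀ * EU2) + (EXU + x₀ * EU) * EU := by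
    refine (abs_sub _ _).trans (add_le_add (abs_sub_mul_le (integral_nonneg fun ω => by positivity)
      hxn (integral_nonneg fun ω => by positivity) lq lq') ?_)
    rw [abs_mul, abs_of_nonneg hun]
    exact mul_le_mul hc lu hun ((abs_nonneg _).trans hc)
  refine (abs_combine_expansions hxn hc hd hf E1 E2 E3 E4 E5).trans (le_of_eq ?_)
  rw [errorThree]
  ring

end NestedSums

/-! ### Moments of the local errors -/

section Moments

variable {Ω : Type*} [MeasurableSpace Ω] {μ : Measure Ω} [IsProbabilityMeasure μ]
  {ι : Type*} [Fintype ι] {x : Ω → ι → ℕ}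

lemma pow_sum_le_card_pow_mul (a : ι → ℕ) (b : ℕ) :
    ((∑ c, a c : ℕ) : ℝ) ^ (b + 1) ≤ (Fintype.card ι : ℝ) ^ b * ∑ c, (a c : ℝ) ^ (b + 1) := by
  rw [Nat.cast_sum, ← Finset.card_univ]
  exact pow_sum_le_card_mul_sum_pow (fun c _ => Nat.cast_nonneg _) b

lemma mul_pow_le_add_pow (s t : ℕ) (b : ℕ) :
    (s : ℝ) * (t : ℝ) ^ (b + 1) ≤ (s : ℝ) ^ (b + 2) + (t : ℝ) ^ (b + 2) := by
  have hs : (0 : ℝ) ≤ s := Nat.cast_nonneg s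
  have ht : (0 : ℝ) ≤ t := Nat.cast_nonneg t
  rcases le_total (s : ℝ) t with h | h
  · calc (s : ℝ) * (t : ℝ) ^ (b + 1) ≤ t * (t : ℝ) ^ (b + 1) := by gcongr
      _ = (t : ℝ) ^ (b + 2) := by ring
      _ ≤ _ := by linarith [pow_nonneg hs (b + 2)]
  · calc (s : ℝ) * (t : ℝ) ^ (b + 1) ≤ s * (s : ℝ) ^ (b + 1) := by gcongr
      _ = (s : ℝ) ^ (b + 2) := by ring
      _ ≤ _ := by linarith [pow_nonneg ht (b + 2)]

lemma natCast_pow_le_pow_four (n b : ℕ) (h1 : 1 ≤ b) (h4 : b ≤ 4) : (n : ℝ) ^ b ≤ (n : ℝ) ^ 4 := by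
  rcases Nat.eq_zero_or_pos n with h | h
  · subst h; simp [Nat.ne_of_gt h1]
  · exact pow_le_pow_right₀ (by exact_mod_cast h) h4

lemma integrable_pow_of_four {Y : Ω → ℕ} (hY : Measurable Y)
    (h : Integrable (fun ω => (Y ω : ℝ) ^ 4) μ) {b : ℕ} (hb : b ≤ 4) :
    Integrable (fun ω => (Y ω : ℝ) ^ b) μ := by
  rcases Nat.eq_zero_or_pos b with h0 | h0
  · subst h0; simp
  · refine h.mono' ((Measurable.of_discrete (f := fun n : ℕ => (n : ℝ) ^ b)).comp
      hY).aestronglyMeasurable (Filter.Eventually.of_forall fun ω => ?_)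
    rw [Real.norm_eq_abs, abs_of_nonneg (by positivity)]
    exact natCast_pow_le_pow_four _ _ h0 hb

variable {D : Ω → ℝ} (hx : Measurable x) (hD : Measurable D) (hD0 : ∀ ω, 0 ≤ D ω)
  (hD4 : ∀ ω, D ω ≤ 4) (hint : ∀ c, Integrable (fun ω => (x ω c : ℝ) ^ 4) μ)

include hD hD0 hD4 in
lemma integrable_mul_weight {Y : Ω → ℝ} (hY : Integrable Y μ) :
    Integrable (fun ω => Y ω * D ω) μ :=
  hY.mul_bdd (c := 4) hD.aestronglyMeasurable (Filter.Eventually.of_forall fun ω => by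
    rw [Real.norm_eq_abs, abs_of_nonneg (hD0 ω)]; exact hD4 ω)

include hx hD hD0 hD4 hint in
/-- Weighted moments of a sum in terms of a common bound for the weighted moments of its terms. -/
lemma integral_sum_pow_mul_le {b : ℕ} (hb : b + 1 ≤ 4) {φ : ℝ}
    (hφ : ∀ c, ∫ ω, (x ω c : ℝ) ^ (b + 1) * D ω ∂μ ≤ φ) :
    ∫ ω, ((∑ c, x ω c : ℕ) : ℝ) ^ (b + 1) * D ω ∂μ ≤ (Fintype.card ι : ℝ) ^ (b + 1) * φ := by
  have hi : ∀ c, Integrable (fun ω => (x ω c : ℝ) ^ (b + 1) * D ω) μ := fun c =>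
    integrable_mul_weight hD hD0 hD4
      (integrable_pow_of_four ((measurable_pi_apply c).comp hx) (hint c) hb)
  calc ∫ ω, ((∑ c, x ω c : ℕ) : ℝ) ^ (b + 1) * D ω ∂μ
      ≤ ∫ ω, (Fintype.card ι : ℝ) ^ b * ∑ c, (x ω c : ℝ) ^ (b + 1) * D ω ∂μ := by
        refine integral_mono_of_nonneg (Filter.Eventually.of_forall fun ω =>
          mul_nonneg (by positivity) (hD0 ω)) ((integrable_finsetSum _ fun c _ => hi c).const_mul _)
          (Filter.Eventually.of_forall fun ω => ?_)
        simp only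
        rw [← Finset.sum_mul, ← mul_assoc]
        exact mul_le_mul_of_nonneg_right (pow_sum_le_card_pow_mul _ _) (hD0 ω)
    _ = (Fintype.card ι : ℝ) ^ b * ∑ c, ∫ ω, (x ω c : ℝ) ^ (b + 1) * D ω ∂μ := by
        rw [integral_const_mul, integral_finsetSum _ fun c _ => hi c]
    _ ≤ (Fintype.card ι : ℝ) ^ b * ∑ _c : ι, φ := by gcongr with c; exact hφ c
    _ = _ := by rw [Finset.sum_const, Finset.card_univ, nsmul_eq_mul]; ring

include hx hD hD0 hD4 hint in
/-- Weighted mixed moments of one term and the whole sum. -/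
lemma integral_mul_sum_pow_mul_le (i : ι) {b : ℕ} (hb : b + 2 ≤ 4) {φ : ℝ}
    (hφ : ∀ c, ∫ ω, (x ω c : ℝ) ^ (b + 2) * D ω ∂μ ≤ φ) :
    ∫ ω, (x ω i : ℝ) * ((∑ c, x ω c : ℕ) : ℝ) ^ (b + 1) * D ω ∂μ
      ≤ 2 * (Fintype.card ι : ℝ) ^ (b + 1) * φ := by
  have hi : ∀ c, Integrable (fun ω => (x ω c : ℝ) ^ (b + 2) * D ω) μ := fun c =>
    integrable_mul_weight hD hD0 hD4
      (integrable_pow_of_four ((measurable_pi_apply c).comp hx) (hint c) hb)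
  have hi2 : ∀ c, Integrable (fun ω => (x ω i : ℝ) ^ (b + 2) * D ω + (x ω c : ℝ) ^ (b + 2) * D ω)
    μ := fun c => (hi i).add (hi c)
  calc ∫ ω, (x ω i : ℝ) * ((∑ c, x ω c : ℕ) : ℝ) ^ (b + 1) * D ω ∂μ
      ≤ ∫ ω, (Fintype.card ι : ℝ) ^ b *
          ∑ c, ((x ω i : ℝ) ^ (b + 2) * D ω + (x ω c : ℝ) ^ (b + 2) * D ω) ∂μ := by
        refine integral_mono_of_nonneg (Filter.Eventually.of_forall fun ω =>
          mul_nonneg (by positivity) (hD0 ω)) ((integrable_finsetSum _ fun c _ => hi2 c).const_mul _)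
          (Filter.Eventually.of_forall fun ω => ?_)
        simp only [← add_mul]
        rw [← Finset.sum_mul, ← mul_assoc]
        refine mul_le_mul_of_nonneg_right ?_ (hD0 ω)
        calc (x ω i : ℝ) * ((∑ c, x ω c : ℕ) : ℝ) ^ (b + 1)
            ≤ (x ω i : ℝ) * ((Fintype.card ι : ℝ) ^ b * ∑ c, (x ω c : ℝ) ^ (b + 1)) := by
              gcongr; exact pow_sum_le_card_pow_mul _ _
          _ = (Fintype.card ι : ℝ) ^ b * ∑ c, (x ω i : ℝ) * (x ω c : ℝ) ^ (b + 1) := by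
              rw [← Finset.mul_sum]; ring
          _ ≤ _ := by gcongr with c; exact mul_pow_le_add_pow _ _ _
    _ = (Fintype.card ι : ℝ) ^ b * ∑ c, ((∫ ω, (x ω i : ℝ) ^ (b + 2) * D ω ∂μ) +
          ∫ ω, (x ω c : ℝ) ^ (b + 2) * D ω ∂μ) := by
        rw [integral_const_mul, integral_finsetSum _ fun c _ => hi2 c]
        congr 1
        exact Finset.sum_congr rfl fun c _ => integral_add (hi i) (hi c)
    _ ≤ (Fintype.card ι : ℝ) ^ b * ∑ _c : ι, (φ + φ) := by
        gcongr with c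
        · exact hφ i
        · exact hφ c
    _ = _ := by rw [Finset.sum_const, Finset.card_univ, nsmul_eq_mul]; ring

include hx in
/-- The local error of order three in terms of one-point moments: every term pairs `4 - b` unweighted
factors with `b ≥ 1` factors weighted by the conditional smoothness. -/
lemma errorThree_le (hint : ∀ c, Integrable (fun ω => (x ω c : ℝ) ^ 4) μ) {W : Ω → ℕ}
    (hW : Measurable W) (i : ι) {ξ : ℝ} {φ : ℕ → ℝ}
    (hξ : ∀ b, 1 ≤ b → b ≤ 3 → ∀ c, ∫ ω, (x ω c : ℝ) ^ b ∂μ ≤ ξ ^ b)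
    (hφ : ∀ b, 1 ≤ b → b ≤ 4 → ∀ c, ∫ ω, (x ω c : ℝ) ^ b * condSmooth μ x W ω ∂μ ≤ φ b) :
    NestedSums.errorThree μ x W (fun a => a i) (fun a => ∑ c, a c) ≤
      9 * (Fintype.card ι : ℝ) ^ 3 * (φ 4 + ξ * φ 3 + ξ ^ 2 * φ 2 + ξ ^ 3 * φ 1) := by
  set K := (Fintype.card ι : ℝ)
  have hm := measurable_condSmooth (μ := μ) (W := W) hx
  have h0 := condSmooth_nonneg (μ := μ) (W := W) (x := x)
  have h4 := condSmooth_le (μ := μ) (x := x) hW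
  have one0 : ∀ _ : Ω, (0 : ℝ) ≤ 1 := fun _ => zero_le_one
  have one4 : ∀ _ : Ω, (1 : ℝ) ≤ 4 := fun _ => by norm_num
  have hφ0 : ∀ b, 1 ≤ b → b ≤ 4 → 0 ≤ φ b := fun b h1 hb =>
    (integral_nonneg fun ω => mul_nonneg (by positivity) (h0 ω)).trans (hφ b h1 hb i)
  have hξ0 : 0 ≤ ξ := by
    have := hξ 1 le_rfl (by norm_num) i
    rw [pow_one] at this
    exact (integral_nonneg fun ω => by positivity).trans this
  have A1 := integral_mul_sum_pow_mul_le hx hm h0 h4 hint i (b := 2) (by norm_num)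
    (hφ 4 (by norm_num) (by norm_num))
  have A2 := integral_sum_pow_mul_le hx hm h0 h4 hint (b := 2) (by norm_num)
    (hφ 3 (by norm_num) (by norm_num))
  have A3 := integral_sum_pow_mul_le hx hm h0 h4 hint (b := 1) (by norm_num)
    (hφ 2 (by norm_num) (by norm_num))
  have A4 := integral_sum_pow_mul_le hx hm h0 h4 hint (b := 0) (by norm_num)
    (hφ 1 (by norm_num) (by norm_num))
  have B1 := integral_mul_sum_pow_mul_le hx measurable_const one0 one4 hint i (b := 0) (by norm_num)
    (φ := ξ ^ 2) (by simpa using hξ 2 (by norm_num) (by norm_num))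
  have B2 := integral_mul_sum_pow_mul_le hx measurable_const one0 one4 hint i (b := 1) (by norm_num)
    (φ := ξ ^ 3) (by simpa using hξ 3 (by norm_num) (by norm_num))
  have B3 := integral_sum_pow_mul_le hx measurable_const one0 one4 hint (b := 1) (by norm_num)
    (φ := ξ ^ 2) (by simpa using hξ 2 (by norm_num) (by norm_num))
  have B4 := integral_sum_pow_mul_le hx measurable_const one0 one4 hint (b := 0) (by norm_num)
    (φ := ξ) (by simpa using hξ 1 (by norm_num) (by norm_num))
  have B5 := hξ 1 le_rfl (by norm_num) i
  simp only [zero_add, pow_one, mul_one, Nat.reduceAdd] at A1 A2 A3 A4 B1 B2 B3 B4 B5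
  have hP : (∫ ω, (x ω i * (∑ c, x ω c : ℕ) : ℝ) ∂μ) +
      (∫ ω, (x ω i : ℝ) ∂μ) * ∫ ω, ((∑ c, x ω c : ℕ) : ℝ) ∂μ ≤ 3 * K * ξ ^ 2 := by
    have := mul_le_mul B5 B4 (integral_nonneg fun ω => by positivity) hξ0
    linarith
  have hQ : (∫ ω, (x ω i * ((∑ c, x ω c : ℕ) : ℝ) ^ 2 : ℝ) ∂μ) +
      (∫ ω, (x ω i : ℝ) ∂μ) * ∫ ω, ((∑ c, x ω c : ℕ) : ℝ) ^ 2 ∂μ ≤ 3 * K ^ 2 * ξ ^ 3 := by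
    have := mul_le_mul B5 B3 (integral_nonneg fun ω => by positivity) hξ0
    linarith
  have hPn : 0 ≤ 3 * K * ξ ^ 2 := by positivity
  have T2 := mul_le_mul B5 (mul_le_mul_of_nonneg_left A2 (by norm_num : (0 : ℝ) ≤ 4))
    (mul_nonneg (by norm_num) (integral_nonneg fun ω => mul_nonneg (by positivity) (h0 ω))) hξ0
  have T3 := mul_le_mul hP (mul_le_mul_of_nonneg_left A3 (by norm_num : (0 : ℝ) ≤ 2))
    (mul_nonneg (by norm_num) (integral_nonneg fun ω => mul_nonneg (by positivity) (h0 ω))) hPn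
  have T4 := mul_le_mul (add_le_add (mul_le_mul_of_nonneg_left hQ (by norm_num : (0 : ℝ) ≤ 2))
      (mul_le_mul hP B4 (integral_nonneg fun ω => by positivity) hPn)) A4
    (integral_nonneg fun ω => mul_nonneg (by positivity) (h0 ω)) (by positivity)
  rw [NestedSums.errorThree]
  have n4 := hφ0 4 (by norm_num) (by norm_num)
  have n3 := mul_nonneg hξ0 (hφ0 3 (by norm_num) (by norm_num))
  have n2 := mul_nonneg (pow_nonneg hξ0 2) (hφ0 2 (by norm_num) (by norm_num))
  have hK : 0 ≤ K ^ 3 := by positivity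
  have m4 := mul_nonneg hK n4
  have m3 := mul_nonneg hK n3
  have m2 := mul_nonneg hK n2
  refine (add_le_add (add_le_add (add_le_add (mul_le_mul_of_nonneg_left A1
    (by norm_num : (0 : ℝ) ≤ 4)) T2) T3) T4).trans ?_
  linarith

include hx in
/-- The local error of order two in terms of one-point moments. -/
lemma errorTwo_le (hint : ∀ c, Integrable (fun ω => (x ω c : ℝ) ^ 4) μ) {W : Ω → ℕ}
    (hW : Measurable W) (i : ι) {ξ : ℝ} {φ : ℕ → ℝ}
    (hξ : ∀ b, 1 ≤ b → b ≤ 3 → ∀ c, ∫ ω, (x ω c : ℝ) ^ b ∂μ ≤ ξ ^ b)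
    (hφ : ∀ b, 1 ≤ b → b ≤ 4 → ∀ c, ∫ ω, (x ω c : ℝ) ^ b * condSmooth μ x W ω ∂μ ≤ φ b) :
    NestedSums.errorTwo μ x W (fun a => a i) (fun a => ∑ c, a c) ≤
      4 * (Fintype.card ι : ℝ) ^ 2 * (φ 3 + ξ * φ 2 + ξ ^ 2 * φ 1) := by
  set K := (Fintype.card ι : ℝ)
  have hm := measurable_condSmooth (μ := μ) (W := W) hx
  have h0 := condSmooth_nonneg (μ := μ) (W := W) (x := x)
  have h4 := condSmooth_le (μ := μ) (x := x) hW
  have one0 : ∀ _ : Ω, (0 : ℝ) ≤ 1 := fun _ => zero_le_one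
  have one4 : ∀ _ : Ω, (1 : ℝ) ≤ 4 := fun _ => by norm_num
  have hφ0 : ∀ b, 1 ≤ b → b ≤ 4 → 0 ≤ φ b := fun b h1 hb =>
    (integral_nonneg fun ω => mul_nonneg (by positivity) (h0 ω)).trans (hφ b h1 hb i)
  have hξ0 : 0 ≤ ξ := by
    have := hξ 1 le_rfl (by norm_num) i
    rw [pow_one] at this
    exact (integral_nonneg fun ω => by positivity).trans this
  have A1 := integral_mul_sum_pow_mul_le hx hm h0 h4 hint i (b := 1) (by norm_num)
    (hφ 3 (by norm_num) (by norm_num))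
  have A3 := integral_sum_pow_mul_le hx hm h0 h4 hint (b := 1) (by norm_num)
    (hφ 2 (by norm_num) (by norm_num))
  have A4 := integral_sum_pow_mul_le hx hm h0 h4 hint (b := 0) (by norm_num)
    (hφ 1 (by norm_num) (by norm_num))
  have B1 := integral_mul_sum_pow_mul_le hx measurable_const one0 one4 hint i (b := 0) (by norm_num)
    (φ := ξ ^ 2) (by simpa using hξ 2 (by norm_num) (by norm_num))
  have B4 := integral_sum_pow_mul_le hx measurable_const one0 one4 hint (b := 0) (by norm_num)
    (φ := ξ) (by simpa using hξ 1 (by norm_num) (by norm_num))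
  have B5 := hξ 1 le_rfl (by norm_num) i
  simp only [zero_add, pow_one, mul_one, Nat.reduceAdd] at A1 A3 A4 B1 B4 B5
  have hP : (∫ ω, (x ω i * (∑ c, x ω c : ℕ) : ℝ) ∂μ) +
      (∫ ω, (x ω i : ℝ) ∂μ) * ∫ ω, ((∑ c, x ω c : ℕ) : ℝ) ∂μ ≤ 3 * K * ξ ^ 2 := by
    have := mul_le_mul B5 B4 (integral_nonneg fun ω => by positivity) hξ0
    linarith
  have hPn : 0 ≤ 3 * K * ξ ^ 2 := by positivity
  have T2 := mul_le_mul B5 (mul_le_mul_of_nonneg_left A3 (by norm_num : (0 : ℝ) ≤ 2))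
    (mul_nonneg (by norm_num) (integral_nonneg fun ω => mul_nonneg (by positivity) (h0 ω))) hξ0
  have T3 := mul_le_mul hP A4
    (integral_nonneg fun ω => mul_nonneg (by positivity) (h0 ω)) hPn
  rw [NestedSums.errorTwo]
  have n2 := mul_nonneg hξ0 (hφ0 2 (by norm_num) (by norm_num))
  have n1 := mul_nonneg (pow_nonneg hξ0 2) (hφ0 1 (by norm_num) (by norm_num))
  have hK : 0 ≤ K ^ 2 := by positivity
  have m2 := mul_nonneg hK n2
  have m1 := mul_nonneg hK n1
  refine (add_le_add (add_le_add (mul_le_mul_of_nonneg_left A1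
    (by norm_num : (0 : ℝ) ≤ 2)) T2) T3).trans ?_
  linarith

end Moments

/-! ### Neighbourhoods in the index set -/

lemma latticeDist_comm {d : ℕ} (i j : Fin d → ℤ) : latticeDist i j = latticeDist j i := by
  unfold latticeDist
  congr 1
  funext l
  omega

lemma latticeDist_self {d : ℕ} (i : Fin d → ℤ) : latticeDist i i = 0 := by
  simp [latticeDist]

lemma latticeDist_le_iff {d : ℕ} {i j : Fin d → ℤ} {R : ℕ} :
    latticeDist i j ≤ R ↔ ∀ l, (i l - j l).natAbs ≤ R := by
  simp [latticeDist, Finset.sup_le_iff]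

lemma latticeDist_triangle {d : ℕ} (i j k : Fin d → ℤ) :
    latticeDist i k ≤ latticeDist i j + latticeDist j k := by
  rw [latticeDist_le_iff]
  intro l
  have h1 := (latticeDist_le_iff (i := i) (j := j)).1 le_rfl l
  have h2 := (latticeDist_le_iff (i := j) (j := k)).1 le_rfl l
  omega

section Field

variable {d : ℕ} {J : Finset (Fin d → ℤ)}

/-- The points of `J` at distance at most `R` from `i`. -/
def indexBall (i : J) (R : ℕ) : Finset J :=
  Finset.univ.filter fun l => latticeDist (l : Fin d → ℤ) i ≤ R

lemma mem_indexBall {i l : J} {R : ℕ} :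
    l ∈ indexBall i R ↔ latticeDist (l : Fin d → ℤ) i ≤ R := by
  simp [indexBall]

lemma nbhdC_eq_indexBall (m : ℕ) (i : J) : nbhdC m i = indexBall i (3 * m) := rfl

lemma self_mem_indexBall (i : J) (R : ℕ) : i ∈ indexBall i R := by
  rw [mem_indexBall, latticeDist_self]; exact Nat.zero_le _

lemma indexBall_mono (i : J) {R R' : ℕ} (h : R ≤ R') : indexBall i R ⊆ indexBall i R' :=
  fun l hl => by
    rw [mem_indexBall] at hl ⊢
    exact hl.trans h

/-- A ball of radius `R` contains at most `(2 R + 1) ^ d` points. -/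
lemma card_indexBall_le (i : J) (R : ℕ) : (indexBall i R).card ≤ (2 * R + 1) ^ d := by
  have h : (indexBall i R).card ≤
      (Fintype.piFinset fun l : Fin d => Finset.Icc ((i : Fin d → ℤ) l - R) (i.1 l + R)).card := by
    refine Finset.card_le_card_of_injOn (fun l => (l : Fin d → ℤ)) (fun l hl => ?_)
      (fun a _ b _ hab => Subtype.ext hab)
    have hl' := latticeDist_le_iff.1 (mem_indexBall.1 hl)
    rw [Finset.mem_coe, Fintype.mem_piFinset]
    intro t
    rw [Finset.mem_Icc]
    have := hl' t
    change (i : Fin d → ℤ) t - R ≤ (l : Fin d → ℤ) t ∧ (l : Fin d → ℤ) t ≤ (i : Fin d → ℤ) t + R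
    constructor <;> omega
  refine h.trans (le_of_eq ?_)
  rw [Fintype.card_piFinset]
  have : ∀ l : Fin d, (Finset.Icc ((i : Fin d → ℤ) l - R) (i.1 l + R)).card = 2 * R + 1 := by
    intro l
    rw [Int.card_Icc]
    omega
  simp [this]

lemma sum_ite_mem_subtype {M B : Finset J} (h : B ⊆ M) (f : J → ℕ) :
    ∑ l : M, (if (l : J) ∈ B then f l else 0) = ∑ l ∈ B, f l := by
  rw [Finset.sum_coe_sort M fun l => if l ∈ B then f l else 0, Finset.sum_ite_mem,
    Finset.inter_eq_right.2 h]

variable {Ω : Type*} [MeasurableSpace Ω] {μ : Measure Ω} [IsProbabilityMeasure μ]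
  {X : J → Ω → ℕ} {m : ℕ}

/-- The restriction of the field to a set of indices. -/
def restrictField (X : J → Ω → ℕ) (S : Finset J) (ω : Ω) (l : S) : ℕ := X l ω

lemma measurable_restrictField (hX : ∀ i, Measurable (X i)) (S : Finset J) :
    Measurable (restrictField X S) :=
  measurable_pi_lambda _ fun l => hX l

lemma measurable_fieldSum (hX : ∀ i, Measurable (X i)) : Measurable (fieldSum X) :=
  Finset.measurable_sum _ fun i _ => hX i

/-- The conditional smoothness given `X_S` is the smoothness given the discrete variable
`restrictField X S`. -/
lemma condSmoothness_eq (S : Finset J) (ω : Ω) :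
    condSmoothness μ X S ω = condSmooth μ (restrictField X S) (fieldSum X) ω := by
  unfold condSmoothness condSmooth
  have : {ω' | ∀ l ∈ S, X l ω' = X l ω} = {ω' | restrictField X S ω' = restrictField X S ω} := by
    ext ω'
    simp only [Set.mem_ofPred_eq, funext_iff, restrictField, Subtype.forall]
  rw [this]

/-- The `m`-dependence, for arbitrary functions of the two subfamilies. Measurability is automatic
since the subfamilies take values in countable discrete spaces. -/
lemma indepFun_of_far (hdep : IsMDependent m X μ) {M N : Finset J}
    (hMN : ∀ i ∈ M, ∀ j ∈ N, m < latticeDist (i : Fin d → ℤ) j) {β γ : Type*}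
    [MeasurableSpace β] [MeasurableSpace γ] (φ : (M → ℕ) → β) (ψ : (N → ℕ) → γ) :
    IndepFun (fun ω => φ (restrictField X M ω)) (fun ω => ψ (restrictField X N ω)) μ :=
  (hdep M N hMN).comp Measurable.of_discrete Measurable.of_discrete

lemma far_of_mem_indexBall {i l l' : J} {R : ℕ} (hl : l ∈ indexBall i R)
    (hl' : l' ∈ (indexBall i (R + m))ᶜ) : m < latticeDist (l : Fin d → ℤ) l' := by
  rw [Finset.mem_compl, mem_indexBall] at hl'
  rw [mem_indexBall] at hl
  have := latticeDist_triangle (l' : Fin d → ℤ) l i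
  rw [latticeDist_comm (l' : Fin d → ℤ) l] at this
  omega

/-- The sum of the coordinates indexed by `B`, as a function of the field on `S`. -/
def partialSum (S B : Finset J) (a : S → ℕ) : ℕ := ∑ l : S, if (l : J) ∈ B then a l else 0

lemma partialSum_restrictField {S B : Finset J} (h : B ⊆ S) (ω : Ω) :
    partialSum S B (restrictField X S ω) = ∑ l ∈ B, X l ω :=
  sum_ite_mem_subtype h fun l => X l ω

lemma partialSum_self (S : Finset J) (a : S → ℕ) : partialSum S S a = ∑ l, a l := by
  simp [partialSum]

lemma partialSum_mono (S : Finset J) {B B' : Finset J} (h : B ⊆ B') (a : S → ℕ) :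
    partialSum S B a ≤ partialSum S B' a := by
  refine Finset.sum_le_sum fun l _ => ?_
  by_cases hl : (l : J) ∈ B
  · simp [hl, h hl]
  · simp [hl]

lemma fieldSum_sub_partialSum {S B : Finset J} (h : B ⊆ S) (ω : Ω) :
    (fieldSum X ω : ℤ) - partialSum S B (restrictField X S ω) =
      ((∑ l : (Bᶜ : Finset J), restrictField X Bᶜ ω l : ℕ) : ℤ) := by
  rw [partialSum_restrictField h, fieldSum, ← Finset.sum_add_sum_compl B]
  have : ∑ l : (Bᶜ : Finset J), restrictField X Bᶜ ω l = ∑ l ∈ Bᶜ, X l ω :=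
    Finset.sum_coe_sort Bᶜ fun l => X l ω
  rw [this]
  push_cast
  ring

lemma integrable_one_add_fieldSum_pow (hX : ∀ i, Measurable (X i))
    (hint : ∀ i, Integrable (fun ω => (X i ω : ℝ) ^ 4) μ) :
    Integrable (fun ω => (1 + (fieldSum X ω : ℝ)) ^ 4) μ := by
  have h1 : Integrable (fun ω => 8 * (1 + (Fintype.card J : ℝ) ^ 3 * ∑ i, (X i ω : ℝ) ^ 4)) μ :=
    ((integrable_const (1 : ℝ)).add ((integrable_finsetSum _ fun i _ => hint i).const_mul
      _)).const_mul 8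
  refine h1.mono' ((Measurable.of_discrete (f := fun n : ℕ => (1 + (n : ℝ)) ^ 4)).comp
    (measurable_fieldSum hX)).aestronglyMeasurable (Filter.Eventually.of_forall fun ω => ?_)
  have h2 := pow_sum_le_card_pow_mul (fun i => X i ω) 3
  rw [Real.norm_eq_abs, abs_of_nonneg (by positivity)]
  have h3 : (1 + (fieldSum X ω : ℝ)) ^ 4 ≤ 8 * (1 + (fieldSum X ω : ℝ) ^ 4) := by
    have : (0 : ℝ) ≤ fieldSum X ω := Nat.cast_nonneg _
    nlinarith [sq_nonneg ((fieldSum X ω : ℝ) - 1), sq_nonneg ((fieldSum X ω : ℝ) ^ 2 - 1),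
      sq_nonneg ((fieldSum X ω : ℝ) ^ 2 - fieldSum X ω)]
  refine h3.trans ?_
  gcongr
  exact h2

/-- The nested sums around `i`: the partial sums over the balls of radius `m`, `2 m` and `3 m`. -/
lemma nestedSums (hX : ∀ i, Measurable (X i))
    (hint : ∀ i, Integrable (fun ω => (X i ω : ℝ) ^ 4) μ) (i : J) :
    NestedSums μ (restrictField X (nbhdC m i)) (fieldSum X)
      (partialSum (nbhdC m i) (indexBall i m)) (partialSum (nbhdC m i) (indexBall i (2 * m)))
      (fun a => ∑ l, a l) where
  measurable_x := measurable_restrictField hX _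
  measurable_W := measurable_fieldSum hX
  integrable_pow := integrable_one_add_fieldSum_pow hX hint
  le₁₂ := partialSum_mono _ (indexBall_mono i (by omega))
  le₂₃ a := by
    rw [← partialSum_self]
    exact partialSum_mono _ (indexBall_mono i (by omega)) a
  le_W ω := by
    rw [← partialSum_self, partialSum_restrictField subset_rfl]
    exact Finset.sum_le_univ_sum_of_nonneg fun _ => Nat.zero_le _

/-- A function of the field on the ball of radius `R` is independent of the sum over the complement of
the ball of radius `R + m`. -/
lemma indepFun_partialSum (hdep : IsMDependent m X μ) (i : J) {S : Finset J} {R : ℕ}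
    (hR : indexBall i (R + m) ⊆ S) {β : Type*} [MeasurableSpace β] {f : Ω → β}
    (φ : (indexBall i R → ℕ) → β)
    (hf : ∀ ω, f ω = φ (restrictField X (indexBall i R) ω)) :
    IndepFun f (fun ω => (fieldSum X ω : ℤ) -
      partialSum S (indexBall i (R + m)) (restrictField X S ω)) μ := by
  have h := indepFun_of_far hdep (M := indexBall i R) (N := (indexBall i (R + m))ᶜ)
    (fun l hl l' hl' => far_of_mem_indexBall hl hl') φ
    (fun q => ((∑ l, q l : ℕ) : ℤ))
  rw [funext hf]
  convert h using 2 with ω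
  exact fieldSum_sub_partialSum hR ω

/-- The summand at `i` is independent of the sum outside the ball of radius `m`. -/
lemma indep_one (hdep : IsMDependent m X μ) (i : J) :
    IndepFun (fun ω => X i ω) (fun ω => (fieldSum X ω : ℤ) -
      partialSum (nbhdC m i) (indexBall i m) (restrictField X (nbhdC m i) ω)) μ := by
  have := indepFun_partialSum hdep i (S := nbhdC m i) (R := 0) (f := fun ω => X i ω)
    (indexBall_mono i (by omega)) (fun a => a ⟨i, self_mem_indexBall i 0⟩) (fun ω => rfl)
  simpa only [zero_add] using this

/-- The summand at `i` and its first partial sum are independent of the sum outside the ball of radius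
`2 m`. -/
lemma indep_two (hdep : IsMDependent m X μ) (i : J) :
    IndepFun (fun ω => (X i ω,
        partialSum (nbhdC m i) (indexBall i m) (restrictField X (nbhdC m i) ω)))
      (fun ω => (fieldSum X ω : ℤ) -
      partialSum (nbhdC m i) (indexBall i (2 * m)) (restrictField X (nbhdC m i) ω)) μ := by
  have := indepFun_partialSum hdep i (S := nbhdC m i) (R := m)
    (f := fun ω => (X i ω,
        partialSum (nbhdC m i) (indexBall i m) (restrictField X (nbhdC m i) ω)))
    (indexBall_mono i (by omega))
    (fun a => (a ⟨i, self_mem_indexBall i m⟩, partialSum (indexBall i m) (indexBall i m) a))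
    (fun ω => Prod.ext rfl <| (partialSum_restrictField (indexBall_mono i (by omega)) ω).trans
      (partialSum_restrictField subset_rfl ω).symm)
  simpa only [two_mul] using this

/-- The summand at `i` and its first two partial sums are independent of the sum outside the ball of
radius `3 m`. -/
lemma indep_three (hdep : IsMDependent m X μ) (i : J) :
    IndepFun (fun ω => (X i ω,
        partialSum (nbhdC m i) (indexBall i m) (restrictField X (nbhdC m i) ω),
        partialSum (nbhdC m i) (indexBall i (2 * m)) (restrictField X (nbhdC m i) ω)))
      (fun ω => (fieldSum X ω : ℤ) -
        ((∑ l, restrictField X (nbhdC m i) ω l : ℕ) : ℤ)) μ := by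
  have := indepFun_partialSum hdep i (S := nbhdC m i) (R := 2 * m)
    (f := fun ω => (X i ω,
        partialSum (nbhdC m i) (indexBall i m) (restrictField X (nbhdC m i) ω),
        partialSum (nbhdC m i) (indexBall i (2 * m)) (restrictField X (nbhdC m i) ω)))
    (indexBall_mono i (by omega))
    (fun a => (a ⟨i, self_mem_indexBall i _⟩, partialSum _ (indexBall i m) a,
      partialSum _ (indexBall i (2 * m)) a))
    (fun ω => Prod.ext rfl <| Prod.ext
      ((partialSum_restrictField (indexBall_mono i (by omega)) ω).trans
        (partialSum_restrictField (indexBall_mono i (by omega)) ω).symm)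
      ((partialSum_restrictField (indexBall_mono i (by omega)) ω).trans
        (partialSum_restrictField subset_rfl ω).symm))
  have e : 2 * m + m = 3 * m := by ring
  simp only [e, ← nbhdC_eq_indexBall, partialSum_self] at this
  exact this

/-- The index `i` as an element of its own neighbourhood. -/
def nbhdC.self (m : ℕ) (i : J) : nbhdC m i := ⟨i, self_mem_indexBall i (3 * m)⟩

lemma le_partialSum_ball (i : J) (a : nbhdC m i → ℕ) :
    a (nbhdC.self m i) ≤ partialSum (nbhdC m i) (indexBall i m) a := by
  have := Finset.single_le_sum (f := fun l : nbhdC m i => if (l : J) ∈ indexBall i m then a l else 0)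
    (fun l _ => Nat.zero_le _) (Finset.mem_univ (nbhdC.self m i))
  rwa [if_pos (show ((nbhdC.self m i : nbhdC m i) : J) ∈ indexBall i m from
    self_mem_indexBall i m)] at this

lemma integrable_mul_fieldSum (hX : ∀ i, Measurable (X i))
    (hint : ∀ i, Integrable (fun ω => (X i ω : ℝ) ^ 4) μ) (i : J) {g : ℤ → ℝ}
    (hg : HasPolyGrowth 3 g) :
    Integrable (fun ω => (X i ω : ℝ) * g (fieldSum X ω)) μ := by
  obtain ⟨C, hC, hg⟩ := hg
  refine ((integrable_one_add_fieldSum_pow hX hint).const_mul C).mono' ?_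
    (Filter.Eventually.of_forall fun ω => ?_)
  · exact ((Measurable.of_discrete (f := fun z : ℕ × ℕ => (z.1 : ℝ) * g z.2)).comp
      ((hX i).prodMk (measurable_fieldSum hX))).aestronglyMeasurable
  · have h1 : (X i ω : ℝ) ≤ 1 + fieldSum X ω := by
      have : X i ω ≤ fieldSum X ω :=
        Finset.single_le_sum (f := fun j => X j ω) (fun _ _ => Nat.zero_le _) (Finset.mem_univ i)
      have : (X i ω : ℝ) ≤ fieldSum X ω := by exact_mod_cast this
      linarith
    rw [Real.norm_eq_abs, abs_mul, Nat.abs_cast]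
    calc (X i ω : ℝ) * |g (fieldSum X ω)| ≤
          (1 + fieldSum X ω) * (C * (1 + fieldSum X ω) ^ 3) := by
            gcongr
            exact hg _
      _ = _ := by ring

/-! ### The expansion of `E[W g(W)]` -/

/-- The total error of the third order expansion: the local errors summed over the index set. -/
noncomputable def totalErrorThree (μ : Measure Ω) (X : J → Ω → ℕ) (m : ℕ) : ℝ :=
  ∑ i : J, NestedSums.errorThree μ (restrictField X (nbhdC m i)) (fieldSum X)
    (fun a => a (nbhdC.self m i)) (fun a => ∑ l, a l)

/-- The total error of the second order expansion: the local errors summed over the index set. -/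
noncomputable def totalErrorTwo (μ : Measure Ω) (X : J → Ω → ℕ) (m : ℕ) : ℝ :=
  ∑ i : J, NestedSums.errorTwo μ (restrictField X (nbhdC m i)) (fieldSum X)
    (fun a => a (nbhdC.self m i)) (fun a => ∑ l, a l)

lemma integral_fieldSum_mul (hX : ∀ i, Measurable (X i))
    (hint : ∀ i, Integrable (fun ω => (X i ω : ℝ) ^ 4) μ) {g : ℤ → ℝ} (hg : HasPolyGrowth 3 g) :
    ∫ ω, (fieldSum X ω : ℝ) * g (fieldSum X ω) ∂μ =
      ∑ i, ∫ ω, (X i ω : ℝ) * g (fieldSum X ω) ∂μ := by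
  rw [← integral_finsetSum _ fun i _ => integrable_mul_fieldSum hX hint i hg]
  refine integral_congr_ae (Filter.Eventually.of_forall fun ω => ?_)
  simp only [← Finset.sum_mul]
  congr 1
  simp [fieldSum]

/-- The local expansions summed over the index set. The coefficients do not depend on `g`, so they
can be identified afterwards. -/
lemma exists_field_expansion_three (hX : ∀ i, Measurable (X i))
    (hint : ∀ i, Integrable (fun ω => (X i ω : ℝ) ^ 4) μ) (hdep : IsMDependent m X μ) :
    ∃ a₁ a₂ a₃ : ℝ, ∀ (g : ℤ → ℝ) (H : ℝ), IsSecondDiff H (Δ (Δ (Δ g))) →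
      |(∫ ω, (fieldSum X ω : ℝ) * g (fieldSum X ω) ∂μ)
        - (a₁ * (∫ ω, g ((fieldSum X ω : ℤ) + 1) ∂μ)
        + a₂ * (∫ ω, Δ g ((fieldSum X ω : ℤ) + 1) ∂μ)
        + a₃ * (∫ ω, Δ (Δ g) ((fieldSum X ω : ℤ) + 1) ∂μ))| ≤ H * totalErrorThree μ X m := by
  choose a₁ a₂ a₃ h using fun i : J =>
    (nestedSums (m := m) hX hint i).exists_expansion_three (le_partialSum_ball i)
      (indep_one hdep i) (indep_two hdep i) (indep_three hdep i)
  refine ⟨∑ i, a₁ i, ∑ i, a₂ i, ∑ i, a₃ i, fun g H hg => ?_⟩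
  have hgr : HasPolyGrowth 3 g :=
    ((HasPolyGrowth.of_isSecondDiff hg).of_fwdDiff.of_fwdDiff).of_fwdDiff
  rw [integral_fieldSum_mul hX hint hgr, totalErrorThree, Finset.mul_sum, Finset.sum_mul,
    Finset.sum_mul, Finset.sum_mul, ← Finset.sum_add_distrib, ← Finset.sum_add_distrib,
    ← Finset.sum_sub_distrib]
  exact (Finset.abs_sum_le_sum_abs _ _).trans (Finset.sum_le_sum fun i _ => h i g H hg)

lemma exists_field_expansion_two (hX : ∀ i, Measurable (X i))
    (hint : ∀ i, Integrable (fun ω => (X i ω : ℝ) ^ 4) μ) (hdep : IsMDependent m X μ) :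
    ∃ a₁ a₂ : ℝ, ∀ (g : ℤ → ℝ) (H : ℝ), IsSecondDiff H (Δ (Δ g)) →
      |(∫ ω, (fieldSum X ω : ℝ) * g (fieldSum X ω) ∂μ)
        - (a₁ * (∫ ω, g ((fieldSum X ω : ℤ) + 1) ∂μ)
        + a₂ * (∫ ω, Δ g ((fieldSum X ω : ℤ) + 1) ∂μ))| ≤ H * totalErrorTwo μ X m := by
  choose a₁ a₂ h using fun i : J =>
    (nestedSums (m := m) hX hint i).exists_expansion_two (le_partialSum_ball i)
      (indep_one hdep i) (indep_two hdep i)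
  refine ⟨∑ i, a₁ i, ∑ i, a₂ i, fun g H hg => ?_⟩
  have hgr : HasPolyGrowth 3 g :=
    (((HasPolyGrowth.of_isSecondDiff hg).of_fwdDiff).of_fwdDiff).mono (by norm_num)
  rw [integral_fieldSum_mul hX hint hgr, totalErrorTwo, Finset.mul_sum, Finset.sum_mul,
    Finset.sum_mul, ← Finset.sum_add_distrib, ← Finset.sum_sub_distrib]
  exact (Finset.abs_sum_le_sum_abs _ _).trans (Finset.sum_le_sum fun i _ => h i g H hg)

lemma isSecondDiff_zero_of_eq {Φ : ℤ → ℝ} (h : ∀ k, Φ k = 0) : IsSecondDiff 0 Φ :=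
  (IsSecondDiff.zero le_rfl).congr h

lemma factMoment_one (W : Ω → ℕ) : factMoment μ W 1 = ∫ ω, (W ω : ℝ) ∂μ := by
  simp [factMoment]

lemma factMoment_two (W : Ω → ℕ) : factMoment μ W 2 = ∫ ω, (W ω : ℝ) * ((W ω : ℝ) - 1) ∂μ := by
  unfold factMoment
  refine integral_congr_ae (Filter.Eventually.of_forall fun ω => ?_)
  simp only
  rcases W ω with _ | n
  · simp
  · simp [Nat.descFactorial_succ]; ring

lemma factMoment_three (W : Ω → ℕ) :
    factMoment μ W 3 = ∫ ω, (W ω : ℝ) * (((W ω : ℝ) - 1) * ((W ω : ℝ) - 2)) ∂μ := by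
  unfold factMoment
  refine integral_congr_ae (Filter.Eventually.of_forall fun ω => ?_)
  simp only
  rcases W ω with _ | _ | n
  · simp
  · simp [Nat.descFactorial_succ]
  · simp [Nat.descFactorial_succ]; ring

/-- The third order expansion of `E[W g(W)]`: its coefficients are identified as the factorial
cumulants by inserting polynomials of degree at most two, for which the error vanishes. -/
lemma field_expansion_three (hX : ∀ i, Measurable (X i))
    (hint : ∀ i, Integrable (fun ω => (X i ω : ℝ) ^ 4) μ) (hdep : IsMDependent m X μ)
    {g : ℤ → ℝ} {H : ℝ} (hg : IsSecondDiff H (Δ (Δ (Δ g)))) :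
    |(∫ ω, (fieldSum X ω : ℝ) * g (fieldSum X ω) ∂μ)
      - (Gam1 μ (fieldSum X) * (∫ ω, g ((fieldSum X ω : ℤ) + 1) ∂μ)
      + Gam2 μ (fieldSum X) * (∫ ω, Δ g ((fieldSum X ω : ℤ) + 1) ∂μ)
      + Gam3 μ (fieldSum X) * (∫ ω, Δ (Δ g) ((fieldSum X ω : ℤ) + 1) ∂μ))|
      ≤ H * totalErrorThree μ X m := by
  obtain ⟨a₁, a₂, a₃, h⟩ := exists_field_expansion_three hX hint hdep
  have p0 := h (fun _ => 1) 0 (isSecondDiff_zero_of_eq fun k => by simp [fwdDiff])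
  have p1 := h (fun k => (k : ℝ) - 1) 0 (isSecondDiff_zero_of_eq fun k => by simp [fwdDiff])
  have p2 := h (fun k => ((k : ℝ) - 1) * ((k : ℝ) - 2)) 0
    (isSecondDiff_zero_of_eq fun k => by simp [fwdDiff]; ring)
  rw [zero_mul, abs_nonpos_iff, sub_eq_zero] at p0 p1 p2
  have q1 : ∀ k : ℤ, ((k + 1 : ℤ) : ℝ) - 1 = k := fun k => by push_cast; ring
  have q2 : ∀ k : ℤ, (((k + 1 : ℤ) : ℝ) - 1) * (((k + 1 : ℤ) : ℝ) - 2) = k * (k - 1) := fun k => by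
    push_cast; ring
  have d0 : ∀ k : ℤ, Δ (fun _ : ℤ => (1 : ℝ)) k = 0 := fun k => by simp [fwdDiff]
  have d00 : ∀ k : ℤ, Δ (Δ (fun _ : ℤ => (1 : ℝ))) k = 0 := fun k => by simp [fwdDiff]
  have d1 : ∀ k : ℤ, Δ (fun k : ℤ => (k : ℝ) - 1) k = 1 := fun k => by
    simp [fwdDiff]
  have d11 : ∀ k : ℤ, Δ (Δ (fun k : ℤ => (k : ℝ) - 1)) k = 0 := fun k => by
    simp [fwdDiff]
  have d2 : ∀ k : ℤ, Δ (fun k : ℤ => ((k : ℝ) - 1) * ((k : ℝ) - 2)) (k + 1) = 2 * k := fun k => by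
    simp [fwdDiff]; ring
  have d22 : ∀ k : ℤ, Δ (Δ (fun k : ℤ => ((k : ℝ) - 1) * ((k : ℝ) - 2))) k = 2 := fun k => by
    simp [fwdDiff]; ring
  simp only [d0, d00, integral_const, probReal_univ, smul_eq_mul, mul_one, mul_zero, add_zero]
    at p0
  simp only [q1, d1, d11, integral_const, probReal_univ, smul_eq_mul, mul_one, mul_zero, add_zero,
    Int.cast_natCast] at p1
  simp only [q2, d2, d22, integral_const, integral_const_mul, probReal_univ, smul_eq_mul, one_mul,
    Int.cast_natCast] at p2
  rw [← factMoment_one] at p0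
  rw [← factMoment_two, ← factMoment_one] at p1
  rw [← factMoment_three, ← factMoment_two, ← factMoment_one] at p2
  have e1 : Gam1 μ (fieldSum X) = a₁ := p0
  have e2 : Gam2 μ (fieldSum X) = a₂ := by
    rw [Gam2]; linear_combination p1 - factMoment μ (fieldSum X) 1 * p0
  have e3 : Gam3 μ (fieldSum X) = a₃ := by
    rw [Gam3]
    set t₁ := factMoment μ (fieldSum X) 1
    set t₂ := factMoment μ (fieldSum X) 2
    linear_combination p2 / 2 - t₁ * p1 + (t₁ ^ 2 - t₂ / 2) * p0
  rw [e1, e2, e3]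
  exact h g H hg

/-- The second order expansion of `E[W g(W)]`, with coefficients identified by affine functions. -/
lemma field_expansion_two (hX : ∀ i, Measurable (X i))
    (hint : ∀ i, Integrable (fun ω => (X i ω : ℝ) ^ 4) μ) (hdep : IsMDependent m X μ)
    {g : ℤ → ℝ} {H : ℝ} (hg : IsSecondDiff H (Δ (Δ g))) :
    |(∫ ω, (fieldSum X ω : ℝ) * g (fieldSum X ω) ∂μ)
      - (Gam1 μ (fieldSum X) * (∫ ω, g ((fieldSum X ω : ℤ) + 1) ∂μ)
      + Gam2 μ (fieldSum X) * (∫ ω, Δ g ((fieldSum X ω : ℤ) + 1) ∂μ))|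
      ≤ H * totalErrorTwo μ X m := by
  obtain ⟨a₁, a₂, h⟩ := exists_field_expansion_two hX hint hdep
  have p0 := h (fun _ => 1) 0 (isSecondDiff_zero_of_eq fun k => by simp [fwdDiff])
  have p1 := h (fun k => (k : ℝ) - 1) 0 (isSecondDiff_zero_of_eq fun k => by simp [fwdDiff])
  rw [zero_mul, abs_nonpos_iff, sub_eq_zero] at p0 p1
  have q1 : ∀ k : ℤ, ((k + 1 : ℤ) : ℝ) - 1 = k := fun k => by push_cast; ring
  have d0 : ∀ k : ℤ, Δ (fun _ : ℤ => (1 : ℝ)) k = 0 := fun k => by simp [fwdDiff]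
  have d1 : ∀ k : ℤ, Δ (fun k : ℤ => (k : ℝ) - 1) k = 1 := fun k => by
    simp [fwdDiff]
  simp only [d0, integral_const, probReal_univ, smul_eq_mul, mul_one, mul_zero, add_zero]
    at p0
  simp only [q1, d1, integral_const, probReal_univ, smul_eq_mul, mul_one,
    Int.cast_natCast] at p1
  rw [← factMoment_one] at p0
  rw [← factMoment_two, ← factMoment_one] at p1
  have e1 : Gam1 μ (fieldSum X) = a₁ := p0
  have e2 : Gam2 μ (fieldSum X) = a₂ := by
    rw [Gam2]; linear_combination p1 - factMoment μ (fieldSum X) 1 * p0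
  rw [e1, e2]
  exact h g H hg

end Field

/-! ### Weighted moments -/

section WeightedMoments

variable {Ω : Type*} [MeasurableSpace Ω] {μ : Measure Ω}

/-- The weighted inequality of arithmetic and geometric means for `y ^ 4` and `1`. -/
lemma pow_le_weighted_mean {y : ℝ} (hy : 0 ≤ y) {b : ℕ} (hb : b ≤ 4) :
    y ^ b ≤ b / 4 * y ^ 4 + (1 - b / 4) := by
  interval_cases b
  · norm_num
  · nlinarith [mul_nonneg (sq_nonneg (y - 1)) (by positivity : 0 ≤ y ^ 2 + 2 * y + 3)]
  · nlinarith [sq_nonneg (y ^ 2 - 1)]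
  · nlinarith [mul_nonneg (sq_nonneg (y - 1)) (by positivity : 0 ≤ 3 * y ^ 2 + 2 * y + 1)]
  · norm_num

lemma integral_pow_mul_le_of_pos {Y D : Ω → ℝ} (hY : ∀ ω, 0 ≤ Y ω) (hD : ∀ ω, 0 ≤ D ω)
    (hi : Integrable (fun ω => Y ω ^ 4 * D ω) μ) (hiD : Integrable D μ) {s t : ℝ} (hs : 0 < s)
    (ht : 0 < t) (hYs : ∫ ω, Y ω ^ 4 * D ω ∂μ ≤ s ^ 4) (hDt : ∫ ω, D ω ∂μ ≤ t ^ 4) {b : ℕ}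
    (hb : b ≤ 4) : ∫ ω, Y ω ^ b * D ω ∂μ ≤ s ^ b * t ^ (4 - b) := by
  have hb' : (b : ℝ) ≤ 4 := by exact_mod_cast hb
  have h1 : ∀ ω, Y ω ^ b * D ω ≤ (s / t) ^ b * (b / 4 * (t / s) ^ 4) * (Y ω ^ 4 * D ω) +
      (s / t) ^ b * (1 - b / 4) * D ω := fun ω => by
    have := pow_le_weighted_mean (y := Y ω * (t / s)) (mul_nonneg (hY ω) (by positivity)) hb
    calc Y ω ^ b * D ω = (s / t) ^ b * (Y ω * (t / s)) ^ b * D ω := by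
          rw [← mul_pow]
          congr 2
          field_simp
      _ ≤ (s / t) ^ b * (b / 4 * (Y ω * (t / s)) ^ 4 + (1 - b / 4)) * D ω := by
          gcongr
          exact hD ω
      _ = _ := by ring
  refine (integral_mono_of_nonneg (Filter.Eventually.of_forall fun ω =>
    mul_nonneg (pow_nonneg (hY ω) _) (hD ω)) ((hi.const_mul _).add (hiD.const_mul _))
    (Filter.Eventually.of_forall h1)).trans ?_
  simp only [Pi.add_apply]
  rw [integral_add (hi.const_mul _) (hiD.const_mul _), integral_const_mul, integral_const_mul]
  have h2 : 0 ≤ 1 - (b : ℝ) / 4 := by linarith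
  calc _ ≤ (s / t) ^ b * (b / 4 * (t / s) ^ 4) * s ^ 4 + (s / t) ^ b * (1 - b / 4) * t ^ 4 := by
        gcongr
    _ = (s / t) ^ b * t ^ 4 := by field_simp; ring
    _ = s ^ b * t ^ (4 - b) := by
        rw [← pow_mul_pow_sub t hb, div_pow]
        field_simp

/-- Hölder's inequality for the moments of `Y` weighted by `D`, stated for fourth roots `s` and `t` of
bounds for the two extreme moments. Degenerate `s` or `t` are reached as limits. -/
lemma integral_pow_mul_le {Y D : Ω → ℝ} (hY : ∀ ω, 0 ≤ Y ω) (hD : ∀ ω, 0 ≤ D ω)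
    (hi : Integrable (fun ω => Y ω ^ 4 * D ω) μ) (hiD : Integrable D μ) {s t : ℝ} (hs : 0 ≤ s)
    (ht : 0 ≤ t) (hYs : ∫ ω, Y ω ^ 4 * D ω ∂μ ≤ s ^ 4) (hDt : ∫ ω, D ω ∂μ ≤ t ^ 4) {b : ℕ}
    (hb : b ≤ 4) : ∫ ω, Y ω ^ b * D ω ∂μ ≤ s ^ b * t ^ (4 - b) := by
  have hlim : Filter.Tendsto (fun ε : ℝ => (s + ε) ^ b * (t + ε) ^ (4 - b))
      (nhdsWithin 0 (Set.Ioi 0)) (nhds (s ^ b * t ^ (4 - b))) := by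
    have : Continuous fun ε : ℝ => (s + ε) ^ b * (t + ε) ^ (4 - b) := by fun_prop
    simpa using (this.tendsto 0).mono_left nhdsWithin_le_nhds
  refine ge_of_tendsto hlim ?_
  filter_upwards [self_mem_nhdsWithin] with ε hε
  have hε' : 0 < ε := hε
  refine integral_pow_mul_le_of_pos hY hD hi hiD (by positivity) (by positivity)
    (hYs.trans ?_) (hDt.trans ?_) hb
  · gcongr; linarith
  · gcongr; linarith

end WeightedMoments

/-! ### Lower bounds for the smoothness term -/

section Field

variable {d : ℕ} {J : Finset (Fin d → ℤ)} {Ω : Type*} [MeasurableSpace Ω] {μ : Measure Ω}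
  [IsProbabilityMeasure μ] {X : J → Ω → ℕ} {m : ℕ}

/-- The conditional smoothness of the field sum given the field around `i`. -/
noncomputable def localSmooth (μ : Measure Ω) (X : J → Ω → ℕ) (m : ℕ) (i : J) (ω : Ω) : ℝ :=
  condSmooth μ (restrictField X (nbhdC m i)) (fieldSum X) ω

lemma localSmooth_nonneg (i : J) (ω : Ω) : 0 ≤ localSmooth μ X m i ω := condSmooth_nonneg ω

lemma integrable_mul_localSmooth (hX : ∀ i, Measurable (X i)) (i : J) {Y : Ω → ℝ}
    (hY : Integrable Y μ) : Integrable (fun ω => Y ω * localSmooth μ X m i ω) μ :=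
  integrable_mul_condSmooth (measurable_restrictField hX _) (measurable_fieldSum hX) hY

lemma integrable_localSmooth (hX : ∀ i, Measurable (X i)) (i : J) :
    Integrable (localSmooth μ X m i) μ := by
  simpa using integrable_mul_localSmooth (m := m) hX i (integrable_const (1 : ℝ) (μ := μ))

lemma integral_le_supFourthSmooth (i j : J) :
    ∫ ω, (X i ω : ℝ) ^ 4 * localSmooth μ X m j ω ∂μ ≤ supFourthSmooth m X μ := by
  simp only [supFourthSmooth, condSmoothness_eq]
  exact (le_ciSup (f := fun j => ∫ ω, (X i ω : ℝ) ^ 4 * localSmooth μ X m j ω ∂μ)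
    (Set.finite_range _).bddAbove j).trans (le_ciSup (f := fun i => ⨆ j,
      ∫ ω, (X i ω : ℝ) ^ 4 * localSmooth μ X m j ω ∂μ) (Set.finite_range _).bddAbove i)

lemma supFourthSmooth_nonneg : 0 ≤ supFourthSmooth m X μ :=
  Real.iSup_nonneg fun _ => Real.iSup_nonneg fun _ => integral_nonneg fun _ =>
    mul_nonneg (by positivity) (secondDiffNorm_nonneg _)

lemma indepFun_pair (hdep : IsMDependent m X μ) {a b : J}
    (h : m < latticeDist (a : Fin d → ℤ) b) : IndepFun (X a) (X b) μ :=
  indepFun_of_far hdep (M := {a}) (N := {b}) (by simpa using h)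
    (fun q => q ⟨a, Finset.mem_singleton_self a⟩) (fun q => q ⟨b, Finset.mem_singleton_self b⟩)

/-- Far from `i` the fourth moments factor out of the weighted fourth moments. -/
lemma integral_pow_four_mul_of_far (hX : ∀ i, Measurable (X i)) (hdep : IsMDependent m X μ)
    {a i : J} (h : 4 * m < latticeDist (a : Fin d → ℤ) i) :
    ∫ ω, (X a ω : ℝ) ^ 4 * localSmooth μ X m i ω ∂μ =
      (∫ ω, (X a ω : ℝ) ^ 4 ∂μ) * ∫ ω, localSmooth μ X m i ω ∂μ := by
  have hi : IndepFun (fun ω => (X a ω : ℝ) ^ 4) (localSmooth μ X m i) μ := by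
    refine indepFun_of_far hdep (M := {a}) (N := nbhdC m i) (fun l hl l' hl' => ?_)
      (fun q => (q ⟨a, Finset.mem_singleton_self a⟩ : ℝ) ^ 4)
      (fun q => secondDiffNorm fun k =>
        (ProbabilityTheory.cond μ {ω' | restrictField X (nbhdC m i) ω' = q}).real
          {ω' | (fieldSum X ω' : ℤ) = k})
    rw [Finset.mem_singleton] at hl
    subst hl
    rw [nbhdC_eq_indexBall, mem_indexBall] at hl'
    have := latticeDist_triangle (l : Fin d → ℤ) l' i
    omega
  exact hi.integral_fun_mul_eq_mul_integral
    ((Measurable.of_discrete (f := fun n : ℕ => (n : ℝ) ^ 4)).comp (hX a)).aestronglyMeasurable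
    (measurable_condSmooth (measurable_restrictField hX _)).aestronglyMeasurable

lemma memLp_two (hX : ∀ i, Measurable (X i))
    (hint : ∀ i, Integrable (fun ω => (X i ω : ℝ) ^ 4) μ) (i : J) :
    MemLp (fun ω => (X i ω : ℝ)) 2 μ :=
  (memLp_two_iff_integrable_sq
    ((Measurable.of_discrete (f := fun n : ℕ => (n : ℝ))).comp (hX i)).aestronglyMeasurable).2
    (integrable_pow_of_four (hX i) (hint i) (by norm_num))

/-- Covariances vanish beyond distance `m`. Within that distance the nonnegativity of the field and
the inequality `2 x y ≤ x² + y²` suffice. -/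
lemma covariance_le (hX : ∀ i, Measurable (X i))
    (hint : ∀ i, Integrable (fun ω => (X i ω : ℝ) ^ 4) μ) (hdep : IsMDependent m X μ) (a b : J) :
    ProbabilityTheory.covariance (fun ω => (X a ω : ℝ)) (fun ω => (X b ω : ℝ)) μ ≤
      if latticeDist (a : Fin d → ℤ) b ≤ m then
        (∫ ω, (X a ω : ℝ) ^ 2 ∂μ) / 2 + (∫ ω, (X b ω : ℝ) ^ 2 ∂μ) / 2 else 0 := by
  have ha := memLp_two hX hint a
  have hb := memLp_two hX hint b
  split_ifs with h
  · rw [ProbabilityTheory.covariance_eq_sub ha hb]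
    have h1 : ∫ ω, (X a ω : ℝ) * X b ω ∂μ ≤
        ∫ ω, ((X a ω : ℝ) ^ 2 / 2 + (X b ω : ℝ) ^ 2 / 2) ∂μ := by
      refine integral_mono (ha.integrable_mul hb)
        ((ha.integrable_sq.div_const 2).add (hb.integrable_sq.div_const 2)) fun ω => ?_
      nlinarith [sq_nonneg ((X a ω : ℝ) - X b ω)]
    rw [integral_add (ha.integrable_sq.div_const 2) (hb.integrable_sq.div_const 2),
      integral_div, integral_div] at h1
    have h2 : 0 ≤ (∫ ω, (X a ω : ℝ) ∂μ) * ∫ ω, (X b ω : ℝ) ∂μ :=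
      mul_nonneg (integral_nonneg fun _ => Nat.cast_nonneg _)
        (integral_nonneg fun _ => Nat.cast_nonneg _)
    change (∫ ω, (X a ω : ℝ) * X b ω ∂μ) - _ ≤ _
    linarith
  · refine le_of_eq (IndepFun.covariance_eq_zero ?_ ha hb)
    exact (indepFun_pair hdep (not_le.1 h)).comp (φ := fun n : ℕ => (n : ℝ))
      (ψ := fun n : ℕ => (n : ℝ)) Measurable.of_discrete Measurable.of_discrete

/-- The variance of a partial sum of an `m`-dependent field. -/
lemma variance_sum_le (hX : ∀ i, Measurable (X i))
    (hint : ∀ i, Integrable (fun ω => (X i ω : ℝ) ^ 4) μ) (hdep : IsMDependent m X μ)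
    (s : Finset J) :
    ProbabilityTheory.variance (fun ω => ∑ l ∈ s, (X l ω : ℝ)) μ ≤
      (2 * m + 1 : ℝ) ^ d * ∑ l ∈ s, ∫ ω, (X l ω : ℝ) ^ 2 ∂μ := by
  rw [ProbabilityTheory.variance_fun_sum' fun i _ => memLp_two hX hint i]
  set e : J → ℝ := fun l => ∫ ω, (X l ω : ℝ) ^ 2 ∂μ with he
  have he0 : ∀ l, 0 ≤ e l := fun l => integral_nonneg fun ω => by positivity
  have key : ∀ a : J, ∑ b ∈ s, (if latticeDist (a : Fin d → ℤ) b ≤ m then e a / 2 else 0) ≤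
      (2 * m + 1 : ℝ) ^ d * (e a / 2) := fun a => by
    rw [← Finset.sum_filter, Finset.sum_const, nsmul_eq_mul]
    have h1 : (s.filter fun b : J => latticeDist (a : Fin d → ℤ) b ≤ m).card ≤
        (2 * m + 1) ^ d := by
      refine (Finset.card_le_card fun b hb => ?_).trans (card_indexBall_le a m)
      rw [mem_indexBall, latticeDist_comm]
      exact (Finset.mem_filter.1 hb).2
    have : (((s.filter fun b : J => latticeDist (a : Fin d → ℤ) b ≤ m).card : ℕ) : ℝ) ≤
        (2 * m + 1) ^ d := by exact_mod_cast h1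
    exact mul_le_mul_of_nonneg_right this (by linarith [he0 a])
  calc _ ≤ ∑ a ∈ s, ∑ b ∈ s, ((if latticeDist (a : Fin d → ℤ) b ≤ m then e a / 2 else 0) +
          (if latticeDist (b : Fin d → ℤ) a ≤ m then e b / 2 else 0)) := by
        refine Finset.sum_le_sum fun a _ => Finset.sum_le_sum fun b _ => ?_
        refine (covariance_le hX hint hdep a b).trans (le_of_eq ?_)
        rw [latticeDist_comm (b : Fin d → ℤ) a]
        split_ifs <;> simp [he]
    _ = (∑ a ∈ s, ∑ b ∈ s, (if latticeDist (a : Fin d → ℤ) b ≤ m then e a / 2 else 0)) +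
        ∑ b ∈ s, ∑ a ∈ s, (if latticeDist (b : Fin d → ℤ) a ≤ m then e b / 2 else 0) := by
        simp only [Finset.sum_add_distrib]
        congr 1
        exact Finset.sum_comm
    _ ≤ (∑ a ∈ s, (2 * m + 1 : ℝ) ^ d * (e a / 2)) +
        ∑ b ∈ s, (2 * m + 1 : ℝ) ^ d * (e b / 2) :=
        add_le_add (Finset.sum_le_sum fun a _ => key a) (Finset.sum_le_sum fun b _ => key b)
    _ = _ := by
        rw [← Finset.sum_add_distrib, Finset.mul_sum]
        exact Finset.sum_congr rfl fun a _ => by ring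

lemma one_sub_cos_ge {τ : ℝ} (h0 : 0 ≤ τ) (h1 : τ ≤ 1) : 2 / 5 * τ ^ 2 ≤ 1 - Real.cos τ := by
  have h := abs_le.1 (Real.cos_bound (x := τ) (by rwa [abs_of_nonneg h0]))
  rw [abs_of_nonneg h0] at h
  nlinarith [h.2, pow_le_one₀ h0 h1 (n := 2), sq_nonneg τ,
    mul_le_mul_of_nonneg_left (pow_le_one₀ h0 h1 (n := 2)) (sq_nonneg τ)]

/-- A lower bound for the weighted fourth moments: test the second difference against a cosine at
the scale of the standard deviation of the sum outside the neighbourhood of `j`. That sum is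
independent of `X j`, and given the neighbourhood it differs from `W` by a constant. -/
lemma fourth_moment_le (hX : ∀ i, Measurable (X i))
    (hint : ∀ i, Integrable (fun ω => (X i ω : ℝ) ^ 4) μ) (hdep : IsMDependent m X μ) (j : J) :
    2 / 5 * (∫ ω, (X j ω : ℝ) ^ 4 ∂μ) ≤
      (1 + ProbabilityTheory.variance (fun ω => ∑ l ∈ (nbhdC m j)ᶜ, (X l ω : ℝ)) μ) *
        ∫ ω, (X j ω : ℝ) ^ 4 * localSmooth μ X m j ω ∂μ := by
  set T : Ω → ℝ := fun ω => ∑ l ∈ (nbhdC m j)ᶜ, (X l ω : ℝ) with hT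
  set V := ProbabilityTheory.variance T μ with hV
  have hV0 : 0 ≤ V := ProbabilityTheory.variance_nonneg _ _
  -- `τ ^ 2 * V ≤ 1` makes the mean of the cosine at least `1 / 2`, and `τ ≤ 1` makes its second
  -- difference of order `τ ^ 2`
  set τ : ℝ := (Real.sqrt (1 + V))⁻¹ with hτ
  have hτ2 : τ ^ 2 = (1 + V)⁻¹ := by rw [hτ, inv_pow, Real.sq_sqrt (by linarith)]
  have hτ0 : 0 ≤ τ := by positivity
  have hτ1 : τ ≤ 1 := by
    rw [hτ]
    exact inv_le_one_of_one_le₀ (Real.one_le_sqrt.2 (by linarith))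
  set e := ∫ ω, T ω ∂μ with he
  have hTm : Measurable T := Finset.measurable_sum _ fun l _ =>
    (Measurable.of_discrete (f := fun n : ℕ => (n : ℝ))).comp (hX l)
  have hT2 : MemLp T 2 μ := memLp_finsetSum _ fun l _ => memLp_two hX hint l
  set c := fun ω => Real.cos (τ * (T ω - e)) with hc
  have hcm : Measurable c := Real.measurable_cos.comp ((hTm.sub_const e).const_mul τ)
  have hci : Integrable c μ := (integrable_const (1 : ℝ)).mono' hcm.aestronglyMeasurable
    (Filter.Eventually.of_forall fun ω => Real.abs_cos_le_one _)
  have hTe : Integrable (fun ω => (T ω - e) ^ 2) μ := (hT2.sub (memLp_const e)).integrable_sq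
  have hcE : 1 / 2 ≤ ∫ ω, c ω ∂μ := by
    have h1 : ∫ ω, (1 - τ ^ 2 / 2 * (T ω - e) ^ 2) ∂μ ≤ ∫ ω, c ω ∂μ := by
      refine integral_mono ((integrable_const _).sub
        (hTe.const_mul _)) hci fun ω => ?_
      have := Real.one_sub_sq_div_two_le_cos (x := τ * (T ω - e))
      simp only [hc]
      linarith
    rw [integral_sub (integrable_const _)
      (hTe.const_mul _), integral_const_mul,
      ← ProbabilityTheory.variance_eq_integral hTm.aemeasurable] at h1
    simp only [integral_const, probReal_univ, smul_eq_mul, mul_one] at h1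
    have : τ ^ 2 / 2 * V ≤ 1 / 2 := by
      rw [hτ2]
      have : (1 + V)⁻¹ * V ≤ 1 := by
        rw [inv_mul_le_iff₀ (by linarith)]; linarith
      linarith
    linarith
  -- the sign and the shift by one make the second difference a positive multiple of a centred cosine
  set G : ℤ → ℝ := fun k => -Real.cos (τ * (k - 1 - e)) with hG
  have hGΔ : ∀ k : ℤ, Δ (Δ G) k = 2 * (1 - Real.cos τ) * Real.cos (τ * (k - e)) := fun k => by
    have h1 : τ * ((k + 1 + 1 : ℤ) - 1 - e) = τ * (k - e) + τ := by push_cast; ring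
    have h2 : τ * ((k + 1 : ℤ) - 1 - e) = τ * (k - e) := by push_cast; ring
    have h3 : τ * ((k : ℝ) - 1 - e) = τ * (k - e) - τ := by ring
    simp only [fwdDiff, hG, h1, h2, h3, Real.cos_add, Real.cos_sub]
    ring
  have hGb : IsSecondDiff 1 (Δ (Δ G)) := IsSecondDiff.of_bounded fun k => by
    rw [hG, abs_neg]; exact Real.abs_cos_le_one _
  set S := nbhdC m j with hS
  have hmain := abs_integral_secondDiff_le (μ := μ) (x := restrictField X S) (W := fieldSum X)
    (measurable_restrictField hX _) (measurable_fieldSum hX)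
    (Φ := fun a k => (a (nbhdC.self m j) : ℝ) ^ 4 * Δ (Δ G) (k + -((∑ l, a l : ℕ) : ℤ)))
    (b := fun a => (a (nbhdC.self m j) : ℝ) ^ 4 * 1)
    (fun a => (hGb.shift _).const_mul (by positivity))
    ((hint j).mul_const 1)
  have hW : ∀ ω, Δ (Δ G) ((fieldSum X ω : ℤ) + -((∑ l, restrictField X S ω l : ℕ) : ℤ)) =
      2 * (1 - Real.cos τ) * c ω := fun ω => by
    have h1 := fieldSum_sub_partialSum (X := X) (S := S) (B := S) subset_rfl ω
    rw [partialSum_self] at h1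
    rw [hGΔ, ← sub_eq_add_neg, h1]
    have h2 : ((∑ l : (Sᶜ : Finset J), restrictField X Sᶜ ω l : ℕ) : ℝ) = T ω := by
      rw [hT]
      push_cast
      exact Finset.sum_coe_sort Sᶜ fun l => (X l ω : ℝ)
    rw [hc, Int.cast_natCast, h2]
  have hind : IndepFun (fun ω => (X j ω : ℝ) ^ 4) c μ := by
    refine indepFun_of_far hdep (M := {j}) (N := Sᶜ) (fun l hl l' hl' => ?_)
      (fun q => (q ⟨j, Finset.mem_singleton_self j⟩ : ℝ) ^ 4)
      (fun q => Real.cos (τ * ((∑ l, (q l : ℝ)) - e))) |>.congr ?_ ?_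
    · rw [Finset.mem_singleton] at hl
      subst hl
      rw [Finset.mem_compl, hS, nbhdC_eq_indexBall, mem_indexBall, latticeDist_comm] at hl'
      omega
    · rfl
    · refine Filter.Eventually.of_forall fun ω => ?_
      simp only [hc, hT]
      congr 3
      exact Finset.sum_coe_sort Sᶜ fun l => (X l ω : ℝ)
  have hL : ∫ ω, ((restrictField X S ω (nbhdC.self m j) : ℕ) : ℝ) ^ 4 *
      Δ (Δ G) ((fieldSum X ω : ℤ) + -((∑ l, restrictField X S ω l : ℕ) : ℤ)) ∂μ =
      2 * (1 - Real.cos τ) * ((∫ ω, (X j ω : ℝ) ^ 4 ∂μ) * ∫ ω, c ω ∂μ) := by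
    rw [← hind.integral_fun_mul_eq_mul_integral (hint j).aestronglyMeasurable
      hcm.aestronglyMeasurable, ← integral_const_mul]
    refine integral_congr_ae (Filter.Eventually.of_forall fun ω => ?_)
    simp only [hW]
    change (X j ω : ℝ) ^ 4 * _ = _
    ring
  rw [hL] at hmain
  have h4 : 0 ≤ ∫ ω, (X j ω : ℝ) ^ 4 ∂μ := integral_nonneg fun ω => by positivity
  have hcos := one_sub_cos_ge hτ0 hτ1
  have hcos0 : 0 ≤ 1 - Real.cos τ := sub_nonneg.2 (Real.cos_le_one τ)
  have hfin : 2 / 5 * τ ^ 2 * (∫ ω, (X j ω : ℝ) ^ 4 ∂μ) ≤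
      ∫ ω, (X j ω : ℝ) ^ 4 * localSmooth μ X m j ω ∂μ := by
    refine le_trans ?_ ((le_abs_self _).trans hmain) |>.trans (le_of_eq ?_)
    · calc 2 / 5 * τ ^ 2 * (∫ ω, (X j ω : ℝ) ^ 4 ∂μ) =
          2 * (2 / 5 * τ ^ 2) * ((∫ ω, (X j ω : ℝ) ^ 4 ∂μ) * (1 / 2)) := by ring
        _ ≤ _ := by gcongr
    · simp only [mul_one]
      rfl
  rw [hτ2] at hfin
  calc _ = (1 + V) * (2 / 5 * (1 + V)⁻¹ * (∫ ω, (X j ω : ℝ) ^ 4 ∂μ)) := by field_simp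
    _ ≤ _ := by gcongr

/-! ### Comparison of the errors with the smoothness term -/

lemma exists_pow_four_eq {y : ℝ} (hy : 0 ≤ y) : ∃ x : ℝ, 0 ≤ x ∧ x ^ 4 = y :=
  ⟨√√y, Real.sqrt_nonneg _, by
    rw [show (4 : ℕ) = 2 * 2 from rfl, pow_mul, Real.sq_sqrt (Real.sqrt_nonneg _), Real.sq_sqrt hy]⟩

lemma integral_pow_le_pow
    (hint : ∀ i, Integrable (fun ω => (X i ω : ℝ) ^ 4) μ) {i : J} {ξ : ℝ} (hξ : 0 ≤ ξ)
    (h : ∫ ω, (X i ω : ℝ) ^ 4 ∂μ ≤ ξ ^ 4) {b : ℕ} (hb : b ≤ 4) :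
    ∫ ω, (X i ω : ℝ) ^ b ∂μ ≤ ξ ^ b := by
  have := integral_pow_mul_le (μ := μ) (Y := fun ω => (X i ω : ℝ)) (D := fun _ => 1)
    (fun _ => Nat.cast_nonneg _) (fun _ => zero_le_one) (by simpa using hint i)
    (integrable_const _) hξ zero_le_one (by simpa using h) (by simp) hb
  simpa using this

/-- A bound for both local errors at `i`. The total degree of every term of the second order error
is only three; since `1 ≤ ξ`, it can be raised to four. -/
lemma local_errors_le_of_moments (hX : ∀ i, Measurable (X i))
    (hint : ∀ i, Integrable (fun ω => (X i ω : ℝ) ^ 4) μ) (i : J) {ξ ρ : ℝ} {φ : ℕ → ℝ}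
    (hξ1 : 1 ≤ ξ) (hξ : ∀ i, ∫ ω, (X i ω : ℝ) ^ 4 ∂μ ≤ ξ ^ 4)
    (hφ : ∀ b, 1 ≤ b → b ≤ 4 → ∀ c, ∫ ω, (X c ω : ℝ) ^ b * localSmooth μ X m i ω ∂μ ≤ φ b)
    (hρ : ∀ b, 1 ≤ b → b ≤ 4 → ξ ^ (4 - b) * φ b ≤ ρ) :
    NestedSums.errorThree μ (restrictField X (nbhdC m i)) (fieldSum X)
      (fun a => a (nbhdC.self m i)) (fun a => ∑ l, a l) ≤ 36 * (6 * m + 1 : ℝ) ^ (3 * d) * ρ ∧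
    NestedSums.errorTwo μ (restrictField X (nbhdC m i)) (fieldSum X)
      (fun a => a (nbhdC.self m i)) (fun a => ∑ l, a l) ≤ 36 * (6 * m + 1 : ℝ) ^ (3 * d) * ρ := by
  have hξ0 : 0 ≤ ξ := zero_le_one.trans hξ1
  have h3 := errorThree_le (μ := μ) (x := restrictField X (nbhdC m i)) (measurable_restrictField hX _)
    (fun c => hint c) (measurable_fieldSum hX) (nbhdC.self m i) (ξ := ξ) (φ := φ)
    (fun b _ hb c => integral_pow_le_pow hint hξ0 (hξ c) (by omega))
    (fun b h1 hb c => hφ b h1 hb c)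
  have h2 := errorTwo_le (μ := μ) (x := restrictField X (nbhdC m i)) (measurable_restrictField hX _)
    (fun c => hint c) (measurable_fieldSum hX) (nbhdC.self m i) (ξ := ξ) (φ := φ)
    (fun b _ hb c => integral_pow_le_pow hint hξ0 (hξ c) (by omega))
    (fun b h1 hb c => hφ b h1 hb c)
  have hφ0 : ∀ b, 1 ≤ b → b ≤ 4 → 0 ≤ φ b := fun b h1 hb =>
    (integral_nonneg fun ω => mul_nonneg (by positivity) (localSmooth_nonneg i ω)).trans
      (hφ b h1 hb i)
  have r1 := hρ 1 (by norm_num) (by norm_num)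
  have r2 := hρ 2 (by norm_num) (by norm_num)
  have r3 := hρ 3 (by norm_num) (by norm_num)
  have r4 := hρ 4 (by norm_num) (by norm_num)
  have f1 := hφ0 1 (by norm_num) (by norm_num)
  have f2 := hφ0 2 (by norm_num) (by norm_num)
  have f3 := hφ0 3 (by norm_num) (by norm_num)
  have f4 := hφ0 4 (by norm_num) (by norm_num)
  norm_num at r1 r2 r3 r4
  have hρ0 : 0 ≤ ρ := f4.trans r4
  set k := (Fintype.card (nbhdC m i) : ℝ) with hk
  have hk1 : 1 ≤ k := by
    have : 0 < Fintype.card (nbhdC m i) := Fintype.card_pos_iff.2 ⟨nbhdC.self m i⟩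
    rw [hk]
    exact_mod_cast this
  have hkK : k ≤ (6 * m + 1 : ℝ) ^ d := by
    have := card_indexBall_le i (3 * m)
    rw [← nbhdC_eq_indexBall, ← Fintype.card_coe] at this
    have h : k ≤ (((2 * (3 * m) + 1) ^ d : ℕ) : ℝ) := by rw [hk]; exact_mod_cast this
    refine h.trans (le_of_eq ?_)
    push_cast
    ring
  have hk3 : k ^ 3 ≤ (6 * m + 1 : ℝ) ^ (3 * d) := by
    rw [mul_comm 3 d, pow_mul]
    gcongr
  have hk23 : k ^ 2 ≤ k ^ 3 := pow_le_pow_right₀ hk1 (by norm_num)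
  constructor
  · calc _ ≤ _ := h3
      _ ≤ 9 * (6 * m + 1 : ℝ) ^ (3 * d) * (4 * ρ) := by
          gcongr
          linarith
      _ = _ := by ring
  · have e3 : φ 3 ≤ ξ * φ 3 := le_mul_of_one_le_left f3 hξ1
    have e2 : ξ * φ 2 ≤ ξ ^ 2 * φ 2 := by
      rw [pow_two, mul_assoc]
      exact le_mul_of_one_le_left (by positivity) hξ1
    have e1 : ξ ^ 2 * φ 1 ≤ ξ ^ 3 * φ 1 := by
      gcongr
      norm_num
    calc _ ≤ _ := h2
      _ ≤ 4 * (6 * m + 1 : ℝ) ^ (3 * d) * (9 * ρ) := by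
          gcongr
          · exact hk23.trans hk3
          · linarith
      _ = _ := by ring

/-- If the fourth moments are at most one, integrality makes every weighted moment at most the
weighted fourth moment. -/
lemma local_errors_le_of_small (hX : ∀ i, Measurable (X i))
    (hint : ∀ i, Integrable (fun ω => (X i ω : ℝ) ^ 4) μ) (i : J)
    (h1 : ∀ i, ∫ ω, (X i ω : ℝ) ^ 4 ∂μ ≤ 1) :
    NestedSums.errorThree μ (restrictField X (nbhdC m i)) (fieldSum X)
      (fun a => a (nbhdC.self m i)) (fun a => ∑ l, a l) ≤
        36 * (6 * m + 1 : ℝ) ^ (3 * d) * supFourthSmooth m X μ ∧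
    NestedSums.errorTwo μ (restrictField X (nbhdC m i)) (fieldSum X)
      (fun a => a (nbhdC.self m i)) (fun a => ∑ l, a l) ≤
        36 * (6 * m + 1 : ℝ) ^ (3 * d) * supFourthSmooth m X μ := by
  refine local_errors_le_of_moments hX hint i le_rfl (fun i => by simpa using h1 i)
    (φ := fun _ => supFourthSmooth m X μ) (fun b hb1 hb4 c => ?_) (fun b _ _ => by simp)
  refine (integral_mono_of_nonneg (Filter.Eventually.of_forall fun ω =>
    mul_nonneg (by positivity) (localSmooth_nonneg i ω))
    (integrable_mul_localSmooth hX i (hint c)) (Filter.Eventually.of_forall fun ω =>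
    mul_le_mul_of_nonneg_right (natCast_pow_le_pow_four _ b hb1 hb4)
      (localSmooth_nonneg i ω))).trans (integral_le_supFourthSmooth c i)

/-- Local errors when fourth moments may exceed one. Let `ξ ^ 4` bound the fourth moments,
`s ^ 4 = S` and let `t ^ 4` be the mean smoothness around `i`. By Hölder's inequality every term of the
errors is at most `(ξ t) ^ (4 - b) s ^ b` with `1 ≤ b ≤ 4`, so the errors are of order `S` unless
`ξ t` exceeds `s`. -/
lemma local_errors_le_of_ratio (hX : ∀ i, Measurable (X i))
    (hint : ∀ i, Integrable (fun ω => (X i ω : ℝ) ^ 4) μ) (i : J) {ξ s t r : ℝ}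
    (hξ1 : 1 ≤ ξ) (hξ : ∀ i, ∫ ω, (X i ω : ℝ) ^ 4 ∂μ ≤ ξ ^ 4) (hs : 0 ≤ s) (ht : 0 ≤ t)
    (hr : 1 ≤ r) (hsS : s ^ 4 = supFourthSmooth m X μ)
    (htD : ∫ ω, localSmooth μ X m i ω ∂μ = t ^ 4) (hst : ξ * t ≤ r * s) :
    NestedSums.errorThree μ (restrictField X (nbhdC m i)) (fieldSum X)
      (fun a => a (nbhdC.self m i)) (fun a => ∑ l, a l) ≤
        36 * (6 * m + 1 : ℝ) ^ (3 * d) * (r ^ 3 * supFourthSmooth m X μ) ∧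
    NestedSums.errorTwo μ (restrictField X (nbhdC m i)) (fieldSum X)
      (fun a => a (nbhdC.self m i)) (fun a => ∑ l, a l) ≤
        36 * (6 * m + 1 : ℝ) ^ (3 * d) * (r ^ 3 * supFourthSmooth m X μ) := by
  have hξ0 : 0 ≤ ξ := zero_le_one.trans hξ1
  refine local_errors_le_of_moments hX hint i hξ1 hξ (φ := fun b => s ^ b * t ^ (4 - b))
    (fun b hb1 hb4 c => ?_) (fun b hb1 hb4 => ?_)
  · exact integral_pow_mul_le (fun _ => Nat.cast_nonneg _) (localSmooth_nonneg i)
      (integrable_mul_localSmooth hX i (hint c)) (integrable_localSmooth hX i) hs ht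
      (by rw [hsS]; exact integral_le_supFourthSmooth c i) htD.le hb4
  · calc ξ ^ (4 - b) * (s ^ b * t ^ (4 - b)) = s ^ b * (ξ * t) ^ (4 - b) := by
          rw [mul_pow]; ring
      _ ≤ s ^ b * (r * s) ^ (4 - b) := by gcongr
      _ = r ^ (4 - b) * s ^ 4 := by
          rw [mul_pow, ← pow_mul_pow_sub s hb4]; ring
      _ ≤ r ^ 3 * s ^ 4 := by
          gcongr
          omega
      _ = _ := by rw [hsS]

lemma gam1_eq_sum (hX : ∀ i, Measurable (X i))
    (hint : ∀ i, Integrable (fun ω => (X i ω : ℝ) ^ 4) μ) :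
    Gam1 μ (fieldSum X) = ∑ i, ∫ ω, (X i ω : ℝ) ∂μ := by
  have hi : ∀ i, Integrable (fun ω => (X i ω : ℝ)) μ := fun i => by
    simpa using integrable_pow_of_four (hX i) (hint i) (b := 1) (by norm_num)
  rw [Gam1, factMoment_one, ← integral_finsetSum _ fun i _ => hi i]
  simp [fieldSum]

/-- A sum whose terms are bounded by `u` on a ball and by `v` elsewhere. -/
lemma sum_le_of_ball (j : J) (R : ℕ) {f : J → ℝ} {u v : ℝ} (hu0 : 0 ≤ u) (hv0 : 0 ≤ v)
    (hu : ∀ l ∈ indexBall j R, f l ≤ u) (hv : ∀ l ∉ indexBall j R, f l ≤ v) :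
    ∑ l, f l ≤ (2 * R + 1 : ℝ) ^ d * u + J.card * v := by
  rw [← Finset.sum_add_sum_compl (indexBall j R)]
  have h1 : ((indexBall j R).card : ℝ) ≤ (2 * R + 1 : ℝ) ^ d := by
    exact_mod_cast card_indexBall_le j R
  have h2 : (((indexBall j R)ᶜ).card : ℝ) ≤ J.card := by
    have := Finset.card_le_univ (indexBall j R)ᶜ
    rw [Fintype.card_coe] at this
    exact_mod_cast this
  refine add_le_add ((Finset.sum_le_card_nsmul _ _ u hu).trans ?_)
    ((Finset.sum_le_card_nsmul _ _ v fun l hl => hv l (Finset.mem_compl.1 hl)).trans ?_)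
  · rw [nsmul_eq_mul]; gcongr
  · rw [nsmul_eq_mul]; gcongr

lemma sum_subset_le_of_ball (j : J) (R : ℕ) (s : Finset J) {f : J → ℝ} (hf : ∀ l, 0 ≤ f l) {u v : ℝ}
    (hu0 : 0 ≤ u) (hv0 : 0 ≤ v)
    (hu : ∀ l ∈ indexBall j R, f l ≤ u) (hv : ∀ l ∉ indexBall j R, f l ≤ v) :
    ∑ l ∈ s, f l ≤ (2 * R + 1 : ℝ) ^ d * u + J.card * v :=
  (Finset.sum_le_sum_of_subset_of_nonneg (Finset.subset_univ s) fun l _ _ => hf l).trans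
    (sum_le_of_ball j R hu0 hv0 hu hv)

/-- The arithmetic behind `gam1_le_of_dominant`: `b ξ + n x` bounds the mean, `b (b ξ² + n x²)` bounds
the variance, and the hypothesis `h` says that the moment at one point dominates. -/
lemma mul_one_add_le_of_dominant {b n ξ x : ℝ} (hb : 1 ≤ b) (hn : 1 ≤ n) (hξ : 1 ≤ ξ) (hx : 0 ≤ x)
    (hxξ : x ≤ ξ) (h : n * x ^ 3 ≤ b * ξ ^ 3) :
    (b * ξ + n * x) * (1 + b * (b * ξ ^ 2 + n * x ^ 2)) ≤ 6 * (ξ ^ 4 * n * b ^ 3) := by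
  have hb0 : 0 ≤ b := by linarith
  have hn0 : 0 ≤ n := by linarith
  have hξ0 : 0 ≤ ξ := by linarith
  have b2 : 1 ≤ b ^ 2 := one_le_pow₀ hb
  have b3 : b ≤ b ^ 3 := le_self_pow₀ hb (by norm_num)
  have b23 : b ^ 2 ≤ b ^ 3 := pow_le_pow_right₀ hb (by norm_num)
  have b13 : 1 ≤ b ^ 3 := one_le_pow₀ hb
  have ξ14 : ξ ≤ ξ ^ 4 := le_self_pow₀ hξ (by norm_num)
  have ξ34 : ξ ^ 3 ≤ ξ ^ 4 := pow_le_pow_right₀ hξ (by norm_num)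
  have t1 : b * ξ ≤ ξ ^ 4 * n * b ^ 3 := by
    calc b * ξ = ξ * 1 * b := by ring
      _ ≤ ξ ^ 4 * n * b ^ 3 := by gcongr
  have t2 : b ^ 3 * ξ ^ 3 ≤ ξ ^ 4 * n * b ^ 3 := by
    calc b ^ 3 * ξ ^ 3 = ξ ^ 3 * 1 * b ^ 3 := by ring
      _ ≤ ξ ^ 4 * n * b ^ 3 := by gcongr
  have t3 : b ^ 2 * n * ξ * x ^ 2 ≤ ξ ^ 4 * n * b ^ 3 := by
    calc b ^ 2 * n * ξ * x ^ 2 ≤ b ^ 3 * n * ξ * ξ ^ 2 := by gcongr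
      _ = ξ ^ 3 * n * b ^ 3 := by ring
      _ ≤ ξ ^ 4 * n * b ^ 3 := by gcongr
  have t4 : n * x ≤ ξ ^ 4 * n * b ^ 3 := by
    calc n * x = x * n * 1 := by ring
      _ ≤ ξ ^ 4 * n * b ^ 3 := by
        gcongr
        exact hxξ.trans ξ14
  have t5 : n * b ^ 2 * ξ ^ 2 * x ≤ ξ ^ 4 * n * b ^ 3 := by
    calc n * b ^ 2 * ξ ^ 2 * x ≤ n * b ^ 3 * ξ ^ 2 * ξ := by gcongr
      _ = ξ ^ 3 * n * b ^ 3 := by ring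
      _ ≤ ξ ^ 4 * n * b ^ 3 := by gcongr
  have t6 : b * n ^ 2 * x ^ 3 ≤ ξ ^ 4 * n * b ^ 3 := by
    calc b * n ^ 2 * x ^ 3 = b * n * (n * x ^ 3) := by ring
      _ ≤ b * n * (b * ξ ^ 3) := by gcongr
      _ = ξ ^ 3 * n * b ^ 2 := by ring
      _ ≤ ξ ^ 4 * n * b ^ 3 := by gcongr
  nlinarith [t1, t2, t3, t4, t5, t6]

/-- If the fourth moment at `j` dominates the moments away from `j`, the mean of the sum is controlled
by the smoothness. -/
lemma gam1_le_of_dominant (hX : ∀ i, Measurable (X i))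
    (hint : ∀ i, Integrable (fun ω => (X i ω : ℝ) ^ 4) μ) (hdep : IsMDependent m X μ) (j : J)
    {ξ x : ℝ} (hξ1 : 1 ≤ ξ) (hξj : ∫ ω, (X j ω : ℝ) ^ 4 ∂μ = ξ ^ 4)
    (hξ : ∀ i, ∫ ω, (X i ω : ℝ) ^ 4 ∂μ ≤ ξ ^ 4) (hx0 : 0 ≤ x) (hxξ : x ≤ ξ)
    (hx : ∀ l ∉ indexBall j (8 * m), ∫ ω, (X l ω : ℝ) ^ 4 ∂μ ≤ x ^ 4)
    (hdom : J.card * x ^ 3 ≤ (16 * m + 1 : ℝ) ^ d * ξ ^ 3) :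
    Gam1 μ (fieldSum X) ≤
      15 * (((16 * m + 1 : ℝ) ^ d) ^ 3 * J.card * supFourthSmooth m X μ) := by
  have hξ0 : 0 ≤ ξ := zero_le_one.trans hξ1
  set b : ℝ := (16 * m + 1 : ℝ) ^ d with hb
  have hb1 : 1 ≤ b := one_le_pow₀ (by
    have : (0 : ℝ) ≤ m := Nat.cast_nonneg m
    linarith)
  have hn1 : (1 : ℝ) ≤ J.card := Nat.one_le_cast.2 (Finset.card_pos.2 ⟨j.1, j.2⟩)
  have hbe : (2 * (8 * m : ℕ) + 1 : ℝ) ^ d = b := by rw [hb]; push_cast; ring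
  have hG : Gam1 μ (fieldSum X) ≤ b * ξ + J.card * x := by
    rw [gam1_eq_sum hX hint, ← hbe]
    refine sum_le_of_ball j (8 * m) hξ0 hx0 (fun l _ => ?_) (fun l hl => ?_)
    · simpa using integral_pow_le_pow hint hξ0 (hξ l) (b := 1) (by norm_num)
    · simpa using integral_pow_le_pow hint hx0 (hx l hl) (b := 1) (by norm_num)
  have hG0 : 0 ≤ Gam1 μ (fieldSum X) := by
    rw [Gam1, factMoment_one]; exact integral_nonneg fun _ => Nat.cast_nonneg _
  set V := ProbabilityTheory.variance (fun ω => ∑ l ∈ (nbhdC m j)ᶜ, (X l ω : ℝ)) μ with hV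
  have hV0 : 0 ≤ V := ProbabilityTheory.variance_nonneg _ _
  have hVle : V ≤ b * (b * ξ ^ 2 + J.card * x ^ 2) := by
    refine (variance_sum_le hX hint hdep _).trans (mul_le_mul ?_ ?_
      (Finset.sum_nonneg fun l _ => integral_nonneg fun ω => by positivity) (by positivity))
    · rw [hb]
      gcongr
      norm_num
    · rw [← hbe]
      refine sum_subset_le_of_ball j (8 * m) _ (fun l => integral_nonneg fun ω => by positivity)
        (by positivity) (by positivity) (fun l _ => ?_) (fun l hl => ?_)
      · exact integral_pow_le_pow hint hξ0 (hξ l) (by norm_num)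
      · exact integral_pow_le_pow hint hx0 (hx l hl) (by norm_num)
  have hS0 := supFourthSmooth_nonneg (m := m) (X := X) (μ := μ)
  have h4 := fourth_moment_le hX hint hdep j
  rw [hξj, ← hV] at h4
  have h5 : 2 / 5 * ξ ^ 4 ≤ (1 + V) * supFourthSmooth m X μ :=
    h4.trans (mul_le_mul_of_nonneg_left (integral_le_supFourthSmooth j j) (by linarith))
  have hpos : 0 < 2 / 5 * ξ ^ 4 := by positivity
  refine le_of_mul_le_mul_left ?_ hpos
  calc 2 / 5 * ξ ^ 4 * Gam1 μ (fieldSum X) ≤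
        (1 + V) * supFourthSmooth m X μ * Gam1 μ (fieldSum X) := by gcongr
    _ ≤ (1 + b * (b * ξ ^ 2 + J.card * x ^ 2)) * supFourthSmooth m X μ * (b * ξ + J.card * x) := by
        gcongr
    _ = (b * ξ + J.card * x) * (1 + b * (b * ξ ^ 2 + J.card * x ^ 2)) *
        supFourthSmooth m X μ := by ring
    _ ≤ 6 * (ξ ^ 4 * J.card * b ^ 3) * supFourthSmooth m X μ := by
        exact mul_le_mul_of_nonneg_right
          (mul_one_add_le_of_dominant hb1 hn1 hξ1 hx0 hxξ hdom) hS0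
    _ = _ := by ring

/-- The smoothness term is bounded below by the mean or by a constant. By `fourth_moment_le` at a
point `j` with maximal fourth moment `M`, `S` is at least of order `M / (1 + V)`, while `n M` bounds the
mean and, up to the size of a neighbourhood, the variance `V`. -/
lemma one_le_or_gam1_le (hX : ∀ i, Measurable (X i))
    (hint : ∀ i, Integrable (fun ω => (X i ω : ℝ) ^ 4) μ) (hdep : IsMDependent m X μ) (j : J)
    (hmax : ∀ i, ∫ ω, (X i ω : ℝ) ^ 4 ∂μ ≤ ∫ ω, (X j ω : ℝ) ^ 4 ∂μ) :
    Gam1 μ (fieldSum X) ≤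
      5 * (((16 * m + 1 : ℝ) ^ d) ^ 3 * J.card * supFourthSmooth m X μ) ∨
    1 ≤ 5 * (((16 * m + 1 : ℝ) ^ d) ^ 3 * J.card * supFourthSmooth m X μ) := by
  set M := ∫ ω, (X j ω : ℝ) ^ 4 ∂μ with hM
  have hM0 : 0 ≤ M := integral_nonneg fun ω => by positivity
  set b : ℝ := (2 * m + 1 : ℝ) ^ d with hb
  have hb1 : 1 ≤ b := one_le_pow₀ (by
    have : (0 : ℝ) ≤ m := Nat.cast_nonneg m
    linarith)
  have hbβ : b ≤ ((16 * m + 1 : ℝ) ^ d) ^ 3 := by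
    have h1 : b ≤ (16 * m + 1 : ℝ) ^ d := by
      rw [hb]; gcongr; norm_num
    exact h1.trans (le_self_pow₀ (hb1.trans h1) (by norm_num))
  set S := supFourthSmooth m X μ with hS
  have hS0 : 0 ≤ S := supFourthSmooth_nonneg
  set n : ℝ := (J.card : ℝ) with hn
  have hn1 : (1 : ℝ) ≤ n := Nat.one_le_cast.2 (Finset.card_pos.2 ⟨j.1, j.2⟩)
  have hmom : ∀ l, ∀ b, 1 ≤ b → b ≤ 4 → ∫ ω, (X l ω : ℝ) ^ b ∂μ ≤ M := fun l b h1 h4 =>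
    (integral_mono (integrable_pow_of_four (hX l) (hint l) h4) (hint l) fun ω =>
      natCast_pow_le_pow_four _ b h1 h4).trans (hmax l)
  have hG : Gam1 μ (fieldSum X) ≤ n * M := by
    rw [gam1_eq_sum hX hint]
    refine (Finset.sum_le_card_nsmul _ _ M fun l _ => ?_).trans (le_of_eq ?_)
    · simpa using hmom l 1 le_rfl (by norm_num)
    · rw [nsmul_eq_mul, Finset.card_univ, Fintype.card_coe]
  set V := ProbabilityTheory.variance (fun ω => ∑ l ∈ (nbhdC m j)ᶜ, (X l ω : ℝ)) μ with hV
  have hV0 : 0 ≤ V := ProbabilityTheory.variance_nonneg _ _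
  have hVle : V ≤ b * (n * M) := by
    refine (variance_sum_le hX hint hdep _).trans ?_
    gcongr
    refine (Finset.sum_le_sum_of_subset_of_nonneg (Finset.subset_univ _)
      fun l _ _ => integral_nonneg fun ω => by positivity).trans ?_
    refine (Finset.sum_le_card_nsmul _ _ M fun l _ => hmom l 2 (by norm_num) (by norm_num)).trans
      (le_of_eq ?_)
    rw [nsmul_eq_mul, Finset.card_univ, Fintype.card_coe]
  have h5 : 2 / 5 * M ≤ (1 + b * (n * M)) * S :=
    (fourth_moment_le hX hint hdep j).trans
      (mul_le_mul (by linarith) (integral_le_supFourthSmooth j j)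
        (integral_nonneg fun ω => mul_nonneg (by positivity) (localSmooth_nonneg j ω))
        (by positivity))
  have hβ : b * (n * S) ≤ ((16 * m + 1 : ℝ) ^ d) ^ 3 * n * S := by
    rw [mul_assoc]; gcongr
  rcases le_total (b * (n * M)) 1 with h | h
  · left
    have : 2 / 5 * M ≤ 2 * S := h5.trans (by gcongr; linarith)
    have h6 : n * M ≤ 5 * (b * (n * S)) := by
      calc n * M ≤ n * (5 * S) := by gcongr; linarith
        _ = 5 * (1 * (n * S)) := by ring
        _ ≤ _ := by gcongr
    linarith
  · right
    have h7 : 2 / 5 * M ≤ (2 * (b * (n * M))) * S := h5.trans (by gcongr; linarith)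
    have hMpos : 0 < M := by
      rcases hM0.lt_or_eq with h0 | h0
      · exact h0
      · rw [← h0] at h; norm_num at h
    have : 2 / 5 ≤ 2 * (b * (n * S)) := by
      refine le_of_mul_le_mul_right ?_ hMpos
      linarith
    linarith

/-- Either both expansion errors are controlled by the smoothness, or the mean itself is. Let `ξ ^ 4`
be the largest fourth moment, attained at `j`, and `x ^ 4` the largest one away from `j`. A point `i`
far from `j` satisfies `ξ t i ≤ s` because the moment at `j` factors out of the weighted moment. Near `j`
only `x t i ≤ s` is available, so the local errors there lose `(ξ / x) ^ 3`. If `b ξ³ ≤ n x³`, the loss is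
made up by the small number of such points; otherwise the moment at `j` dominates. -/
lemma total_errors_le_or_gam1_le (hX : ∀ i, Measurable (X i))
    (hint : ∀ i, Integrable (fun ω => (X i ω : ℝ) ^ 4) μ) (hdep : IsMDependent m X μ) (j : J)
    (hmax : ∀ i, ∫ ω, (X i ω : ℝ) ^ 4 ∂μ ≤ ∫ ω, (X j ω : ℝ) ^ 4 ∂μ) :
    Gam1 μ (fieldSum X) ≤
      15 * (((16 * m + 1 : ℝ) ^ d) ^ 3 * J.card * supFourthSmooth m X μ) ∨
    (totalErrorThree μ X m ≤
      72 * (((16 * m + 1 : ℝ) ^ d) ^ 3 * J.card * supFourthSmooth m X μ) ∧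
    totalErrorTwo μ X m ≤
      72 * (((16 * m + 1 : ℝ) ^ d) ^ 3 * J.card * supFourthSmooth m X μ)) := by
  set S := supFourthSmooth m X μ with hS
  have hS0 : 0 ≤ S := supFourthSmooth_nonneg
  set n : ℝ := (J.card : ℝ) with hn
  have hn1 : (1 : ℝ) ≤ n := Nat.one_le_cast.2 (Finset.card_pos.2 ⟨j.1, j.2⟩)
  have hm0 : (0 : ℝ) ≤ m := Nat.cast_nonneg m
  set b : ℝ := (16 * m + 1 : ℝ) ^ d with hb
  have hb1 : 1 ≤ b := one_le_pow₀ (by linarith)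
  set κ : ℝ := (6 * m + 1 : ℝ) ^ (3 * d) with hκ
  have hκ0 : 0 ≤ κ := by positivity
  have hκb : κ ≤ b ^ 3 := by
    rw [hκ, hb, ← pow_mul, mul_comm d 3]
    gcongr
    norm_num
  have hcard : ∀ c : ℝ, ∑ _i : J, c = n * c := fun c => by
    rw [Finset.sum_const, Finset.card_univ, Fintype.card_coe, nsmul_eq_mul]
  have finish : ∀ f : J → ℝ, ∑ i, f i ≤ 36 * κ * (2 * (n * S)) →
      ∑ i, f i ≤ 72 * (b ^ 3 * n * S) := fun f hf => by
    refine hf.trans ?_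
    calc 36 * κ * (2 * (n * S)) = 72 * (κ * (n * S)) := by ring
      _ ≤ 72 * (b ^ 3 * (n * S)) := by gcongr
      _ = _ := by ring
  rcases le_or_gt (∫ ω, (X j ω : ℝ) ^ 4 ∂μ) 1 with hM | hM
  · right
    -- all fourth moments are at most one
    have hloc := fun i => local_errors_le_of_small (m := m) hX hint i fun l => (hmax l).trans hM
    have h2 : ∑ _i : J, 36 * κ * S ≤ 36 * κ * (2 * (n * S)) := by
      rw [hcard]
      nlinarith [mul_nonneg hκ0 (mul_nonneg (zero_le_one.trans hn1) hS0)]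
    exact ⟨finish _ ((Finset.sum_le_sum fun i _ => (hloc i).1).trans h2),
      finish _ ((Finset.sum_le_sum fun i _ => (hloc i).2).trans h2)⟩
  obtain ⟨ξ, hξ0, hξM⟩ := exists_pow_four_eq (zero_le_one.trans hM.le)
  have hξ1 : 1 ≤ ξ := by
    by_contra h
    have := pow_lt_one₀ hξ0 (not_le.1 h) (n := 4) (by norm_num)
    linarith
  have hξ : ∀ i, ∫ ω, (X i ω : ℝ) ^ 4 ∂μ ≤ ξ ^ 4 := fun i => (hmax i).trans hξM.ge
  obtain ⟨s, hs0, hsS⟩ := exists_pow_four_eq hS0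
  have hD0 : ∀ i, 0 ≤ ∫ ω, localSmooth μ X m i ω ∂μ := fun i =>
    integral_nonneg fun ω => localSmooth_nonneg i ω
  choose t ht0 htD using fun i => exists_pow_four_eq (hD0 i)
  have hfar : ∀ a i : J, 4 * m < latticeDist (a : Fin d → ℤ) i → ∀ y : ℝ, 0 ≤ y →
      ∫ ω, (X a ω : ℝ) ^ 4 ∂μ = y ^ 4 → y * t i ≤ s := fun a i hai y hy hya => by
    refine le_of_pow_le_pow_left₀ (n := 4) (by norm_num) hs0 ?_
    rw [mul_pow, ← hya, htD, hsS, ← integral_pow_four_mul_of_far hX hdep hai]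
    exact integral_le_supFourthSmooth a i
  -- the fourth root of the largest fourth moment away from `j`
  obtain ⟨x, hx0, hxξ, hx, hxt⟩ : ∃ x : ℝ, 0 ≤ x ∧ x ≤ ξ ∧
      (∀ l ∉ indexBall j (8 * m), ∫ ω, (X l ω : ℝ) ^ 4 ∂μ ≤ x ^ 4) ∧
      ∀ i ∈ indexBall j (4 * m), x * t i ≤ s := by
    rcases (indexBall j (8 * m))ᶜ.eq_empty_or_nonempty with hF | hF
    · refine ⟨0, le_rfl, hξ0, fun l hl => ?_, fun i _ => by simpa using hs0⟩
      rw [← Finset.mem_compl, hF] at hl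
      exact absurd hl (Finset.notMem_empty _)
    · obtain ⟨a, ha, hamax⟩ := Finset.exists_max_image _ (fun l => ∫ ω, (X l ω : ℝ) ^ 4 ∂μ) hF
      obtain ⟨x, hx0, hxa⟩ := exists_pow_four_eq
        (y := ∫ ω, (X a ω : ℝ) ^ 4 ∂μ) (integral_nonneg fun ω => by positivity)
      refine ⟨x, hx0, le_of_pow_le_pow_left₀ (n := 4) (by norm_num) hξ0 (hxa ▸ hξ a),
        fun l hl => hxa ▸ hamax l (Finset.mem_compl.2 hl), fun i hi => hfar a i ?_ x hx0 hxa.symm⟩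
      rw [Finset.mem_compl, mem_indexBall] at ha
      rw [mem_indexBall] at hi
      have := latticeDist_triangle (a : Fin d → ℤ) i j
      omega
  -- either the moment at `j` dominates, or there are many points compared with `(ξ / x) ^ 3`
  rcases le_total (n * x ^ 3) (b * ξ ^ 3) with hdom | hdom
  · left
    exact gam1_le_of_dominant hX hint hdep j hξ1 hξM.symm hξ hx0 hxξ hx hdom
  right
  have hxpos : 0 < x := by
    rcases hx0.lt_or_eq with h | h
    · exact h
    · rw [← h] at hdom
      have : 0 < b * ξ ^ 3 := by positivity
      norm_num at hdom
      linarith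
  set r := ξ / x with hr
  have hr1 : 1 ≤ r := (one_le_div hxpos).2 hxξ
  have hr3 : b * r ^ 3 ≤ n := by
    rw [hr, div_pow, ← mul_div_assoc, div_le_iff₀ (by positivity)]
    exact hdom
  -- near `j`, with the loss `r = ξ / x`
  have hnear := fun i (hi : i ∈ indexBall j (4 * m)) =>
    local_errors_le_of_ratio (m := m) hX hint i hξ1 hξ hs0 (ht0 i) hr1 hsS (htD i).symm (by
      calc ξ * t i = r * (x * t i) := by rw [hr]; field_simp
        _ ≤ r * s := by
          gcongr
          exact hxt i hi)
  -- away from `j`, without loss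
  have hout := fun i (hi : i ∉ indexBall j (4 * m)) =>
    local_errors_le_of_ratio (m := m) hX hint i hξ1 hξ hs0 (ht0 i) le_rfl hsS (htD i).symm (by
      rw [one_mul]
      refine hfar j i ?_ ξ hξ0 hξM.symm
      rw [mem_indexBall, latticeDist_comm] at hi
      omega)
  have hu0 : 0 ≤ 36 * κ * (r ^ 3 * S) := by positivity
  have hv0 : 0 ≤ 36 * κ * (1 ^ 3 * S) := by positivity
  have hsum : (2 * (4 * m : ℕ) + 1 : ℝ) ^ d * (36 * κ * (r ^ 3 * S)) +
      J.card * (36 * κ * (1 ^ 3 * S)) ≤ 36 * κ * (2 * (n * S)) := by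
    have hb4 : (2 * (4 * m : ℕ) + 1 : ℝ) ^ d ≤ b := by
      refine pow_le_pow_left₀ (by positivity) ?_ d
      push_cast
      linarith
    calc _ ≤ b * (36 * κ * (r ^ 3 * S)) + n * (36 * κ * (1 ^ 3 * S)) :=
          add_le_add (mul_le_mul_of_nonneg_right hb4 hu0) le_rfl
      _ = 36 * κ * (b * r ^ 3 * S + n * S) := by ring
      _ ≤ 36 * κ * (n * S + n * S) := by gcongr
      _ = _ := by ring
  exact ⟨finish _ ((sum_le_of_ball j (4 * m) hu0 hv0 (fun i hi => (hnear i hi).1)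
      fun i hi => (hout i hi).1).trans hsum),
    finish _ ((sum_le_of_ball j (4 * m) hu0 hv0 (fun i hi => (hnear i hi).2)
      fun i hi => (hout i hi).2).trans hsum)⟩

/-- The smoothness term `m^{3d} |J| S` controls both expansion errors and is bounded below, unless it
already dominates the mean. The constant comes from `16 m + 1 ≤ 17 m` and `17 ^ 3 = 4913`. -/
lemma errors_dichotomy (hX : ∀ i, Measurable (X i))
    (hint : ∀ i, Integrable (fun ω => (X i ω : ℝ) ^ 4) μ) (hdep : IsMDependent m X μ)
    (hm : 1 ≤ m) :
    Gam1 μ (fieldSum X) ≤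
      72 * 4913 ^ d * ((m : ℝ) ^ (3 * d) * J.card * supFourthSmooth m X μ) ∨
    (totalErrorThree μ X m ≤
      72 * 4913 ^ d * ((m : ℝ) ^ (3 * d) * J.card * supFourthSmooth m X μ) ∧
    totalErrorTwo μ X m ≤
      72 * 4913 ^ d * ((m : ℝ) ^ (3 * d) * J.card * supFourthSmooth m X μ) ∧
    1 ≤ 72 * 4913 ^ d * ((m : ℝ) ^ (3 * d) * J.card * supFourthSmooth m X μ)) := by
  set S := supFourthSmooth m X μ with hS
  have hS0 : 0 ≤ S := supFourthSmooth_nonneg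
  have hm1 : (1 : ℝ) ≤ m := by exact_mod_cast hm
  have hβ : ((16 * m + 1 : ℝ) ^ d) ^ 3 ≤ 4913 ^ d * (m : ℝ) ^ (3 * d) := by
    calc ((16 * m + 1 : ℝ) ^ d) ^ 3 ≤ ((17 * m : ℝ) ^ d) ^ 3 := by gcongr; linarith
      _ = (17 ^ 3) ^ d * (m : ℝ) ^ (3 * d) := by
        rw [mul_pow, mul_pow, ← pow_mul, ← pow_mul, ← pow_mul, mul_comm d 3]
      _ = _ := by norm_num
  have hle : ((16 * m + 1 : ℝ) ^ d) ^ 3 * J.card * S ≤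
      4913 ^ d * ((m : ℝ) ^ (3 * d) * J.card * S) := by
    calc _ ≤ 4913 ^ d * (m : ℝ) ^ (3 * d) * J.card * S := by gcongr
      _ = _ := by ring
  have h0 : 0 ≤ ((16 * m + 1 : ℝ) ^ d) ^ 3 * J.card * S := by positivity
  rcases isEmpty_or_nonempty J with hJ | hJ
  · left
    rw [gam1_eq_sum hX hint, Finset.univ_eq_empty, Finset.sum_empty]
    positivity
  · obtain ⟨j, -, hmax⟩ := Finset.exists_max_image Finset.univ
      (fun l => ∫ ω, (X l ω : ℝ) ^ 4 ∂μ) Finset.univ_nonempty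
    have hmax' := fun i => hmax i (Finset.mem_univ i)
    rcases one_le_or_gam1_le hX hint hdep j hmax' with h1 | h1
    · left; linarith
    rcases total_errors_le_or_gam1_le hX hint hdep j hmax' with h2 | ⟨h2, h3⟩
    · left; linarith
    · right
      exact ⟨by linarith, by linarith, by linarith⟩

end Field

/-! ### Stein equations of birth-death chains -/

/-- A probability weight `ν` on `ℕ` reversible for the birth rates `a` and the death rates `b`, where the
birth rates grow at most as fast as the death rates. The birth rates may vanish, so that chains on
`{0, …, N}` are included. -/
structure BirthDeath (a b ν : ℕ → ℝ) : Prop where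
  nonneg : ∀ k, 0 ≤ ν k
  hasSum : HasSum ν 1
  birth_nonneg : ∀ k, 0 ≤ a k
  death_zero : b 0 = 0
  death_pos : ∀ k, 0 < b (k + 1)
  balance : ∀ k, a k * ν k = b (k + 1) * ν (k + 1)
  summable_birth : Summable fun k => a k * ν k
  growth : ∀ j k, j ≤ k → a k - a j ≤ b k - b j

/-- The solution of the Stein equation of a birth-death chain. Outside the support of `ν` it vanishes
because of the division by zero. -/
noncomputable def birthDeathSolution (b ν f : ℕ → ℝ) (k : ℕ) : ℝ :=
  (∑ j ∈ Finset.range k, ν j * (f j - ∑' i, ν i * f i)) / (b k * ν k)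

namespace BirthDeath

variable {a b ν : ℕ → ℝ} (B : BirthDeath a b ν)
include B

lemma summable_mul {f : ℕ → ℝ} {C : ℝ} (hf : ∀ k, |f k| ≤ C) : Summable fun k => ν k * f k :=
  Summable.of_norm_bounded (B.hasSum.summable.mul_right C) fun k => by
    rw [Real.norm_eq_abs, abs_mul, abs_of_nonneg (B.nonneg k)]
    exact mul_le_mul_of_nonneg_left (hf k) (B.nonneg k)

lemma eq_zero_succ {k : ℕ} (h : a k * ν k = 0) : ν (k + 1) = 0 := by
  rw [B.balance] at h
  exact (mul_eq_zero.1 h).resolve_left (B.death_pos k).ne'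

lemma eq_zero_of_le {k l : ℕ} (h : ν k = 0) (hkl : k ≤ l) : ν l = 0 := by
  induction l, hkl using Nat.le_induction with
  | base => exact h
  | succ l _ ih => exact B.eq_zero_succ (by rw [ih, mul_zero])

lemma hasSum_tail (k : ℕ) : HasSum (fun j => ν (j + k)) (1 - ∑ j ∈ Finset.range k, ν j) :=
  (hasSum_nat_add_iff' k).2 B.hasSum

lemma summable_death : Summable fun k => b k * ν k := by
  rw [← summable_nat_add_iff 1]
  exact B.summable_birth.congr fun k => B.balance k

lemma sum_birth_eq (k : ℕ) :
    ∑ j ∈ Finset.range k, a j * ν j = ∑ j ∈ Finset.range (k + 1), b j * ν j := by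
  rw [Finset.sum_range_succ', B.death_zero, zero_mul, add_zero]
  exact Finset.sum_congr rfl fun j _ => B.balance j

/-- Monotonicity of the upper tail ratio. -/
lemma death_mul_tail_le (k : ℕ) :
    b k * (1 - ∑ j ∈ Finset.range (k + 1), ν j) ≤ a k * (1 - ∑ j ∈ Finset.range k, ν j) := by
  have h1 := B.hasSum_tail k
  have h2 := B.hasSum_tail (k + 1)
  have hA : Summable fun j => a (j + k) * ν (j + k) := (summable_nat_add_iff k).2 B.summable_birth
  have hB : Summable fun j => b (j + k) * ν (j + k) := (summable_nat_add_iff k).2 B.summable_death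
  have hB' : HasSum (fun j => b (j + k + 1) * ν (j + k + 1)) (∑' j, a (j + k) * ν (j + k)) :=
    hA.hasSum.congr_fun fun j => (B.balance (j + k)).symm
  have e1 : ∑' j, b (j + k) * ν (j + k) = b k * ν k + ∑' j, a (j + k) * ν (j + k) := by
    rw [hB.tsum_eq_zero_add, zero_add]
    congr 1
    refine tsum_congr fun j => ?_
    rw [B.balance (j + k), add_right_comm]
  have h3 : HasSum (fun j => (a k - a (j + k) + (b (j + k) - b k)) * ν (j + k))
      ((a k - b k) * (1 - ∑ j ∈ Finset.range k, ν j) - (∑' j, a (j + k) * ν (j + k))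
        + (b k * ν k + ∑' j, a (j + k) * ν (j + k))) := by
    refine (((h1.mul_left (a k - b k)).sub hA.hasSum).add (e1 ▸ hB.hasSum)).congr_fun fun j => ?_
    ring
  have h4 := h3.nonneg fun j => mul_nonneg
    (by linarith [B.growth k (j + k) (Nat.le_add_left k j)]) (B.nonneg _)
  rw [Finset.sum_range_succ]
  linarith

/-- Monotonicity of the lower tail ratio. -/
lemma birth_mul_head_le (k : ℕ) :
    a k * ∑ j ∈ Finset.range k, ν j ≤ b k * ∑ j ∈ Finset.range (k + 1), ν j := by
  have h0 : 0 ≤ ∑ j ∈ Finset.range k, (b k - b j - (a k - a j)) * ν j :=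
    Finset.sum_nonneg fun j hj => mul_nonneg
      (by linarith [B.growth j k (Finset.mem_range.1 hj).le]) (B.nonneg _)
  have h1 := B.sum_birth_eq k
  rw [Finset.sum_range_succ] at h1 ⊢
  have h2 : ∑ j ∈ Finset.range k, (b k - b j - (a k - a j)) * ν j =
      (b k - a k) * (∑ j ∈ Finset.range k, ν j) - (∑ j ∈ Finset.range k, b j * ν j) +
        ∑ j ∈ Finset.range k, a j * ν j := by
    rw [Finset.mul_sum, ← Finset.sum_sub_distrib, ← Finset.sum_add_distrib]
    exact Finset.sum_congr rfl fun j _ => by ring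
  rw [h2, h1] at h0
  linarith

lemma sum_centered_eq {f : ℕ → ℝ} (k : ℕ) :
    ∑ j ∈ Finset.range k, ν j * (f j - ∑' i, ν i * f i) =
      ∑ j ∈ Finset.range k, ν j * f j - (∑ j ∈ Finset.range k, ν j) * ∑' i, ν i * f i := by
  rw [Finset.sum_mul, ← Finset.sum_sub_distrib]
  exact Finset.sum_congr rfl fun j _ => by ring

/-- The Stein equation, on the support of `ν`. At the right end of a finite support the birth rate
vanishes and the equation holds because the centred function sums to zero. -/
lemma solution_spec {f : ℕ → ℝ} {C : ℝ} (hf : ∀ k, |f k| ≤ C) {k : ℕ} (hk : 0 < ν k) :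
    a k * birthDeathSolution b ν f (k + 1) - b k * birthDeathSolution b ν f k =
      f k - ∑' i, ν i * f i := by
  set c := ∑' i, ν i * f i with hc
  set G := fun k => ∑ j ∈ Finset.range k, ν j * (f j - c) with hG
  have h1 : a k * birthDeathSolution b ν f (k + 1) = G (k + 1) / ν k := by
    rcases (B.birth_nonneg k).lt_or_eq with h | h
    · rw [birthDeathSolution, ← B.balance]
      field_simp
      rfl
    · have hz : ∀ l, ν (l + (k + 1)) = 0 := fun l =>
        B.eq_zero_of_le (B.eq_zero_succ (by rw [← h, zero_mul])) (Nat.le_add_left _ _)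
      have hs : HasSum (fun j => ν j * (f j - c)) 0 := by
        have := (B.summable_mul hf).hasSum.sub (B.hasSum.mul_right c)
        rw [one_mul, ← hc, sub_self] at this
        exact this.congr_fun fun j => by ring
      have h2 := (hasSum_nat_add_iff' (k + 1)).2 hs
      simp only [hz, zero_mul] at h2
      have h3 := h2.unique hasSum_zero
      have : G (k + 1) = 0 := by
        rw [zero_sub, neg_eq_zero] at h3; exact h3
      rw [this, ← h, zero_mul, zero_div]
  have h2 : b k * birthDeathSolution b ν f k = G k / ν k := by
    rcases Nat.eq_zero_or_pos k with h | h
    · subst h; simp [B.death_zero, hG]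
    · obtain ⟨l, rfl⟩ := Nat.exists_eq_add_of_le' h
      have := B.death_pos l
      rw [birthDeathSolution]
      field_simp
      rfl
  rw [h1, h2, hG]
  simp only [Finset.sum_range_succ]
  field_simp
  ring

/-- A one-sided bound for the increments of the Stein solution at the points of the support: written
as a combination of the values of `f`, the increment at `n` has a positive coefficient only at `f n`.
The signs of the other coefficients are `death_mul_tail_le` and `birth_mul_head_le`. -/
lemma solution_diff_le_of_nonneg {f : ℕ → ℝ} {w : ℝ} (h0 : ∀ k, 0 ≤ f k) (h1 : ∀ k, f k ≤ w)
    {n : ℕ} (hbp : 0 < b n) (hk : 0 < ν n) :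
    birthDeathSolution b ν f (n + 1) - birthDeathSolution b ν f n ≤ w / b n ∧
    (0 < a n → birthDeathSolution b ν f (n + 1) - birthDeathSolution b ν f n ≤ w / a n) := by
  have hw : 0 ≤ w := (h0 0).trans (h1 0)
  have hfs : Summable fun k => ν k * f k :=
    B.summable_mul (C := w) fun k => by rw [abs_of_nonneg (h0 k)]; exact h1 k
  set x := ν n with hx
  set y := f n with hy
  set F := ∑ j ∈ Finset.range n, ν j with hF
  set P := ∑ j ∈ Finset.range n, ν j * f j with hP
  set R := 1 - (F + x) with hR
  set Q := ∑' j, ν (j + (n + 1)) * f (j + (n + 1)) with hQ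
  have hsum : ∑' i, ν i * f i = P + x * y + Q := by
    rw [← hfs.sum_add_tsum_nat_add (n + 1), Finset.sum_range_succ]
  have hP0 : 0 ≤ P := Finset.sum_nonneg fun j _ => mul_nonneg (B.nonneg j) (h0 j)
  have hQ0 : 0 ≤ Q := tsum_nonneg fun j => mul_nonneg (B.nonneg _) (h0 _)
  have hF0 : 0 ≤ F := Finset.sum_nonneg fun j _ => B.nonneg j
  have hR0 : 0 ≤ R := by
    have := (B.hasSum_tail (n + 1)).nonneg fun j => B.nonneg _
    rw [Finset.sum_range_succ] at this
    exact this
  have t1 : b n * R ≤ a n * (R + x) := by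
    have := B.death_mul_tail_le n
    rw [Finset.sum_range_succ] at this
    have e : R + x = 1 - F := by rw [hR]; ring
    rw [e]
    exact this
  have t2 : a n * F ≤ b n * (F + x) := by
    have := B.birth_mul_head_le n
    rwa [Finset.sum_range_succ] at this
  have hy0 : 0 ≤ y := h0 n
  have hy1 : y ≤ w := h1 n
  have g0 : birthDeathSolution b ν f n = (P * (R + x) - F * (x * y + Q)) / (b n * x) := by
    rw [birthDeathSolution, B.sum_centered_eq, hsum]
    congr 1
    simp only [hR, ← hF, ← hP]
    ring
  rcases (B.birth_nonneg n).lt_or_eq with ha | ha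
  · have g1 : birthDeathSolution b ν f (n + 1) =
        ((P + x * y) * R - (F + x) * Q) / (a n * x) := by
      rw [birthDeathSolution, B.sum_centered_eq, hsum, ← B.balance, Finset.sum_range_succ,
        Finset.sum_range_succ]
      congr 1
      simp only [hR, ← hF, ← hP]
      ring
    have hle : birthDeathSolution b ν f (n + 1) - birthDeathSolution b ν f n ≤
        y * (R / a n + F / b n) := by
      have e : birthDeathSolution b ν f (n + 1) - birthDeathSolution b ν f n =
          y * (R / a n + F / b n) - P * ((a n * (R + x) - b n * R) / (a n * b n * x))
          - Q * ((b n * (F + x) - a n * F) / (a n * b n * x)) := by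
        rw [g0, g1]
        field_simp
        ring
      rw [e]
      have u1 : 0 ≤ P * ((a n * (R + x) - b n * R) / (a n * b n * x)) :=
        mul_nonneg hP0 (div_nonneg (sub_nonneg.2 t1) (by positivity))
      have u2 : 0 ≤ Q * ((b n * (F + x) - a n * F) / (a n * b n * x)) :=
        mul_nonneg hQ0 (div_nonneg (sub_nonneg.2 t2) (by positivity))
      linarith
    have m1 : R / a n + F / b n ≤ 1 / b n := by
      rw [div_add_div _ _ ha.ne' hbp.ne', div_le_div_iff₀ (by positivity) hbp]
      have : R + x + F = 1 := by rw [hR]; ring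
      nlinarith
    have m2 : R / a n + F / b n ≤ 1 / a n := by
      rw [div_add_div _ _ ha.ne' hbp.ne', div_le_div_iff₀ (by positivity) ha]
      have : R + x + F = 1 := by rw [hR]; ring
      nlinarith
    have hm0 : 0 ≤ R / a n + F / b n := by positivity
    refine ⟨hle.trans ?_, fun _ => hle.trans ?_⟩
    · calc y * (R / a n + F / b n) ≤ w * (1 / b n) := by gcongr
        _ = _ := by ring
    · calc y * (R / a n + F / b n) ≤ w * (1 / a n) := by gcongr
        _ = _ := by ring
  · refine ⟨?_, fun h => absurd ha h.ne⟩
    have hz : ν (n + 1) = 0 := B.eq_zero_succ (by rw [← ha, zero_mul])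
    have hz' : ∀ j, ν (j + (n + 1)) = 0 := fun j => B.eq_zero_of_le hz (Nat.le_add_left _ _)
    have g1 : birthDeathSolution b ν f (n + 1) = 0 := by
      rw [birthDeathSolution, hz, mul_zero, div_zero]
    have hQz : Q = 0 := by simp [hQ, hz']
    have hRz : R = 0 := by
      have := (B.hasSum_tail (n + 1))
      simp only [hz'] at this
      have := this.unique hasSum_zero
      rwa [Finset.sum_range_succ] at this
    have hF1 : F ≤ 1 := by
      have : R + x + F = 1 := by rw [hR]; ring
      linarith
    rw [g0, g1, hQz, hRz, zero_sub, ← neg_div]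
    have e : -(P * (0 + x) - F * (x * y + 0)) / (b n * x) = (F * y - P) / b n := by
      field_simp
      ring
    rw [e]
    gcongr
    nlinarith

/-- The Stein solution is linear in `f` and does not see constants. -/
lemma solution_affine {f f' : ℕ → ℝ} {C : ℝ} (hf : ∀ k, |f k| ≤ C) {s t : ℝ}
    (h : ∀ k, f' k = s * f k + t) (k : ℕ) :
    birthDeathSolution b ν f' k = s * birthDeathSolution b ν f k := by
  have h1 : ∑' i, ν i * f' i = s * (∑' i, ν i * f i) + t := by
    have h2 := ((B.summable_mul hf).hasSum.mul_left s).add (B.hasSum.mul_right t)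
    rw [one_mul] at h2
    rw [← h2.tsum_eq]
    exact tsum_congr fun i => by rw [h]; ring
  rw [birthDeathSolution, birthDeathSolution, ← mul_div_assoc, Finset.mul_sum, h1]
  congr 1
  exact Finset.sum_congr rfl fun j _ => by rw [h]; ring

/-- Bounds for the increments of the Stein solution in terms of the oscillation of `f`: the one-sided
bound is applied to `f - inf f` and to its reflection. -/
lemma abs_solution_diff_le {f : ℕ → ℝ} {w : ℝ} (hw : ∀ i j, f i - f j ≤ w) {A : ℝ}
    (hA : 0 < A) (hAab : ∀ k, 0 < ν (k + 1) → A ≤ max (a (k + 1)) (b (k + 1))) (k : ℕ) :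
    |birthDeathSolution b ν f (k + 1 + 1) - birthDeathSolution b ν f (k + 1)| ≤ w / A := by
  have hw0 : 0 ≤ w := by simpa using hw 0 0
  rcases (B.nonneg (k + 1)).lt_or_eq with hk | hk
  swap
  · have h1 : ν (k + 1 + 1) = 0 := B.eq_zero_of_le hk.symm (Nat.le_succ _)
    rw [birthDeathSolution, birthDeathSolution, h1, ← hk]
    simp only [mul_zero, div_zero, sub_zero, abs_zero]
    positivity
  have hbd : BddBelow (Set.range f) := ⟨f 0 - w, by rintro _ ⟨j, rfl⟩; linarith [hw 0 j]⟩
  set c := ⨅ j, f j with hc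
  have hc0 : ∀ j, c ≤ f j := fun j => ciInf_le hbd j
  have hc1 : ∀ j, f j - w ≤ c := fun j => le_ciInf fun i => by linarith [hw j i]
  have hfb : ∀ j, |f j| ≤ |c| + w := fun j => by
    rw [abs_le]
    constructor
    · linarith [hc0 j, neg_abs_le c]
    · linarith [hc1 j, le_abs_self c]
  have hup : ∀ f' : ℕ → ℝ, (∀ j, 0 ≤ f' j) → (∀ j, f' j ≤ w) →
      birthDeathSolution b ν f' (k + 1 + 1) - birthDeathSolution b ν f' (k + 1) ≤ w / A := by
    intro f' h0 h1
    obtain ⟨u1, u2⟩ := B.solution_diff_le_of_nonneg h0 h1 (B.death_pos k) hk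
    rcases le_max_iff.1 (hAab k hk) with h | h
    · exact (u2 (hA.trans_le h)).trans (by gcongr)
    · exact u1.trans (by gcongr)
  have e1 := B.solution_affine (f' := fun j => f j - c) hfb (s := 1) (t := -c) fun j => by ring
  have e2 := B.solution_affine (f' := fun j => c + w - f j) hfb (s := -1) (t := c + w)
    fun j => by ring
  have h1 := hup (fun j => f j - c) (fun j => by linarith [hc0 j]) (fun j => by linarith [hc1 j])
  have h2 := hup (fun j => c + w - f j) (fun j => by linarith [hc1 j])
    (fun j => by linarith [hc0 j])
  simp only [e1, e2] at h1 h2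
  rw [abs_le]
  constructor <;> linarith

/-- The Stein equation perturbed by `η Δ g (k + 1)`. It is solved by the solution `g` of the
unperturbed equation for `h`, where `h = f - η Δ g (k + 1)`; since the increments of `g` are controlled
by `h`, such an `h` is the fixed point of a contraction with constant `2 |η| / A`. The bounds improve on
those of the contraction principle by using the oscillation of `h` instead of its norm. -/
lemma exists_perturbed_solution {f : ℕ → ℝ} (hf : ∀ i j, f i - f j ≤ 1) {A η : ℝ}
    (hA : 0 < A) (hAab : ∀ k, 0 < ν (k + 1) → A ≤ max (a (k + 1)) (b (k + 1)))
    (hη : 2 * |η| < A) :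
    ∃ (g : ℕ → ℝ) (c : ℝ),
      (∀ k, 0 < ν k → a k * g (k + 1) - b k * g k + η * (g (k + 1 + 1) - g (k + 1)) = f k - c) ∧
      (∀ k, |g (k + 1 + 1) - g (k + 1)| ≤ 1 / (A - 2 * |η|)) ∧
      (∀ k, |f k - c| ≤ 2 * A / (A - 2 * |η|)) ∧ ∀ k, ν k = 0 → g k = 0 := by
  have hη0 : 0 ≤ |η| := abs_nonneg η
  have hden : 0 < A - 2 * |η| := by linarith
  set D : (ℕ → ℝ) → ℕ → ℝ := fun h k =>
    birthDeathSolution b ν h (k + 1 + 1) - birthDeathSolution b ν h (k + 1) with hD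
  have hfb : ∀ j, |f j| ≤ |f 0| + 1 := fun j => by
    rw [abs_le]
    constructor
    · linarith [hf 0 j, neg_abs_le (f 0)]
    · linarith [hf j 0, le_abs_self (f 0)]
  have hosc : ∀ h : BoundedContinuousFunction ℕ ℝ, ∀ i j, h i - h j ≤ 2 * ‖h‖ := fun h i j => by
    have h1 := abs_le.1 (h.norm_coe_le_norm i)
    have h2 := abs_le.1 (h.norm_coe_le_norm j)
    linarith
  have hDb : ∀ h : BoundedContinuousFunction ℕ ℝ, ∀ k, |D h k| ≤ 2 * ‖h‖ / A := fun h k =>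
    B.abs_solution_diff_le (hosc h) hA hAab k
  have hDsub : ∀ h h' : BoundedContinuousFunction ℕ ℝ, ∀ k, D h k - D h' k = D (h - h') k := by
    have hsol : ∀ h h' : BoundedContinuousFunction ℕ ℝ, ∀ k, birthDeathSolution b ν (h - h') k =
        birthDeathSolution b ν h k - birthDeathSolution b ν h' k := fun h h' k => by
      have e : ∑' i, ν i * (h - h') i = (∑' i, ν i * h i) - ∑' i, ν i * h' i := by
        rw [← (B.summable_mul h.norm_coe_le_norm).tsum_sub (B.summable_mul h'.norm_coe_le_norm)]
        exact tsum_congr fun i => by simp [mul_sub]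
      rw [birthDeathSolution, birthDeathSolution, birthDeathSolution, ← sub_div,
        ← Finset.sum_sub_distrib]
      congr 1
      refine Finset.sum_congr rfl fun j _ => ?_
      have e' : (⇑h - ⇑h') = ⇑(h - h') := rfl
      rw [e', e]
      simp only [BoundedContinuousFunction.coe_sub, Pi.sub_apply]
      ring
    intro h h' k
    simp only [hD]
    rw [hsol, hsol]
    ring
  set T : BoundedContinuousFunction ℕ ℝ → BoundedContinuousFunction ℕ ℝ := fun h =>
    BoundedContinuousFunction.ofNormedAddCommGroupDiscrete (fun k => f k - η * D h k)
      (|f 0| + 1 + |η| * (2 * ‖h‖ / A)) (fun k => by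
        rw [Real.norm_eq_abs]
        refine (abs_sub _ _).trans (add_le_add (hfb k) ?_)
        rw [abs_mul]
        exact mul_le_mul_of_nonneg_left (hDb h k) hη0) with hT
  have hTapp : ∀ h k, T h k = f k - η * D h k := fun h k => rfl
  have hK0 : 0 ≤ 2 * |η| / A := by positivity
  have hK : ContractingWith ⟨2 * |η| / A, hK0⟩ T := by
    refine ⟨?_, LipschitzWith.of_dist_le_mul fun h h' => ?_⟩
    · exact NNReal.coe_lt_coe.1 ((div_lt_one hA).2 hη)
    · rw [BoundedContinuousFunction.dist_le (by positivity)]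
      intro k
      rw [hTapp, hTapp, Real.dist_eq, dist_eq_norm]
      have e : f k - η * D h k - (f k - η * D h' k) = -(η * D (h - h') k) := by
        rw [← hDsub]; ring
      rw [e, abs_neg, abs_mul]
      calc |η| * |D (h - h') k| ≤ |η| * (2 * ‖h - h'‖ / A) := by
            gcongr
            exact hDb (h - h') k
        _ = 2 * |η| / A * ‖h - h'‖ := by ring
  set h := hK.fixedPoint T with hh
  have hfix : ∀ k, h k = f k - η * D h k := fun k => by
    have := hK.fixedPoint_isFixedPt (f := T)
    rw [← hTapp]
    exact congrArg (fun u : BoundedContinuousFunction ℕ ℝ => u k) this.symm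
  -- the oscillation of the fixed point
  set w := sSup (Set.range fun p : ℕ × ℕ => h p.1 - h p.2) with hw
  have hwb : BddAbove (Set.range fun p : ℕ × ℕ => h p.1 - h p.2) :=
    ⟨2 * ‖h‖, by rintro _ ⟨p, rfl⟩; exact hosc h _ _⟩
  have hwle : ∀ i j, h i - h j ≤ w := fun i j => le_csSup hwb ⟨(i, j), rfl⟩
  have hDw : ∀ k, |D h k| ≤ w / A := fun k => B.abs_solution_diff_le hwle hA hAab k
  have hw1 : w ≤ 1 + 2 * |η| * (w / A) := by
    refine csSup_le (Set.range_nonempty _) ?_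
    rintro _ ⟨⟨i, j⟩, rfl⟩
    simp only
    rw [hfix i, hfix j]
    have h1 : -(η * D h i) ≤ |η| * (w / A) := by
      refine (neg_le_abs _).trans ?_
      rw [abs_mul]
      exact mul_le_mul_of_nonneg_left (hDw i) hη0
    have h2 : η * D h j ≤ |η| * (w / A) := by
      refine (le_abs_self _).trans ?_
      rw [abs_mul]
      exact mul_le_mul_of_nonneg_left (hDw j) hη0
    linarith [hf i j]
  have hwA : w / A ≤ 1 / (A - 2 * |η|) := by
    rw [div_le_div_iff₀ hA hden]
    have : 2 * |η| * (w / A) * A = 2 * |η| * w := by field_simp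
    nlinarith
  refine ⟨birthDeathSolution b ν h, ∑' i, ν i * h i, fun k hk => ?_, fun k => (hDw k).trans hwA,
    fun k => ?_, fun k hk => by rw [birthDeathSolution, hk, mul_zero, div_zero]⟩
  · rw [B.solution_spec h.norm_coe_le_norm hk, hfix k]
    ring
  · have hc : |h k - ∑' i, ν i * h i| ≤ w := by
      have hs := (B.hasSum.mul_right (h k)).sub (B.summable_mul h.norm_coe_le_norm).hasSum
      rw [one_mul] at hs
      have hs2 : HasSum (fun i => ν i * (h k - h i)) (h k - ∑' i, ν i * h i) :=
        hs.congr_fun fun i => by ring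
      have hb := B.hasSum.mul_right w
      rw [one_mul] at hb
      rw [abs_le]
      constructor
      · have := hasSum_le (fun i => ?_) hb.neg hs2
        · exact this
        · nlinarith [B.nonneg i, hwle i k]
      · refine hasSum_le (fun i => ?_) hs2 hb
        exact mul_le_mul_of_nonneg_left (hwle k i) (B.nonneg i)
    have e : f k - ∑' i, ν i * h i = (h k - ∑' i, ν i * h i) + η * D h k := by
      rw [hfix k]; ring
    rw [e]
    refine (abs_add_le _ _).trans ?_
    have h3 : |η * D h k| ≤ |η| * (w / A) := by
      rw [abs_mul]
      exact mul_le_mul_of_nonneg_left (hDw k) hη0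
    have h4 : w = w / A * A := by field_simp
    calc _ ≤ w + |η| * (w / A) := add_le_add hc h3
      _ = w / A * (A + |η|) := by rw [mul_add]; linarith
      _ ≤ 1 / (A - 2 * |η|) * (2 * A) := by gcongr; linarith
      _ = _ := by ring

end BirthDeath

/-! ### Convolutions with Poisson weights -/

/-- A weight on `ℕ` with an absolutely convergent second moment. -/
def HasSecondMoment (f : ℕ → ℝ) : Prop := Summable fun k => |f k| * (1 + (k : ℝ)) ^ 2

/-- The ratio test. -/
lemma HasSecondMoment.of_ratio {f c : ℕ → ℝ} {l : ℝ} (hc : Filter.Tendsto c Filter.atTop (nhds l))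
    (hl : l < 1) (h : ∀ k, |f (k + 1)| ≤ c k * |f k|) : HasSecondMoment f := by
  obtain ⟨ρ, hρ, hρ1⟩ := exists_between hl
  have hlim : Filter.Tendsto (fun k : ℕ => c k * (1 + 1 / ((k : ℝ) + 1)) ^ 2) Filter.atTop
      (nhds (l * (1 + 0) ^ 2)) :=
    hc.mul ((tendsto_const_nhds.add tendsto_one_div_add_atTop_nhds_zero_nat).pow 2)
  have hev := hlim.eventually_le_const (u := ρ) (by simpa using hρ)
  refine summable_of_ratio_norm_eventually_le hρ1 ?_
  filter_upwards [hev] with k hk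
  rw [Real.norm_eq_abs, Real.norm_eq_abs, abs_mul, abs_mul, abs_abs, abs_abs,
    abs_of_nonneg (by positivity : (0 : ℝ) ≤ (1 + ((k + 1 : ℕ) : ℝ)) ^ 2),
    abs_of_nonneg (by positivity : (0 : ℝ) ≤ (1 + (k : ℝ)) ^ 2)]
  have e : (1 + ((k + 1 : ℕ) : ℝ)) = (1 + 1 / ((k : ℝ) + 1)) * (1 + k) := by
    push_cast; field_simp; ring
  calc |f (k + 1)| * (1 + ((k + 1 : ℕ) : ℝ)) ^ 2 ≤
        c k * |f k| * (1 + ((k + 1 : ℕ) : ℝ)) ^ 2 := by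
          gcongr
          exact h k
    _ = c k * (1 + 1 / ((k : ℝ) + 1)) ^ 2 * (|f k| * (1 + (k : ℝ)) ^ 2) := by rw [e]; ring
    _ ≤ _ := by gcongr

lemma HasSecondMoment.summable_of_le {f h : ℕ → ℝ} (hf : HasSecondMoment f) {C : ℝ}
    (hh : ∀ k : ℕ, |h k| ≤ C * (1 + k) ^ 2) : Summable fun k => f k * h k := by
  refine Summable.of_norm_bounded (hf.mul_left C) fun k => ?_
  rw [Real.norm_eq_abs, abs_mul]
  calc |f k| * |h k| ≤ |f k| * (C * (1 + k) ^ 2) := by gcongr; exact hh k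
    _ = _ := by ring

lemma HasSecondMoment.summable_abs {f : ℕ → ℝ} (hf : HasSecondMoment f) :
    Summable fun k => |f k| :=
  Summable.of_nonneg_of_le (fun k => abs_nonneg _) (fun k => by
    have : (1 : ℝ) ≤ (1 + (k : ℝ)) ^ 2 :=
      one_le_pow₀ (by linarith [Nat.cast_nonneg (α := ℝ) k])
    exact le_mul_of_one_le_right (abs_nonneg _) this) hf

section Conv

variable {f h : ℕ → ℝ}

lemma summable_prod_of_le (hf : HasSecondMoment f) (hh : HasSecondMoment h) {Ψ : ℕ × ℕ → ℝ} {C : ℝ}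
    (hΨ : ∀ z : ℕ × ℕ, |Ψ z| ≤ C * ((1 + (z.1 : ℝ)) ^ 2 * (1 + (z.2 : ℝ)) ^ 2)) :
    Summable fun z : ℕ × ℕ => f z.1 * h z.2 * Ψ z := by
  have h1 := (Summable.mul_of_nonneg hf hh (fun k => by positivity) (fun k => by positivity)).mul_left
    C
  refine Summable.of_norm_bounded h1 fun z => ?_
  rw [Real.norm_eq_abs, abs_mul, abs_mul]
  calc |f z.1| * |h z.2| * |Ψ z| ≤
        |f z.1| * |h z.2| * (C * ((1 + (z.1 : ℝ)) ^ 2 * (1 + (z.2 : ℝ)) ^ 2)) := by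
          gcongr
          exact hΨ z
    _ = _ := by ring

/-- A sum against a convolution is a double sum. -/
lemma hasSum_convWeight {φ : ℕ → ℝ} {s : ℝ}
    (hs : HasSum (fun z : ℕ × ℕ => f z.1 * h z.2 * φ (z.1 + z.2)) s) :
    HasSum (fun k => convWeight f h k * φ k) s := by
  rw [← Finset.HasAntidiagonal.sigmaAntidiagonalEquivProd.hasSum_iff] at hs
  refine (hs.sigma fun k => hasSum_fintype _).of_eq fun k => ?_
  simp only [Function.comp_apply, Finset.HasAntidiagonal.sigmaAntidiagonalEquivProd_apply]
  rw [Finset.univ_eq_attach, Finset.sum_attach (Finset.HasAntidiagonal.antidiagonal k)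
    (fun z => f z.1 * h z.2 * φ (z.1 + z.2)),
    Finset.Nat.sum_antidiagonal_eq_sum_range_succ_mk, convWeight, Finset.sum_mul]
  refine Finset.sum_congr rfl fun j hj => ?_
  have : j + (k - j) = k := by have := Finset.mem_range.1 hj; omega
  simp only [this]

lemma summable_abs_convWeight (hf : HasSecondMoment f) (hh : HasSecondMoment h) :
    Summable fun k => |convWeight f h k| := by
  have h1 := Summable.mul_of_nonneg hf.summable_abs hh.summable_abs (fun k => abs_nonneg _)
    (fun k => abs_nonneg _)
  have h2 := (hasSum_convWeight (f := fun k => |f k|) (h := fun k => |h k|) (φ := fun _ => 1)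
    (h1.hasSum.of_eq fun z => by ring)).summable
  refine Summable.of_nonneg_of_le (fun k => abs_nonneg _) (fun k => ?_) h2
  rw [mul_one, convWeight, convWeight]
  refine (Finset.abs_sum_le_sum_abs _ _).trans (Finset.sum_le_sum fun j _ => ?_)
  rw [abs_mul]

lemma hasSum_convWeight_one {s t : ℝ} (hf : HasSum f s) (hh : HasSum h t) (hf2 : HasSecondMoment f)
    (hh2 : HasSecondMoment h) : HasSum (convWeight f h) (s * t) := by
  have h1 : Summable fun z : ℕ × ℕ => f z.1 * h z.2 :=
    (summable_prod_of_le hf2 hh2 (Ψ := fun _ => 1) (C := 1) fun z => by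
      rw [abs_one, one_mul, ← mul_pow]
      have h1 := Nat.cast_nonneg (α := ℝ) z.1
      have h2 := Nat.cast_nonneg (α := ℝ) z.2
      exact one_le_pow₀ (by nlinarith)).congr fun z => mul_one _
  have h2 := hasSum_convWeight (φ := fun _ => 1) ((hf.mul hh h1).of_eq fun z => by ring)
  exact h2.of_eq fun k => by ring

/-- Summation by parts for a weight with a one-step recursion. -/
lemma hasSum_recursion_zero {α β g : ℕ → ℝ} (hβ : β 0 = 0)
    (hbal : ∀ k, β (k + 1) * f (k + 1) = α k * f k)
    (hs : Summable fun k => f k * (β k * g k)) :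
    HasSum (fun k => f k * (α k * g (k + 1) - β k * g k)) 0 := by
  have h1 := (hasSum_nat_add_iff' 1).2 hs.hasSum
  rw [Finset.sum_range_one, hβ, zero_mul, mul_zero, sub_zero] at h1
  have h2 := h1.sub hs.hasSum
  rw [sub_self] at h2
  refine h2.of_eq fun k => ?_
  linear_combination (-g (k + 1)) * hbal k

lemma poissonWeight_succ (lam : ℝ) (k : ℕ) :
    ((k + 1 : ℕ) : ℝ) * poissonWeight lam (k + 1) = lam * poissonWeight lam k := by
  unfold poissonWeight
  rw [Nat.factorial_succ, pow_succ]
  push_cast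
  field_simp

lemma hasSecondMoment_poissonWeight (lam : ℝ) : HasSecondMoment (poissonWeight lam) := by
  have hlim : Filter.Tendsto (fun k : ℕ => |lam| * (1 / ((k : ℝ) + 1))) Filter.atTop (nhds 0) := by
    simpa using tendsto_one_div_add_atTop_nhds_zero_nat.const_mul |lam|
  refine HasSecondMoment.of_ratio hlim one_pos fun k => le_of_eq ?_
  have h := congrArg abs (poissonWeight_succ lam k)
  rw [abs_mul, abs_mul, Nat.abs_cast] at h
  push_cast at h
  field_simp
  linarith

lemma hasSum_poissonWeight (lam : ℝ) : HasSum (poissonWeight lam) 1 := by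
  have h := (NormedSpace.expSeries_div_hasSum_exp lam).mul_left (Real.exp (-lam))
  rw [← Real.exp_eq_exp_ℝ, ← Real.exp_add, neg_add_cancel, Real.exp_zero] at h
  exact h.of_eq fun k => by unfold poissonWeight; ring

/-- The Stein identity for the convolution of a Poisson weight with a weight whose ratios of
successive terms have the form `(u + v k) / (w (k + 1))`: the operator has linear coefficients up to
a perturbation by the first difference of `g (k + 1)`. -/
lemma hasSum_conv_poisson_zero {u v w lam : ℝ} (hf2 : HasSecondMoment f)
    (hf : ∀ k : ℕ, w * ((k + 1 : ℕ) : ℝ) * f (k + 1) = (u + v * k) * f k) {g : ℕ → ℝ} {C : ℝ}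
    (hg : ∀ k : ℕ, |g k| ≤ C * (1 + k)) :
    HasSum (fun k : ℕ => convWeight f (poissonWeight lam) k *
      ((u + w * lam - v * lam + v * k) * g (k + 1) - w * k * g k -
        v * lam * (g (k + 1 + 1) - g (k + 1)))) 0 := by
  have hC : 0 ≤ C := by
    have := (abs_nonneg _).trans (hg 0)
    simpa using this
  have hp2 := hasSecondMoment_poissonWeight lam
  set π := poissonWeight lam with hπ
  have hg1 : ∀ i j : ℕ, |g (i + j)| ≤ C * ((1 + (i : ℝ)) * (1 + j)) := fun i j => by
    refine (hg _).trans (mul_le_mul_of_nonneg_left ?_ hC)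
    push_cast
    nlinarith [mul_nonneg (Nat.cast_nonneg (α := ℝ) i) (Nat.cast_nonneg (α := ℝ) j)]
  have key : ∀ {a b : ℝ} {i : ℕ} (j l : ℕ), |a| ≤ b → 0 ≤ b → |a * g (i + j + l)| ≤
      b * (C * (1 + (l : ℝ))) * ((1 + (i : ℝ)) * (1 + (j : ℝ))) := by
    intro a b i j l hab hb
    rw [abs_mul]
    have h1 := hg1 (i + j) l
    have h2 : C * ((1 + ((i + j : ℕ) : ℝ)) * (1 + l)) ≤
        C * (((1 + (i : ℝ)) * (1 + (j : ℝ))) * (1 + l)) := by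
      gcongr
      push_cast
      nlinarith [mul_nonneg (Nat.cast_nonneg (α := ℝ) i) (Nat.cast_nonneg (α := ℝ) j)]
    calc |a| * |g (i + j + l)| ≤ b * (C * (((1 + (i : ℝ)) * (1 + (j : ℝ))) * (1 + l))) := by
          gcongr
          exact h1.trans h2
      _ = _ := by ring
  have wt : ∀ i j : ℕ, (1 + (i : ℝ)) * ((1 + (i : ℝ)) * (1 + (j : ℝ))) ≤
      (1 + (i : ℝ)) ^ 2 * (1 + (j : ℝ)) ^ 2 ∧ (1 + (j : ℝ)) * ((1 + (i : ℝ)) * (1 + (j : ℝ))) ≤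
      (1 + (i : ℝ)) ^ 2 * (1 + (j : ℝ)) ^ 2 := fun i j => by
    have hi : (1 : ℝ) ≤ 1 + i := by linarith [Nat.cast_nonneg (α := ℝ) i]
    have hj : (1 : ℝ) ≤ 1 + j := by linarith [Nat.cast_nonneg (α := ℝ) j]
    constructor
    · calc _ = (1 + (i : ℝ)) ^ 2 * (1 + j) := by ring
        _ ≤ _ := by gcongr; exact le_self_pow₀ hj (by norm_num)
    · calc _ = (1 + (i : ℝ)) * (1 + (j : ℝ)) ^ 2 := by ring
        _ ≤ _ := by gcongr; exact le_self_pow₀ hi (by norm_num)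
  -- the recursion of `f` in the first coordinate
  have h1 : HasSum (fun z : ℕ × ℕ => f z.1 * π z.2 *
      ((u + v * z.1) * g (z.1 + z.2 + 1) - w * z.1 * g (z.1 + z.2))) 0 := by
    have hs : Summable fun z : ℕ × ℕ => f z.1 * π z.2 *
        ((u + v * z.1) * g (z.1 + z.2 + 1) - w * z.1 * g (z.1 + z.2)) := by
      refine summable_prod_of_le hf2 hp2 (C := (|u| + |v|) * (C * 2) + |w| * (C * 1)) fun z => ?_
      have hi := Nat.cast_nonneg (α := ℝ) z.1
      have b1 : |u + v * z.1| ≤ (|u| + |v|) * (1 + z.1) := by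
        refine (abs_add_le _ _).trans ?_
        rw [abs_mul, Nat.abs_cast]
        nlinarith [mul_nonneg (abs_nonneg u) hi, abs_nonneg v]
      have b2 : |w * z.1| ≤ |w| * (1 + z.1) := by
        rw [abs_mul, Nat.abs_cast]
        nlinarith [abs_nonneg w]
      have k1 := key (i := z.1) z.2 1 b1 (by positivity)
      have k2 := key (i := z.1) z.2 0 b2 (by positivity)
      rw [add_zero] at k2
      refine (abs_sub _ _).trans ((add_le_add k1 k2).trans ?_)
      push_cast
      calc _ = ((|u| + |v|) * (C * 2) + |w| * (C * 1)) *
            ((1 + (z.1 : ℝ)) * ((1 + (z.1 : ℝ)) * (1 + (z.2 : ℝ)))) := by ring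
        _ ≤ _ := mul_le_mul_of_nonneg_left (wt z.1 z.2).1 (by positivity)
    have hsw := (Equiv.prodComm ℕ ℕ).hasSum_iff.2 hs.hasSum
    have hz := hsw.prod_fiberwise (g := fun _ => 0) fun j => by
      have hsj : Summable fun k : ℕ => f k * (w * k * g (k + j)) :=
        hf2.summable_of_le (C := |w| * C * (1 + j)) fun k => by
          rw [abs_mul, abs_mul, Nat.abs_cast]
          calc |w| * k * |g (k + j)| ≤ |w| * (1 + k) * (C * ((1 + (k : ℝ)) * (1 + j))) := by
                gcongr
                · linarith
                · exact hg1 k j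
            _ = _ := by ring
      have := (hasSum_recursion_zero (f := f) (α := fun k => u + v * k) (β := fun k => w * k)
        (g := fun k => g (k + j)) (by simp) (fun k => hf k) hsj).mul_left (π j)
      rw [mul_zero] at this
      refine this.of_eq fun k => ?_
      simp only [Function.comp_apply, Equiv.prodComm_apply, Prod.fst_swap, Prod.snd_swap]
      rw [add_right_comm k 1 j]
      ring
    exact hz.unique hasSum_zero ▸ hs.hasSum
  -- the recursion of the Poisson weight in the second coordinate
  have h2 : ∀ l : ℕ, HasSum (fun z : ℕ × ℕ => f z.1 * π z.2 *
      (lam * g (z.1 + z.2 + 1 + l) - z.2 * g (z.1 + z.2 + l))) 0 := by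
    intro l
    have hs : Summable fun z : ℕ × ℕ => f z.1 * π z.2 *
        (lam * g (z.1 + z.2 + 1 + l) - z.2 * g (z.1 + z.2 + l)) := by
      refine summable_prod_of_le hf2 hp2
        (C := |lam| * (C * (1 + ((1 + l : ℕ) : ℝ))) + C * (1 + (l : ℝ))) fun z => ?_
      have hj := Nat.cast_nonneg (α := ℝ) z.2
      have b1 : |lam| ≤ |lam| * (1 + z.2) := by
        nlinarith [mul_nonneg (abs_nonneg lam) hj]
      have b2 : |(z.2 : ℝ)| ≤ 1 + z.2 := by
        rw [Nat.abs_cast]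
        linarith
      have k1 := key (i := z.1) z.2 (1 + l) b1 (by positivity)
      have k2 := key (i := z.1) z.2 l b2 (by positivity)
      rw [← add_assoc] at k1
      refine (abs_sub _ _).trans ((add_le_add k1 k2).trans ?_)
      calc _ = (|lam| * (C * (1 + ((1 + l : ℕ) : ℝ))) + C * (1 + (l : ℝ))) *
            ((1 + (z.2 : ℝ)) * ((1 + (z.1 : ℝ)) * (1 + (z.2 : ℝ)))) := by ring
        _ ≤ _ := mul_le_mul_of_nonneg_left (wt z.1 z.2).2 (by positivity)
    have hz := hs.hasSum.prod_fiberwise (g := fun _ => 0) fun i => by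
      have hsj : Summable fun k : ℕ => π k * (k * g (i + k + l)) :=
        hp2.summable_of_le (C := C * ((1 + i) * (1 + l))) fun k => by
          rw [abs_mul, Nat.abs_cast]
          have h5 := hg1 (i + k) l
          have h6 : (1 + ((i + k : ℕ) : ℝ)) ≤ (1 + i) * (1 + k) := by
            push_cast
            nlinarith [mul_nonneg (Nat.cast_nonneg (α := ℝ) i) (Nat.cast_nonneg (α := ℝ) k)]
          calc (k : ℝ) * |g (i + k + l)| ≤ (1 + k) * (C * (((1 + i) * (1 + k)) * (1 + l))) := by
                gcongr
                · linarith
                · refine h5.trans ?_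
                  gcongr
            _ = _ := by ring
      have := (hasSum_recursion_zero (f := π) (α := fun _ => lam) (β := fun k => k)
        (g := fun k => g (i + k + l)) (by simp) (fun k => poissonWeight_succ lam k)
        hsj).mul_left (f i)
      rw [mul_zero] at this
      refine this.of_eq fun k => ?_
      rw [← add_assoc]
      ring
    exact hz.unique hasSum_zero ▸ hs.hasSum
  refine hasSum_convWeight ?_
  have h3 := (h1.add ((h2 0).mul_left w)).sub ((h2 1).mul_left v)
  rw [mul_zero, mul_zero, add_zero, sub_zero] at h3
  refine h3.of_eq fun z => ?_
  push_cast
  simp only [add_zero]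
  ring

end Conv

section NegBinomial

lemma negBinomialWeight_succ (r p : ℝ) (k : ℕ) :
    1 * ((k + 1 : ℕ) : ℝ) * negBinomialWeight r p (k + 1) =
      ((1 - p) * r + (1 - p) * k) * negBinomialWeight r p k := by
  unfold negBinomialWeight
  rw [Nat.factorial_succ, pow_succ, Finset.prod_range_succ]
  push_cast
  field_simp

lemma hasSecondMoment_negBinomialWeight {r p : ℝ} (hp : 0 < p) (hp1 : p < 1) :
    HasSecondMoment (negBinomialWeight r p) := by
  have hlim : Filter.Tendsto (fun k : ℕ => |(1 - p) * (1 + (r - 1) * (1 / ((k : ℝ) + 1)))|)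
      Filter.atTop (nhds |(1 - p) * (1 + (r - 1) * 0)|) :=
    ((tendsto_const_nhds.add (tendsto_one_div_add_atTop_nhds_zero_nat.const_mul (r - 1))).const_mul
      (1 - p)).abs
  refine HasSecondMoment.of_ratio hlim ?_ fun k => le_of_eq ?_
  · rw [mul_zero, add_zero, mul_one, abs_of_pos (by linarith)]; linarith
  · have h := negBinomialWeight_succ r p k
    rw [← abs_mul]
    congr 1
    push_cast at h
    field_simp
    linear_combination h

lemma ringChoose_eq_prod (r : ℝ) (k : ℕ) :
    Ring.choose (r + k - 1) k = (∏ i ∈ Finset.range k, (r + i)) / (k.factorial : ℝ) := by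
  rw [eq_div_iff (by positivity), mul_comm, ← nsmul_eq_mul]
  have h1 : Ring.choose (r + k - 1) k = Ring.multichoose r k := by
    rw [Ring.choose]; congr 1; ring
  rw [h1, Ring.factorial_nsmul_multichoose_eq_ascPochhammer,
    Polynomial.ascPochhammer_smeval_eq_eval]
  induction k with
  | zero => simp
  | succ k ih =>
    rw [ascPochhammer_succ_eval, Finset.prod_range_succ, ih (by rw [Ring.choose]; congr 1; ring)]

lemma hasSum_negBinomialWeight {r p : ℝ} (hp : 0 < p) (hp1 : p < 1) :
    HasSum (negBinomialWeight r p) 1 := by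
  have h := (Real.one_div_one_sub_rpow_hasFPowerSeriesOnBall_zero r).hasSum (y := 1 - p) (by
    rw [Metric.mem_eball, edist_dist, dist_zero_right, Real.norm_eq_abs, abs_of_pos (by linarith)]
    rw [ENNReal.ofReal_lt_one]
    linarith)
  simp only [FormalMultilinearSeries.ofScalars_apply_eq, zero_add, sub_sub_cancel] at h
  have h2 := h.mul_left (p ^ r)
  have hpr : p ^ r ≠ 0 := (Real.rpow_pos_of_pos hp r).ne'
  rw [mul_one_div_cancel hpr] at h2
  refine h2.of_eq fun k => ?_
  rw [ringChoose_eq_prod, negBinomialWeight]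
  simp
  ring

lemma negBinomialWeight_pos {r p : ℝ} (hr : 0 < r) (hp : 0 < p) (hp1 : p < 1) (k : ℕ) :
    0 < negBinomialWeight r p k := by
  unfold negBinomialWeight
  have h1 : 0 < ∏ i ∈ Finset.range k, (r + i) := Finset.prod_pos fun i _ => by positivity
  have h2 : 0 < 1 - p := by linarith
  have h3 := Real.rpow_pos_of_pos hp r
  positivity

end NegBinomial

section Binomial

lemma binomialWeight_eq_zero {n k : ℕ} (p : ℝ) (h : n < k) : binomialWeight n p k = 0 := by
  simp [binomialWeight, Nat.choose_eq_zero_of_lt h]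

lemma binomialWeight_succ (n : ℕ) (p : ℝ) (k : ℕ) :
    (1 - p) * ((k + 1 : ℕ) : ℝ) * binomialWeight n p (k + 1) =
      (p * n + -p * k) * binomialWeight n p k := by
  rcases lt_or_ge k n with h | h
  · have h1 : ((n.choose (k + 1) : ℕ) : ℝ) * ((k + 1 : ℕ) : ℝ) = n.choose k * ((n : ℝ) - k) := by
      have := Nat.choose_succ_right_eq n k
      rw [← Nat.cast_sub h.le]
      exact_mod_cast this
    have h2 : n - k = n - (k + 1) + 1 := by omega
    unfold binomialWeight
    rw [h2, pow_succ, pow_succ]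
    linear_combination (p ^ k * p * (1 - p) ^ (n - (k + 1)) * (1 - p)) * h1
  · rw [binomialWeight_eq_zero p (by omega)]
    rcases h.eq_or_lt with h | h
    · rw [h]; ring
    · rw [binomialWeight_eq_zero p h]; ring

lemma hasSecondMoment_binomialWeight (n : ℕ) (p : ℝ) : HasSecondMoment (binomialWeight n p) := by
  refine summable_of_ne_finset_zero (s := Finset.range (n + 1)) fun k hk => ?_
  rw [binomialWeight_eq_zero p (by simpa using hk)]
  simp

lemma hasSum_binomialWeight (n : ℕ) (p : ℝ) : HasSum (binomialWeight n p) 1 := by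
  have h : HasSum (binomialWeight n p) (∑ k ∈ Finset.range (n + 1), binomialWeight n p k) :=
    hasSum_sum_of_ne_finset_zero fun k hk => binomialWeight_eq_zero p (by simpa using hk)
  have e : ∑ k ∈ Finset.range (n + 1), binomialWeight n p k = 1 := by
    have := add_pow p (1 - p) n
    rw [add_sub_cancel, one_pow] at this
    rw [this]
    exact Finset.sum_congr rfl fun k _ => by unfold binomialWeight; ring
  rwa [e] at h

end Binomial

/-! ### The Stein operator at the sum of the field -/

section SteinOperator

variable {d : ℕ} {J : Finset (Fin d → ℤ)} {Ω : Type*} [MeasurableSpace Ω] {μ : Measure Ω}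
  [IsProbabilityMeasure μ] {X : J → Ω → ℕ} {m : ℕ}

lemma integrable_comp_fieldSum (hX : ∀ i, Measurable (X i))
    (hint : ∀ i, Integrable (fun ω => (X i ω : ℝ) ^ 4) μ) {φ : ℕ → ℝ} {C : ℝ}
    (hφ : ∀ k : ℕ, |φ k| ≤ C * (1 + k) ^ 4) : Integrable (fun ω => φ (fieldSum X ω)) μ :=
  ((integrable_one_add_fieldSum_pow hX hint).const_mul C).mono'
    ((Measurable.of_discrete (f := φ)).comp (measurable_fieldSum hX)).aestronglyMeasurable
    (Filter.Eventually.of_forall fun _ => hφ _)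

lemma abs_le_of_diff_le {g : ℕ → ℝ} {H : ℝ} (hg : ∀ k, |g (k + 1 + 1) - g (k + 1)| ≤ H) (k : ℕ) :
    |g k| ≤ (|g 0| + |g 1| + H) * (1 + k) := by
  have hH : 0 ≤ H := (abs_nonneg _).trans (hg 0)
  have h1 : ∀ k : ℕ, |g (k + 1)| ≤ |g 1| + H * k := by
    intro k
    induction k with
    | zero => simp
    | succ k ih =>
      have h2 : g (k + 1 + 1) = g (k + 1) + (g (k + 1 + 1) - g (k + 1)) := by ring
      rw [h2]
      refine (abs_add_le _ _).trans ((add_le_add ih (hg k)).trans (le_of_eq ?_))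
      push_cast
      ring
  rcases k with _ | k
  · simp only [Nat.cast_zero, add_zero, mul_one]
    linarith [abs_nonneg (g 1)]
  · refine (h1 k).trans ?_
    push_cast
    have hk := Nat.cast_nonneg (α := ℝ) k
    nlinarith [abs_nonneg (g 0), abs_nonneg (g 1), mul_nonneg (abs_nonneg (g 0)) hk,
      mul_nonneg (abs_nonneg (g 1)) hk]

lemma abs_integral_le_of_bounded {φ : Ω → ℝ} {C : ℝ} (hφ : ∀ ω, |φ ω| ≤ C) :
    |∫ ω, φ ω ∂μ| ≤ C := by
  have h := norm_integral_le_of_norm_le_const (μ := μ) (f := φ) (C := C)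
    (Filter.Eventually.of_forall hφ)
  rwa [probReal_univ, mul_one] at h

/-- The expectation of a Stein operator with linear coefficients applied to `W`. Subtracting the
expansions of `E[W g(W)]` and of `E[W Δg(W)]` leaves multiples of `E g(W + 1)`, `E Δg(W + 1)` and
`E Δ²g(W + 1)`. The hypotheses `h1` and `h3` make the first and the last of them cancel. -/
lemma abs_integral_operator_le (hX : ∀ i, Measurable (X i))
    (hint : ∀ i, Integrable (fun ω => (X i ω : ℝ) ^ 4) μ) (hdep : IsMDependent m X μ)
    {g : ℕ → ℝ} {H : ℝ} (hg : ∀ k, |g (k + 1 + 1) - g (k + 1)| ≤ H) {A v w η : ℝ}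
    (h1 : A + (v - w) * Gam1 μ (fieldSum X) = 0)
    (h3 : (v - w) * Gam3 μ (fieldSum X) + v * Gam2 μ (fieldSum X) = 0)
    (hv : |v| ≤ 1) (hvw : |v - w| ≤ 1) :
    |∫ ω, ((A + v * fieldSum X ω) * g (fieldSum X ω + 1) - w * fieldSum X ω * g (fieldSum X ω)
      + η * (g (fieldSum X ω + 1 + 1) - g (fieldSum X ω + 1))) ∂μ| ≤
      H * (totalErrorThree μ X m + totalErrorTwo μ X m +
        |(v - w) * Gam2 μ (fieldSum X) + v * Gam1 μ (fieldSum X) + η|) := by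
  have hH : 0 ≤ H := (abs_nonneg _).trans (hg 0)
  set W := fieldSum X with hW
  -- the values of `g` below `1` play no role and are replaced by `g 1`
  set G : ℤ → ℝ := fun k => if k ≤ 0 then g 1 else g k.toNat with hG
  have hGs : ∀ k : ℕ, G ((k : ℤ) + 1) = g (k + 1) := fun k => by
    have h : ¬ ((k : ℤ) + 1 ≤ 0) := by omega
    have h' : ((k : ℤ) + 1).toNat = k + 1 := by omega
    simp only [hG, h, if_false, h']
  have hGd : ∀ k, |Δ G k| ≤ H := fun k => by
    rw [fwdDiff]
    rcases lt_or_ge k 0 with hk | hk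
    · have h : k ≤ 0 := hk.le
      have h' : k + 1 ≤ 0 := hk
      simp only [hG, h, h', if_true, sub_self, abs_zero]
      exact hH
    · obtain ⟨n, rfl⟩ := Int.eq_ofNat_of_zero_le hk
      rcases n with _ | n
      · have h1 := hGs 0
        have h0 : G ((0 : ℕ) : ℤ) = g 1 := by simp [hG]
        rw [h1, h0]
        simpa using hH
      · have e1 := hGs n
        have e2 := hGs (n + 1)
        push_cast at e1 e2 ⊢
        rw [e1, e2]
        exact hg n
  have hS : IsSecondDiff H (Δ (Δ (Δ G))) := IsSecondDiff.of_bounded hGd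
  have r3 := field_expansion_three hX hint hdep hS
  have r2 := field_expansion_two hX hint hdep hS
  rw [← hW] at r2 r3
  have hWG : ∀ ω, (W ω : ℝ) * G (W ω) = W ω * g (W ω) := fun ω => by
    rcases W ω with _ | n
    · simp
    · have := hGs n
      push_cast at this ⊢
      rw [this]
  have hWΔ : ∀ ω, (W ω : ℝ) * Δ G (W ω) = W ω * g (W ω + 1) - W ω * g (W ω) := fun ω => by
    rw [fwdDiff, mul_sub, hGs, hWG]
  have hΔ1 : ∀ ω, Δ G ((W ω : ℤ) + 1) = g (W ω + 1 + 1) - g (W ω + 1) := fun ω => by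
    have := hGs (W ω + 1)
    push_cast at this
    rw [fwdDiff, hGs, this]
  set c := |g 0| + |g 1| + H with hc
  have hc0 : 0 ≤ c := by positivity
  have hgb := abs_le_of_diff_le hg
  have p4 : ∀ k : ℕ, ∀ b ≤ 4, (1 + (k : ℝ)) ^ b ≤ (1 + k) ^ 4 := fun k b hb =>
    pow_le_pow_right₀ (by linarith [Nat.cast_nonneg (α := ℝ) k]) hb
  have i1 : Integrable (fun ω => g (W ω + 1)) μ :=
    integrable_comp_fieldSum hX hint (φ := fun k => g (k + 1)) (C := 2 * c) fun k => by
      refine (hgb _).trans ?_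
      have := p4 k 1 (by norm_num)
      rw [pow_one] at this
      have hk := Nat.cast_nonneg (α := ℝ) k
      push_cast
      nlinarith
  have i2 : Integrable (fun ω => (W ω : ℝ) * g (W ω)) μ :=
    integrable_comp_fieldSum hX hint (φ := fun k => (k : ℝ) * g k) (C := c) fun k => by
      have hk := Nat.cast_nonneg (α := ℝ) k
      rw [abs_mul, Nat.abs_cast]
      calc (k : ℝ) * |g k| ≤ (1 + k) * (c * (1 + k)) := by
            gcongr
            · linarith
            · exact hgb k
        _ = c * (1 + k) ^ 2 := by ring
        _ ≤ _ := mul_le_mul_of_nonneg_left (p4 k 2 (by norm_num)) (by positivity)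
  have i3 : Integrable (fun ω => (W ω : ℝ) * g (W ω + 1)) μ :=
    integrable_comp_fieldSum hX hint (φ := fun k => (k : ℝ) * g (k + 1)) (C := 2 * c) fun k => by
      have hk := Nat.cast_nonneg (α := ℝ) k
      rw [abs_mul, Nat.abs_cast]
      calc (k : ℝ) * |g (k + 1)| ≤ (1 + k) * (c * (2 * (1 + k))) := by
            gcongr
            · linarith
            · refine (hgb _).trans ?_
              gcongr
              push_cast
              linarith
        _ = 2 * c * (1 + k) ^ 2 := by ring
        _ ≤ _ := mul_le_mul_of_nonneg_left (p4 k 2 (by norm_num)) (by positivity)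
  have i4 : Integrable (fun ω => g (W ω + 1 + 1) - g (W ω + 1)) μ :=
    integrable_comp_fieldSum hX hint (φ := fun k => g (k + 1 + 1) - g (k + 1)) (C := H) fun k => by
      have := p4 k 0 (by norm_num)
      rw [pow_zero] at this
      exact (hg k).trans (le_mul_of_one_le_right hH this)
  simp only [hWG, hGs, hΔ1] at r3
  simp only [hWΔ, hΔ1, integral_sub i3 i2] at r2
  have hsplit : ∫ ω, ((A + v * W ω) * g (W ω + 1) - w * W ω * g (W ω)
      + η * (g (W ω + 1 + 1) - g (W ω + 1))) ∂μ =
      A * (∫ ω, g (W ω + 1) ∂μ) + v * (∫ ω, (W ω : ℝ) * g (W ω + 1) ∂μ) -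
        w * (∫ ω, (W ω : ℝ) * g (W ω) ∂μ) + η * ∫ ω, (g (W ω + 1 + 1) - g (W ω + 1)) ∂μ := by
    have j1 : Integrable (fun ω => A * g (W ω + 1) + v * (W ω * g (W ω + 1))) μ :=
      (i1.const_mul A).add (i3.const_mul v)
    have j2 : Integrable (fun ω => A * g (W ω + 1) + v * (W ω * g (W ω + 1)) -
        w * (W ω * g (W ω))) μ := j1.sub (i2.const_mul w)
    rw [← integral_const_mul, ← integral_const_mul, ← integral_const_mul, ← integral_const_mul,
      ← integral_add (i1.const_mul A) (i3.const_mul v), ← integral_sub j1 (i2.const_mul w),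
      ← integral_add j2 (i4.const_mul η)]
    refine integral_congr_ae (Filter.Eventually.of_forall fun ω => ?_)
    ring
  rw [hsplit]
  set E0 := ∫ ω, g (W ω + 1) ∂μ
  set E1 := ∫ ω, (g (W ω + 1 + 1) - g (W ω + 1)) ∂μ with hE1
  set E2 := ∫ ω, Δ (Δ G) ((W ω : ℤ) + 1) ∂μ
  set Y := ∫ ω, (W ω : ℝ) * g (W ω) ∂μ
  set Z := ∫ ω, (W ω : ℝ) * g (W ω + 1) ∂μ
  set Γ₁ := Gam1 μ W
  set Γ₂ := Gam2 μ W
  set Γ₃ := Gam3 μ W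
  set R3 := Y - (Γ₁ * E0 + Γ₂ * E1 + Γ₃ * E2) with hR3
  set R2 := Z - Y - (Γ₁ * E1 + Γ₂ * E2) with hR2
  have hE1b : |E1| ≤ H := abs_integral_le_of_bounded fun ω => hg _
  have e : A * E0 + v * Z - w * Y + η * E1 =
      (v - w) * R3 + v * R2 + ((v - w) * Γ₂ + v * Γ₁ + η) * E1 := by
    rw [hR3, hR2]
    linear_combination E0 * h1 + E2 * h3
  rw [e]
  refine (abs_add_le _ _).trans ((add_le_add (abs_add_le _ _) le_rfl).trans ?_)
  rw [abs_mul, abs_mul, abs_mul]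
  have s1 : |v - w| * |R3| ≤ H * totalErrorThree μ X m :=
    (mul_le_of_le_one_left (abs_nonneg _) hvw).trans r3
  have s2 : |v| * |R2| ≤ H * totalErrorTwo μ X m :=
    (mul_le_of_le_one_left (abs_nonneg _) hv).trans r2
  have s3 := mul_le_mul_of_nonneg_left hE1b (abs_nonneg ((v - w) * Γ₂ + v * Γ₁ + η))
  linarith

end SteinOperator

/-! ### Negative binomial approximation -/

section TotalVariation

variable {Ω : Type*} [MeasurableSpace Ω] {μ : Measure Ω} [IsProbabilityMeasure μ] {W : Ω → ℕ}

lemma integrable_comp_of_bounded (hW : Measurable W) {φ : ℕ → ℝ} {C : ℝ} (hφ : ∀ k, |φ k| ≤ C) :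
    Integrable (fun ω => φ (W ω)) μ :=
  (integrable_const C).mono' ((Measurable.of_discrete (f := φ)).comp hW).aestronglyMeasurable
    (Filter.Eventually.of_forall fun _ => hφ _)

/-- To bound the total variation distance it suffices to compare the integrals of indicators. -/
lemma dTV_le_of_forall (hW : Measurable W) {M : ℕ → ℝ} {B : ℝ}
    (h : ∀ f : ℕ → ℝ, (∀ i, 0 ≤ f i) → (∀ i, f i ≤ 1) →
      |∫ ω, f (W ω) ∂μ - ∑' k, M k * f k| ≤ B) : dTV μ W M ≤ B := by
  refine ciSup_le fun A => ?_
  have h1 := h (A.indicator fun _ => 1) (fun i => Set.indicator_nonneg (fun _ _ => zero_le_one) i)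
    (fun i => Set.indicator_le_self' (fun _ _ => zero_le_one) i)
  have e1 : ∫ ω, A.indicator (fun _ => (1 : ℝ)) (W ω) ∂μ = μ.real {ω | W ω ∈ A} := by
    have : (fun ω => A.indicator (fun _ => (1 : ℝ)) (W ω)) =
        (W ⁻¹' A).indicator (fun _ => (1 : ℝ)) := rfl
    rw [this, integral_indicator_const _ (hW MeasurableSet.of_discrete), smul_eq_mul, mul_one]
    rfl
  have e2 : ∑' k, M k * A.indicator (fun _ => 1) k = ∑' k, A.indicator M k :=
    tsum_congr fun k => by by_cases hk : k ∈ A <;> simp [hk]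
  rwa [e1, e2] at h1

end TotalVariation

section NegativeBinomialPoisson

/-- The law `NB(A / (1 - p), p)` is reversible for the birth rates `A + (1 - p) k` and the death rates `k`. -/
lemma birthDeath_negBinomial {A p : ℝ} (hA : 0 < A) (hp : 0 < p) (hp1 : p < 1) :
    BirthDeath (fun k => A + (1 - p) * k) (fun k => k) (negBinomialWeight (A / (1 - p)) p) where
  nonneg k := (negBinomialWeight_pos (div_pos hA (by linarith)) hp hp1 k).le
  hasSum := hasSum_negBinomialWeight hp hp1
  birth_nonneg k := by
    have : 0 < 1 - p := by linarith
    positivity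
  death_zero := by simp
  death_pos k := by positivity
  balance k := by
    have h := negBinomialWeight_succ (A / (1 - p)) p k
    have : 1 - p ≠ 0 := by linarith
    rw [mul_div_cancel₀ _ this, one_mul] at h
    exact h.symm
  summable_birth := by
    refine ((hasSecondMoment_negBinomialWeight hp hp1).summable_of_le
      (h := fun k : ℕ => A + (1 - p) * k) (C := A + (1 - p)) fun k => ?_).congr fun k => mul_comm _ _
    have hk := Nat.cast_nonneg (α := ℝ) k
    have hq : 0 < 1 - p := by linarith
    rw [abs_of_nonneg (by positivity)]
    have h1 : (1 : ℝ) + k ≤ (1 + k) ^ 2 := le_self_pow₀ (by linarith) (by norm_num)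
    calc A + (1 - p) * k ≤ (A + (1 - p)) * (1 + k) := by nlinarith [mul_nonneg hA.le hk]
      _ ≤ _ := by gcongr
  growth j k hjk := by
    have : (j : ℝ) ≤ k := by exact_mod_cast hjk
    nlinarith

variable {d : ℕ} {J : Finset (Fin d → ℤ)} {Ω : Type*} [MeasurableSpace Ω] {μ : Measure Ω}
  [IsProbabilityMeasure μ] {X : J → Ω → ℕ} {m : ℕ}

/-- Approximation by a negative binomial convolved with a signed Poisson measure. All three cumulants
match exactly, so only the expansion errors remain. The first bound needs no expansion and serves when
the mean is small compared with the smoothness term. -/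
lemma dTV_M2_le (hX : ∀ i, Measurable (X i))
    (hint : ∀ i, Integrable (fun ω => (X i ω : ℝ) ^ 4) μ) (hdep : IsMDependent m X μ)
    {r p lam A : ℝ} (hp : 0 < p) (hp1 : p < 1)
    (hA : A = r * (1 - p) + lam * p) (hlam : 2 * (|lam| * (1 - p)) < A)
    (h1 : r * (1 - p) / p + lam = Gam1 μ (fieldSum X))
    (h2 : r * (1 - p) ^ 2 / p ^ 2 = Gam2 μ (fieldSum X))
    (h3 : r * (1 - p) ^ 3 / p ^ 3 = Gam3 μ (fieldSum X)) :
    dTV μ (fieldSum X) (M2Weight r p lam) ≤ 2 * A / (A - 2 * (|lam| * (1 - p))) ∧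
    dTV μ (fieldSum X) (M2Weight r p lam) ≤ 1 / (A - 2 * (|lam| * (1 - p))) *
      (totalErrorThree μ X m + totalErrorTwo μ X m) := by
  have hq : 0 < 1 - p := by linarith
  have hApos : 0 < A := lt_of_le_of_lt (by positivity) hlam
  have hWm := measurable_fieldSum hX
  have hη : |(-(lam * (1 - p)))| = |lam| * (1 - p) := by
    rw [abs_neg, abs_mul, abs_of_pos hq]
  rw [← hη] at hlam ⊢
  have hB := birthDeath_negBinomial hApos hp hp1
  have key : ∀ f : ℕ → ℝ, (∀ i, 0 ≤ f i) → (∀ i, f i ≤ 1) →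
      |∫ ω, f (fieldSum X ω) ∂μ - ∑' k, M2Weight r p lam k * f k| ≤
        2 * A / (A - 2 * |(-(lam * (1 - p)))|) ∧
      |∫ ω, f (fieldSum X ω) ∂μ - ∑' k, M2Weight r p lam k * f k| ≤
        1 / (A - 2 * |(-(lam * (1 - p)))|) * (totalErrorThree μ X m + totalErrorTwo μ X m) := by
    intro f hf0 hf1
    obtain ⟨g, c, hgc, hgd, hfc, -⟩ := hB.exists_perturbed_solution (f := f)
      (fun i j => by linarith [hf0 j, hf1 i]) hApos
      (fun k _ => le_max_of_le_left (by
        have := mul_nonneg hq.le (Nat.cast_nonneg (α := ℝ) (k + 1))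
        linarith)) hlam
    have hν := negBinomialWeight_pos (r := A / (1 - p)) (div_pos hApos hq) hp hp1
    have hM0 := hasSum_conv_poisson_zero (lam := lam)
      (hasSecondMoment_negBinomialWeight (r := r) hp hp1) (negBinomialWeight_succ r p)
      (abs_le_of_diff_le hgd)
    have hM1 := hasSum_convWeight_one (hasSum_negBinomialWeight (r := r) hp hp1)
      (hasSum_poissonWeight lam) (hasSecondMoment_negBinomialWeight (r := r) hp hp1)
      (hasSecondMoment_poissonWeight lam)
    rw [one_mul] at hM1
    have hMf : ∑' k, M2Weight r p lam k * f k = c := by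
      have h4 := hM0.add (hM1.mul_right c)
      rw [zero_add, one_mul, one_mul] at h4
      refine (h4.of_eq fun k => ?_).tsum_eq
      have e := hgc k (hν k)
      simp only [M2Weight]
      linear_combination (-convWeight (negBinomialWeight r p) (poissonWeight lam) k) * e +
        convWeight (negBinomialWeight r p) (poissonWeight lam) k * g (k + 1) * hA
    have hfi : Integrable (fun ω => f (fieldSum X ω)) μ :=
      integrable_comp_of_bounded hWm (C := 1) fun k => by rw [abs_of_nonneg (hf0 k)]; exact hf1 k
    have hE : ∫ ω, f (fieldSum X ω) ∂μ - c = ∫ ω, (f (fieldSum X ω) - c) ∂μ := by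
      rw [integral_sub hfi (integrable_const _)]
      simp
    rw [hMf, hE]
    refine ⟨abs_integral_le_of_bounded fun ω => hfc _, ?_⟩
    -- with these rates the three matching equations make all terms of the expansion cancel
    have h5 := abs_integral_operator_le hX hint hdep hgd (A := A) (v := 1 - p) (w := 1)
      (η := -(lam * (1 - p)))
      (by rw [← h1, hA]; field_simp; ring) (by rw [← h2, ← h3]; field_simp; ring)
      (by rw [abs_of_pos hq]; linarith) (by rw [abs_le]; constructor <;> linarith)
    have h6 : (1 - p - 1) * Gam2 μ (fieldSum X) + (1 - p) * Gam1 μ (fieldSum X)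
        + -(lam * (1 - p)) = 0 := by
      rw [← h1, ← h2]; field_simp; ring
    rw [h6, abs_zero, add_zero] at h5
    refine le_trans (le_of_eq ?_) h5
    congr 1
    refine integral_congr_ae (Filter.Eventually.of_forall fun ω => ?_)
    simp only
    rw [← hgc _ (hν _), one_mul]
  exact ⟨dTV_le_of_forall hWm fun f h0 h1 => (key f h0 h1).1,
    dTV_le_of_forall hWm fun f h0 h1 => (key f h0 h1).2⟩

end NegativeBinomialPoisson

/-! ### Tails of binomial-Poisson weights -/

section GeneratingFunction

/-- The probability generating function of `B(n, p)`. -/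
noncomputable def binomialPgf (n : ℕ) (p : ℝ) (z : ℂ) : ℂ := (((1 - p : ℝ) : ℂ) + p * z) ^ n

/-- The generating function of the signed Poisson weights. -/
noncomputable def poissonPgf (lam : ℝ) (z : ℂ) : ℂ := Complex.exp (-lam) * Complex.exp (lam * z)

lemma differentiable_binomialPgf (n : ℕ) (p : ℝ) : Differentiable ℂ (binomialPgf n p) := by
  unfold binomialPgf; fun_prop

lemma differentiable_poissonPgf (lam : ℝ) : Differentiable ℂ (poissonPgf lam) := by
  unfold poissonPgf; fun_prop

lemma iteratedDeriv_binomialPgf (n : ℕ) (p : ℝ) (k : ℕ) :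
    iteratedDeriv k (binomialPgf n p) = fun z =>
      (n.descFactorial k : ℂ) * p ^ k * (((1 - p : ℝ) : ℂ) + p * z) ^ (n - k) := by
  induction k with
  | zero => funext z; simp [binomialPgf]
  | succ k ih =>
    rw [iteratedDeriv_succ, ih]
    funext z
    have h1 : HasDerivAt (fun z : ℂ => ((1 - p : ℝ) : ℂ) + p * z) p z := by
      simpa using ((hasDerivAt_id z).const_mul (p : ℂ)).const_add ((1 - p : ℝ) : ℂ)
    rw [((h1.fun_pow (n - k)).const_mul _).deriv, Nat.descFactorial_succ, ← Nat.sub_sub]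
    push_cast
    ring

lemma iteratedDeriv_binomialPgf_zero (n : ℕ) (p : ℝ) (k : ℕ) :
    iteratedDeriv k (binomialPgf n p) 0 = (k.factorial : ℂ) * (binomialWeight n p k : ℂ) := by
  rw [iteratedDeriv_binomialPgf, Nat.descFactorial_eq_factorial_mul_choose]
  unfold binomialWeight
  push_cast
  ring

lemma iteratedDeriv_poissonPgf_zero (lam : ℝ) (k : ℕ) :
    iteratedDeriv k (poissonPgf lam) 0 = (k.factorial : ℂ) * (poissonWeight lam k : ℂ) := by
  have h : poissonPgf lam = fun z => Complex.exp (-lam) * Complex.exp (lam * z) := rfl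
  rw [h, iteratedDeriv_const_mul_field, iteratedDeriv_cexp_const_mul]
  unfold poissonWeight
  have : (k.factorial : ℂ) ≠ 0 := by exact_mod_cast k.factorial_ne_zero
  push_cast
  simp
  field_simp

lemma iteratedDeriv_pgf_zero (n : ℕ) (p lam : ℝ) (k : ℕ) :
    iteratedDeriv k (binomialPgf n p * poissonPgf lam) 0 =
      (k.factorial : ℂ) * (M1Weight n p lam k : ℂ) := by
  rw [iteratedDeriv_mul (differentiable_binomialPgf n p).contDiff.contDiffAt
    (differentiable_poissonPgf lam).contDiff.contDiffAt]
  unfold M1Weight convWeight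
  push_cast
  rw [Finset.mul_sum]
  refine Finset.sum_congr rfl fun i hi => ?_
  rw [iteratedDeriv_binomialPgf_zero, iteratedDeriv_poissonPgf_zero]
  have h : (k.choose i : ℂ) * i.factorial * (k - i).factorial = k.factorial := by
    exact_mod_cast Nat.choose_mul_factorial_mul_factorial
      (Nat.lt_succ_iff.1 (Finset.mem_range.1 hi))
  rw [← h]
  ring

/-- Cauchy's estimate for the weights of `B(n, p) * P(lam)`. -/
lemma abs_M1Weight_le {n : ℕ} {p lam ρ B : ℝ} (hρ : 0 < ρ)
    (hB : ∀ z : ℂ, ‖z‖ = ρ → ‖binomialPgf n p z * poissonPgf lam z‖ ≤ B) (k : ℕ) :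
    |M1Weight n p lam k| ≤ B / ρ ^ k := by
  have h := Complex.norm_iteratedDeriv_le_of_forall_mem_sphere_norm_le (c := 0) (R := ρ) (C := B) k hρ
    (f := binomialPgf n p * poissonPgf lam)
    ((differentiable_binomialPgf n p).mul (differentiable_poissonPgf lam)).diffContOnCl
    fun z hz => hB z (by simpa using hz)
  rw [iteratedDeriv_pgf_zero, norm_mul, Complex.norm_natCast, Complex.norm_real, mul_div_assoc] at h
  exact le_of_mul_le_mul_left h (by positivity)

/-- The modulus of `1 - p + p z` decreases from its maximum as `z` moves away from the positive half-line. -/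
lemma norm_sq_binomial_base (p : ℝ) (z : ℂ) :
    ‖((1 - p : ℝ) : ℂ) + p * z‖ ^ 2 =
      (1 - p + p * ‖z‖) ^ 2 - 2 * p * (1 - p) * (‖z‖ - z.re) := by
  have h2 : ‖z‖ ^ 2 = z.re ^ 2 + z.im ^ 2 := by
    rw [← Complex.normSq_eq_norm_sq, Complex.normSq_apply]; ring
  rw [← Complex.normSq_eq_norm_sq, Complex.normSq_apply]
  simp only [Complex.add_re, Complex.add_im, Complex.ofReal_re, Complex.ofReal_im, Complex.mul_re,
    Complex.mul_im]
  linear_combination (-p ^ 2) * h2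

/-- On the circle of radius `7 / 5` the modulus of the generating function is largest at the positive
real point. For `lam < 0` the growth of the Poisson factor away from that point is compensated by the
decay of the binomial factor. -/
lemma norm_pgf_le {n : ℕ} {p lam : ℝ} (hp : 0 < p) (hp1 : p < 1)
    (h : -lam * (1 + p) ≤ n * p * (1 - p)) {z : ℂ} (hz : ‖z‖ = 7 / 5) :
    ‖binomialPgf n p z * poissonPgf lam z‖ ≤
      (1 + p * (2 / 5)) ^ n * Real.exp (lam * (2 / 5)) := by
  set y := 7 / 5 - z.re with hy
  have hy0 : 0 ≤ y := by
    have := Complex.re_le_norm z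
    linarith
  set P := 1 + p * (2 / 5) with hP
  have hP0 : 0 < P := by positivity
  have hb : ‖((1 - p : ℝ) : ℂ) + p * z‖ ^ 2 = P ^ 2 - 2 * p * (1 - p) * y := by
    rw [norm_sq_binomial_base, hz, hP, hy]; ring
  have hq : 0 < 1 - p := by linarith
  have hH : ‖poissonPgf lam z‖ = Real.exp (lam * (2 / 5)) * Real.exp (-lam * y) := by
    rw [poissonPgf, norm_mul, Complex.norm_exp, Complex.norm_exp, ← Real.exp_add, ← Real.exp_add]
    congr 1
    simp [hy]
    ring
  set t := p * (1 - p) * y / P ^ 2 with ht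
  have ht0 : 0 ≤ t := by positivity
  have hF : ‖((1 - p : ℝ) : ℂ) + p * z‖ ≤ P * Real.exp (-t) := by
    refine le_of_pow_le_pow_left₀ (n := 2) (by norm_num) (by positivity) ?_
    rw [hb, mul_pow, ← Real.exp_nat_mul]
    have h1 : 1 - 2 * t ≤ Real.exp ((2 : ℕ) * -t) := by
      have := Real.add_one_le_exp ((2 : ℕ) * -t)
      push_cast at this ⊢
      linarith
    calc P ^ 2 - 2 * p * (1 - p) * y = P ^ 2 * (1 - 2 * t) := by rw [ht]; field_simp
      _ ≤ _ := by gcongr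
  have hexp : -lam * y ≤ n * t := by
    rcases le_or_gt 0 lam with hl | hl
    · have h1 : -lam * y ≤ 0 := by nlinarith
      have h2 : 0 ≤ n * t := by positivity
      linarith
    -- the radius `7 / 5` is close enough to one for this comparison with the hypothesis on `lam`
    · have hP2 : P ^ 2 ≤ 1 + p := by rw [hP]; nlinarith
      rw [ht, ← mul_div_assoc, le_div_iff₀ (by positivity)]
      have h3 : -lam * P ^ 2 ≤ n * p * (1 - p) :=
        (mul_le_mul_of_nonneg_left hP2 (by linarith)).trans h
      nlinarith [mul_le_mul_of_nonneg_right h3 hy0]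
  rw [norm_mul, hH, binomialPgf, norm_pow]
  calc ‖((1 - p : ℝ) : ℂ) + p * z‖ ^ n * (Real.exp (lam * (2 / 5)) * Real.exp (-lam * y)) ≤
      (P * Real.exp (-t)) ^ n * (Real.exp (lam * (2 / 5)) * Real.exp (n * t)) := by gcongr
    _ = P ^ n * Real.exp (lam * (2 / 5)) * (Real.exp (-t) ^ n * Real.exp (n * t)) := by
        rw [mul_pow]; ring
    _ = P ^ n * Real.exp (lam * (2 / 5)) := by
        rw [← Real.exp_nat_mul, ← Real.exp_add]
        simp

/-- The tail of `B(n, p) * P(lam)` beyond its mean divided by `p`, by Cauchy's estimate on the circle of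
radius `7 / 5`. With signed weights, moments cannot be used as in Chebyshev's inequality. -/
lemma abs_tsum_M1Weight_mul_le {n N : ℕ} {p lam x : ℝ} (hp : 0 < p) (hp1 : p < 1) (hx0 : 0 ≤ x)
    (hx : x = n + lam / p) (hxN : x ≤ N + 1) (hlam : 2 * |lam| ≤ (1 - p) * x) {φ : ℕ → ℝ} {κ : ℝ}
    (hφ0 : ∀ k ≤ N, φ k = 0) (hφ : ∀ k, |φ k| ≤ κ) :
    |∑' k, M1Weight n p lam k * φ k| ≤ κ * (7 / 2 * Real.exp (-((1 - p) * x / 5))) := by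
  have hq : 0 < 1 - p := by linarith
  have hκ : 0 ≤ κ := (abs_nonneg _).trans (hφ 0)
  have hlx : lam = p * (x - n) := by rw [hx]; field_simp; ring
  have hneg : -lam * (1 + p) ≤ n * p * (1 - p) := by
    have h1 : -lam ≤ |lam| := neg_le_abs lam
    nlinarith
  set B := (1 + p * (2 / 5)) ^ n * Real.exp (lam * (2 / 5)) with hB
  have hB0 : 0 ≤ B := by positivity
  have hco := abs_M1Weight_le (n := n) (p := p) (lam := lam) (ρ := 7 / 5) (by norm_num)
    fun z hz => norm_pgf_le hp hp1 hneg hz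
  rw [← hB] at hco
  -- a geometric majorant
  have hgeo : HasSum (fun k : ℕ => if k ≤ N then 0 else κ * B * (5 / 7) ^ k)
      (κ * (7 / 2 * (B * (5 / 7) ^ (N + 1)))) := by
    rw [← hasSum_nat_add_iff' (N + 1)]
    have h0 : ∑ i ∈ Finset.range (N + 1), (if i ≤ N then (0 : ℝ) else κ * B * (5 / 7) ^ i) = 0 :=
      Finset.sum_eq_zero fun i hi => if_pos (Nat.lt_succ_iff.1 (Finset.mem_range.1 hi))
    rw [h0, sub_zero]
    have h1 := (hasSum_geometric_of_lt_one (r := (5 / 7 : ℝ)) (by norm_num)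
      (by norm_num)).mul_left (κ * B * (5 / 7) ^ (N + 1))
    have e : κ * B * (5 / 7) ^ (N + 1) * (1 - 5 / 7 : ℝ)⁻¹ =
        κ * (7 / 2 * (B * (5 / 7) ^ (N + 1))) := by
      norm_num; ring
    rw [e] at h1
    refine h1.of_eq fun k => ?_
    rw [if_neg (by omega)]
    ring
  have hle := tsum_of_norm_bounded hgeo (f := fun k => M1Weight n p lam k * φ k) fun k => by
    split_ifs with hk
    · simp [hφ0 k hk]
    · rw [Real.norm_eq_abs, abs_mul]
      calc |M1Weight n p lam k| * |φ k| ≤ B / (7 / 5) ^ k * κ := by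
            gcongr
            · exact hco k
            · exact hφ k
        _ = κ * B * (5 / 7) ^ k := by
            rw [show (5 / 7 : ℝ) = (7 / 5)⁻¹ by norm_num, inv_pow]
            ring
  rw [Real.norm_eq_abs] at hle
  refine hle.trans ?_
  gcongr
  have hP0 : 0 < 1 + p * (2 / 5) := by positivity
  set l := Real.log (1 + p * (2 / 5)) with hl
  have hBe : B = Real.exp (n * l + lam * (2 / 5)) := by
    rw [hB, Real.exp_add, hl, ← Real.log_pow, Real.exp_log (by positivity)]
  have h57 : (5 / 7 : ℝ) ^ (N + 1) = Real.exp (-((N + 1) * Real.log (7 / 5))) := by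
    rw [show (5 / 7 : ℝ) = (7 / 5)⁻¹ by norm_num, inv_pow, Real.exp_neg]
    congr 1
    have : ((N : ℝ) + 1) * Real.log (7 / 5) = Real.log ((7 / 5) ^ (N + 1)) := by
      rw [Real.log_pow]; push_cast; ring
    rw [this, Real.exp_log (by positivity)]
  rw [hBe, h57, ← Real.exp_add]
  apply Real.exp_le_exp.2
  have hlog75 : 0 ≤ Real.log (7 / 5) := Real.log_nonneg (by norm_num)
  have hN : x * Real.log (7 / 5) ≤ (N + 1) * Real.log (7 / 5) := by gcongr
  have l1 : l ≤ p * (2 / 5) := by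
    have := Real.log_le_sub_one_of_pos hP0
    linarith
  have l2 : p * (2 / 5) - l ≤ (p * (2 / 5)) ^ 2 := by
    have h1 := Real.one_sub_inv_le_log_of_pos hP0
    have h2 : 1 - (1 + p * (2 / 5))⁻¹ = p * (2 / 5) / (1 + p * (2 / 5)) := by field_simp; ring
    have h3 : p * (2 / 5) - (p * (2 / 5)) ^ 2 ≤ p * (2 / 5) / (1 + p * (2 / 5)) := by
      rw [le_div_iff₀ hP0]
      nlinarith [pow_pos hp 3]
    linarith
  have l3 : l ≤ Real.log (7 / 5) - 2 / 7 * (1 - p) := by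
    have h1 := Real.log_le_sub_one_of_pos (x := (1 + p * (2 / 5)) / (7 / 5)) (by positivity)
    rw [Real.log_div hP0.ne' (by norm_num)] at h1
    linarith
  have hmain : n * l + lam * (2 / 5) = x * l + (x - n) * (p * (2 / 5) - l) := by
    rw [hlx]; ring
  have hcorr : (x - n) * (p * (2 / 5) - l) ≤ 2 / 25 * (1 - p) * x := by
    have hw0 : 0 ≤ p * (2 / 5) - l := by linarith
    rcases le_or_gt lam 0 with hl0 | hl0
    · have h1 : x - n ≤ 0 := by
        have : lam / p ≤ 0 := div_nonpos_of_nonpos_of_nonneg hl0 hp.le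
        linarith
      have h2 : (x - n) * (p * (2 / 5) - l) ≤ 0 := mul_nonpos_of_nonpos_of_nonneg h1 hw0
      have : 0 ≤ 2 / 25 * (1 - p) * x := by positivity
      linarith
    · have h1 : 0 ≤ x - n := by
        have : 0 ≤ lam / p := by positivity
        linarith
      rw [abs_of_pos hl0] at hlam
      have h4 : 2 * (p * (x - n)) ≤ (1 - p) * x := by rw [← hlx]; exact hlam
      have h5 : 0 ≤ (1 - p) * x := by positivity
      calc (x - n) * (p * (2 / 5) - l) ≤ (x - n) * (p * (2 / 5)) ^ 2 := by gcongr
        _ = 2 * (p * (x - n)) * (p * (2 / 25)) := by ring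
        _ ≤ (1 - p) * x * (p * (2 / 25)) := by gcongr
        _ ≤ (1 - p) * x * (1 * (2 / 25)) := by gcongr
        _ = _ := by ring
  have hx3 := mul_le_mul_of_nonneg_left l3 hx0
  rw [hmain]
  nlinarith [mul_nonneg hq.le hx0]

end GeneratingFunction

/-! ### Binomial approximation -/

section TruncatedChain

/-- The reversible law of a birth-death chain on `{0, …, N}`, normalized from the products of rates. -/
lemma exists_birthDeath_of_finite {a b : ℕ → ℝ} {N : ℕ} (ha : ∀ k < N, 0 < a k)
    (haN : ∀ k, N ≤ k → a k = 0) (hb0 : b 0 = 0) (hb : ∀ k, 0 < b (k + 1))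
    (hgrowth : ∀ j k, j ≤ k → a k - a j ≤ b k - b j) :
    ∃ ν, BirthDeath a b ν ∧ (∀ k ≤ N, 0 < ν k) ∧ ∀ k, N < k → ν k = 0 := by
  set w : ℕ → ℝ := fun k => ∏ i ∈ Finset.range k, a i / b (i + 1) with hw
  have hwpos : ∀ k ≤ N, 0 < w k := fun k hk => Finset.prod_pos fun i hi =>
    div_pos (ha i (by have := Finset.mem_range.1 hi; omega)) (hb i)
  have hwz : ∀ k, N < k → w k = 0 := fun k hk => by
    refine Finset.prod_eq_zero (Finset.mem_range.2 hk) ?_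
    rw [haN N le_rfl, zero_div]
  set Z := ∑ k ∈ Finset.range (N + 1), w k with hZ
  have hZpos : 0 < Z := Finset.sum_pos (fun k hk =>
    hwpos k (Nat.lt_succ_iff.1 (Finset.mem_range.1 hk))) ⟨0, by simp⟩
  have ha0 : ∀ k, 0 ≤ a k := fun k => by
    rcases lt_or_ge k N with h | h
    · exact (ha k h).le
    · exact (haN k h).ge
  have hpos : ∀ k ≤ N, 0 < w k / Z := fun k hk => div_pos (hwpos k hk) hZpos
  have hz : ∀ k, N < k → w k / Z = 0 := fun k hk => by rw [hwz k hk, zero_div]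
  refine ⟨fun k => w k / Z, ⟨fun k => ?_, ?_, ha0, hb0, hb, fun k => ?_, ?_, hgrowth⟩, hpos, hz⟩
  · rcases le_or_gt k N with h | h
    · exact (hpos k h).le
    · exact (hz k h).ge
  · have h : HasSum (fun k => w k / Z) (∑ k ∈ Finset.range (N + 1), w k / Z) :=
      hasSum_sum_of_ne_finset_zero fun k hk => hz k (by simpa using hk)
    rwa [← Finset.sum_div, ← hZ, div_self hZpos.ne'] at h
  · have : w (k + 1) = w k * (a k / b (k + 1)) := Finset.prod_range_succ _ _
    simp only [this]
    have := (hb k).ne'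
    field_simp
  · refine summable_of_ne_finset_zero (s := Finset.range (N + 1)) fun k hk => ?_
    rw [hz k (by simpa using hk), mul_zero]

end TruncatedChain

section BinomialPoisson

variable {d : ℕ} {J : Finset (Fin d → ℤ)} {Ω : Type*} [MeasurableSpace Ω] {μ : Measure Ω}
  [IsProbabilityMeasure μ] {X : J → Ω → ℕ} {m : ℕ}

lemma memLp_two_fieldSum (hX : ∀ i, Measurable (X i))
    (hint : ∀ i, Integrable (fun ω => (X i ω : ℝ) ^ 4) μ) :
    MemLp (fun ω => (fieldSum X ω : ℝ)) 2 μ := by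
  have h := memLp_finsetSum (μ := μ) (p := 2) Finset.univ fun i _ => memLp_two hX hint i
  refine h.congr_norm ((Measurable.of_discrete (f := fun n : ℕ => (n : ℝ))).comp
    (measurable_fieldSum hX)).aestronglyMeasurable (Filter.Eventually.of_forall fun ω => ?_)
  simp [fieldSum]

/-- The second factorial cumulant is `Var W - E W`. -/
lemma variance_fieldSum (hX : ∀ i, Measurable (X i))
    (hint : ∀ i, Integrable (fun ω => (X i ω : ℝ) ^ 4) μ) :
    ProbabilityTheory.variance (fun ω => (fieldSum X ω : ℝ)) μ =
      Gam2 μ (fieldSum X) + Gam1 μ (fieldSum X) := by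
  have h2 := memLp_two_fieldSum hX hint
  have hi := h2.integrable one_le_two
  rw [ProbabilityTheory.variance_eq_sub h2, Gam2, Gam1, factMoment_two, factMoment_one]
  have e : ∫ ω, (fieldSum X ω : ℝ) * ((fieldSum X ω : ℝ) - 1) ∂μ =
      ∫ ω, (fieldSum X ω : ℝ) ^ 2 ∂μ - ∫ ω, (fieldSum X ω : ℝ) ∂μ := by
    rw [← integral_sub h2.integrable_sq hi]
    exact integral_congr_ae (Filter.Eventually.of_forall fun ω => by ring)
  rw [e]
  simp only [Pi.pow_apply]
  ring

/-- Chebyshev's inequality for a bounded function of `W` supported far to the right of the mean. -/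
lemma abs_integral_le_of_tail (hX : ∀ i, Measurable (X i))
    (hint : ∀ i, Integrable (fun ω => (X i ω : ℝ) ^ 4) μ) {φ : ℕ → ℝ} {κ t : ℝ} (ht : 0 < t)
    (hφ : ∀ k, |φ k| ≤ κ) (hφ0 : ∀ k : ℕ, (k : ℝ) < Gam1 μ (fieldSum X) + t → φ k = 0) :
    |∫ ω, φ (fieldSum X ω) ∂μ| ≤
      κ * ((Gam2 μ (fieldSum X) + Gam1 μ (fieldSum X)) / t ^ 2) := by
  have hκ : 0 ≤ κ := (abs_nonneg _).trans (hφ 0)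
  set G := Gam1 μ (fieldSum X) with hG
  have h2 := memLp_two_fieldSum hX hint
  have hGi : G = ∫ ω, (fieldSum X ω : ℝ) ∂μ := by rw [hG, Gam1, factMoment_one]
  have hi : Integrable (fun ω => ((fieldSum X ω : ℝ) - G) ^ 2) μ :=
    (h2.sub (memLp_const G)).integrable_sq
  have hv : ∫ ω, ((fieldSum X ω : ℝ) - G) ^ 2 ∂μ = Gam2 μ (fieldSum X) + G := by
    rw [hG, ← variance_fieldSum hX hint, ProbabilityTheory.variance_eq_integral h2.aemeasurable,
      ← hG, hGi]
  have h3 : ∫ ω, κ / t ^ 2 * ((fieldSum X ω : ℝ) - G) ^ 2 ∂μ =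
      κ * ((Gam2 μ (fieldSum X) + G) / t ^ 2) := by
    rw [integral_const_mul, hv]; ring
  rw [← h3]
  rw [← Real.norm_eq_abs]
  refine norm_integral_le_of_norm_le (hi.const_mul _) (Filter.Eventually.of_forall fun ω => ?_)
  rw [Real.norm_eq_abs]
  rcases lt_or_ge (fieldSum X ω : ℝ) (G + t) with h | h
  · rw [hφ0 _ h, abs_zero]
    positivity
  · refine (hφ _).trans ?_
    rw [div_mul_eq_mul_div, le_div_iff₀ (by positivity)]
    gcongr
    linarith

/-- The birth-death chain with binomial type rates, stopped at `N`. -/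
lemma exists_birthDeath_binomial {N : ℕ} {p x : ℝ} (hp : 0 < p) (hp1 : p < 1) (hNx : N ≤ x) :
    ∃ ν, BirthDeath (fun k : ℕ => if k < N then p * (x - k) else 0) (fun k : ℕ => (1 - p) * k) ν ∧
      (∀ k ≤ N, 0 < ν k) ∧ ∀ k, N < k → ν k = 0 := by
  have hq : 0 < 1 - p := by linarith
  have hpos : ∀ k < N, 0 < p * (x - k) := fun k hk => by
    have : (k : ℝ) < N := by exact_mod_cast hk
    exact mul_pos hp (by linarith)
  refine exists_birthDeath_of_finite (N := N) (fun k hk => ?_) (fun k hk => ?_) (by simp)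
    (fun k => by positivity) fun j k hjk => ?_
  · rw [if_pos hk]; exact hpos k hk
  · rw [if_neg (by omega)]
  · have hc : (j : ℝ) ≤ k := by exact_mod_cast hjk
    have h0 : (1 - p) * (j : ℝ) ≤ (1 - p) * k := by gcongr
    by_cases hk : k < N
    · rw [if_pos hk, if_pos (by omega)]
      nlinarith
    · rw [if_neg hk]
      by_cases hj : j < N
      · rw [if_pos hj]; linarith [hpos j hj]
      · rw [if_neg hj]; linarith

/-- The Stein equation of the stopped chain: up to an error `φ` supported beyond `N`, every `f` with
values in `[0, 1]` is a constant plus the image of the operator that annihilates the target measure. -/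
lemma exists_binomial_stein_solution {N : ℕ} {p x A η : ℝ} (hp : 0 < p) (hp1 : p < 1) (hN : N ≤ x)
    (hA : A = N * p * (1 - p)) (hη : 2 * |η| < A) {f : ℕ → ℝ} (hf : ∀ i j, f i - f j ≤ 1) :
    ∃ (g φ : ℕ → ℝ) (c : ℝ),
      (∀ k, f k = c + ((p * x + -p * k) * g (k + 1) - (1 - p) * k * g k
        + η * (g (k + 1 + 1) - g (k + 1))) + φ k) ∧
      (∀ k, |g (k + 1 + 1) - g (k + 1)| ≤ 1 / (A - 2 * |η|)) ∧
      (∀ k ≤ N, φ k = 0) ∧ (∀ k, |φ k| ≤ 2 * A / (A - 2 * |η|)) ∧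
      ∀ k, |f k - c| ≤ 2 * A / (A - 2 * |η|) := by
  have hq : 0 < 1 - p := by linarith
  have hA0 : 0 < A := lt_of_le_of_lt (by positivity) hη
  have hN0 : (0 : ℝ) ≤ N := Nat.cast_nonneg _
  obtain ⟨ν, hB, hνpos, hν0⟩ := exists_birthDeath_binomial hp hp1 hN
  obtain ⟨g, c, hgc, hgd, hfc, hgz⟩ := hB.exists_perturbed_solution (f := f) hf hA0
    (fun k hk => by
      have hkN : k + 1 ≤ N := by
        by_contra h
        exact hk.ne' (hν0 _ (by omega))
      rcases hkN.lt_or_eq with h | h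
      · rw [if_pos h, hA]
        -- the mean of the two rates with weights `q` and `p` is at least `N p q`
        by_contra hcon
        rw [not_le, max_lt_iff] at hcon
        nlinarith [hcon.1, hcon.2, mul_lt_mul_of_pos_left hcon.1 hq,
          mul_lt_mul_of_pos_left hcon.2 hp, mul_le_mul_of_nonneg_left hN (mul_pos hp hq).le]
      · refine le_max_of_le_right ?_
        rw [h, hA]
        nlinarith [mul_nonneg hN0 hq.le]) hη
  refine ⟨g, fun k => if k ≤ N then 0 else f k - c, c, fun k => ?_, hgd, fun k hk => if_pos hk,
    fun k => ?_, hfc⟩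
  · beta_reduce
    rcases le_or_gt k N with h | h
    · have e := hgc k (hνpos k h)
      rw [if_pos h]
      rcases h.lt_or_eq with h | h
      · simp only [if_pos h] at e
        linear_combination -e
      · have e0 : g (k + 1) = 0 := hgz _ (hν0 _ (by omega))
        simp only [e0] at e
        rw [e0]
        linear_combination -e
    · rw [if_neg h.not_ge, hgz _ (hν0 k h), hgz _ (hν0 (k + 1) (by omega)),
        hgz _ (hν0 (k + 1 + 1) (by omega))]
      ring
  · beta_reduce
    split_ifs
    · rw [abs_zero]
      exact (abs_nonneg _).trans (hfc 0)
    · exact hfc k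

lemma div_sq_le_of_le {p G v : ℝ} (hp : 0 < p) (hp1 : p < 1) (hG : 0 < G)
    (hv : v ≤ 3 / 2 * ((1 - p) * G)) : v / (G * (1 - p) / p) ^ 2 ≤ 3 / 2 / ((1 - p) * G) := by
  have hq : 0 < 1 - p := by linarith
  rw [div_le_div_iff₀ (by positivity) (by positivity)]
  have e : 3 / 2 * (G * (1 - p) / p) ^ 2 = 3 / 2 * ((1 - p) * G) * ((1 - p) * G) / p ^ 2 := by ring
  rw [e, le_div_iff₀ (by positivity)]
  have hp2 : p ^ 2 ≤ 1 := pow_le_one₀ hp.le hp1.le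
  calc v * ((1 - p) * G) * p ^ 2 ≤ 3 / 2 * ((1 - p) * G) * ((1 - p) * G) * p ^ 2 := by gcongr
    _ ≤ 3 / 2 * ((1 - p) * G) * ((1 - p) * G) * 1 := by gcongr
    _ = _ := mul_one _

lemma exp_neg_le_div {q G x : ℝ} (hq : 0 < q) (hG : 0 < G) (hGx : G ≤ x) :
    7 / 2 * Real.exp (-(q * x / 5)) ≤ 35 / 2 / (q * G) := by
  have hx : 0 < x := hG.trans_le hGx
  have hy : 0 < q * x / 5 := by positivity
  have e1 : Real.exp (-(q * x / 5)) ≤ (q * x / 5)⁻¹ := by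
    rw [Real.exp_neg]
    refine inv_anti₀ hy ?_
    linarith [Real.add_one_le_exp (q * x / 5)]
  calc 7 / 2 * Real.exp (-(q * x / 5)) ≤ 7 / 2 * (q * x / 5)⁻¹ := by gcongr
    _ = 35 / 2 / (q * x) := by field_simp; norm_num
    _ ≤ _ := by gcongr

/-- Approximation by a binomial convolved with a signed Poisson measure. The chain is stopped at
`N = ⌊n + lam / p⌋`, beyond which the masses of both measures are of order `1 / (q E W)`. Replacing
`n + δ` by the integer `n` leaves the first order term `δ p² E Δg(W + 1)`, which accounts for the summand
`1` beside the expansion errors. -/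
lemma dTV_M1_le (hX : ∀ i, Measurable (X i))
    (hint : ∀ i, Integrable (fun ω => (X i ω : ℝ) ^ 4) μ) (hdep : IsMDependent m X μ)
    {n N : ℕ} {p lam δ A : ℝ} (hp : 0 < p) (hp1 : p < 1) (hδ0 : 0 ≤ δ) (hδ1 : δ < 1)
    (hN : (N : ℝ) ≤ n + lam / p) (hN1 : n + lam / p ≤ N + 1)
    (hA : A = N * p * (1 - p)) (hlam : 2 * (|lam| * p) < A)
    (h1 : n * p + lam = Gam1 μ (fieldSum X))
    (h2 : -((n + δ) * p ^ 2) = Gam2 μ (fieldSum X))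
    (h3 : (n + δ) * p ^ 3 = Gam3 μ (fieldSum X)) :
    dTV μ (fieldSum X) (M1Weight n p lam) ≤ 9 / 2 * (2 * A / (A - 2 * (|lam| * p))) ∧
    dTV μ (fieldSum X) (M1Weight n p lam) ≤ 1 / (A - 2 * (|lam| * p)) *
      (totalErrorThree μ X m + totalErrorTwo μ X m + 1) +
      19 * (2 * A / (A - 2 * (|lam| * p))) / ((1 - p) * Gam1 μ (fieldSum X)) := by
  have hq : 0 < 1 - p := by linarith
  have hApos : 0 < A := lt_of_le_of_lt (by positivity) hlam
  have hWm := measurable_fieldSum hX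
  have hη : |lam * p| = |lam| * p := by rw [abs_mul, abs_of_pos hp]
  set x := n + lam / p with hx
  have hpx : p * x = Gam1 μ (fieldSum X) := by rw [← h1, hx]; field_simp
  have hN0 : (0 : ℝ) < N := by
    rcases (Nat.cast_nonneg (α := ℝ) N).eq_or_lt with h | h
    · rw [← h] at hA; simp only [zero_mul] at hA; linarith
    · exact h
  have hx0 : 0 < x := hN0.trans_le hN
  have hlamq : 2 * |lam| ≤ (1 - p) * x := by
    have e : 2 * |lam| * p < N * (1 - p) * p := by rw [hA] at hlam; linarith
    have := lt_of_mul_lt_mul_right e hp.le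
    nlinarith
  set G := Gam1 μ (fieldSum X) with hG
  have hG0 : 0 < G := by rw [← hpx]; positivity
  have hGx : G ≤ x := by rw [← hpx]; nlinarith
  -- the variance is comparable with `q G`
  have hvar : Gam2 μ (fieldSum X) + G ≤ 3 / 2 * ((1 - p) * G) := by
    have e1 : p * lam ≤ p * |lam| := by gcongr; exact le_abs_self lam
    have e2 : p * (2 * |lam|) ≤ (1 - p) * G := by rw [← hpx]; nlinarith
    have e3 : 0 ≤ δ * p ^ 2 := by positivity
    rw [← h2]
    have e4 : lam = G - n * p := by linarith
    nlinarith
  rw [← hη] at hlam ⊢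
  set κ := 2 * A / (A - 2 * |lam * p|) with hκ
  have hden : 0 < A - 2 * |lam * p| := by linarith
  have hκ0 : 0 < κ := by rw [hκ]; positivity
  have key : ∀ f : ℕ → ℝ, (∀ i, 0 ≤ f i) → (∀ i, f i ≤ 1) →
      |∫ ω, f (fieldSum X ω) ∂μ - ∑' k, M1Weight n p lam k * f k| ≤ 9 / 2 * κ ∧
      |∫ ω, f (fieldSum X ω) ∂μ - ∑' k, M1Weight n p lam k * f k| ≤
        1 / (A - 2 * |lam * p|) * (totalErrorThree μ X m + totalErrorTwo μ X m + 1) +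
        19 * κ / ((1 - p) * G) := by
    intro f hf0 hf1
    obtain ⟨g, φ, c, hdec, hgd, hφ0, hφκ, hfc⟩ := exists_binomial_stein_solution hp hp1 hN hA hlam
      (f := f) fun i j => by linarith [hf0 j, hf1 i]
    rw [hpx] at hdec
    set L : ℕ → ℝ := fun k => (G + -p * k) * g (k + 1) - (1 - p) * k * g k
      + lam * p * (g (k + 1 + 1) - g (k + 1)) with hL
    have hLb : ∀ k, |L k| ≤ κ + κ := fun k => by
      have e : L k = (f k - c) - φ k := by simp only [hL]; linarith [hdec k]
      rw [e]
      exact (abs_sub _ _).trans (add_le_add (hfc k) (hφκ k))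
    -- the target measure
    have hb2 := hasSecondMoment_binomialWeight n p
    have hM0 := hasSum_conv_poisson_zero (lam := lam) hb2 (binomialWeight_succ n p)
      (abs_le_of_diff_le hgd)
    have hM1 := hasSum_convWeight_one (hasSum_binomialWeight n p) (hasSum_poissonWeight lam) hb2
      (hasSecondMoment_poissonWeight lam)
    rw [one_mul] at hM1
    have hMφ : Summable fun k => M1Weight n p lam k * φ k := by
      refine Summable.of_norm_bounded
        ((summable_abs_convWeight hb2 (hasSecondMoment_poissonWeight lam)).mul_right κ) fun k => ?_
      rw [Real.norm_eq_abs, abs_mul]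
      exact mul_le_mul_of_nonneg_left (hφκ k) (abs_nonneg _)
    have hMf : ∑' k, M1Weight n p lam k * f k = c + ∑' k, M1Weight n p lam k * φ k := by
      have h4 := (hM0.add (hM1.mul_right c)).add hMφ.hasSum
      rw [zero_add, one_mul] at h4
      refine (h4.of_eq fun k => ?_).tsum_eq
      rw [hdec k]
      simp only [M1Weight, ← h1]
      ring
    have hMt := abs_tsum_M1Weight_mul_le hp hp1 hx0.le hx hN1 hlamq hφ0 hφκ
    -- the law of `W`
    have hLi : Integrable (fun ω => L (fieldSum X ω)) μ := integrable_comp_of_bounded hWm hLb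
    have hφi : Integrable (fun ω => φ (fieldSum X ω)) μ := integrable_comp_of_bounded hWm hφκ
    have hWf : ∫ ω, f (fieldSum X ω) ∂μ =
        c + ∫ ω, L (fieldSum X ω) ∂μ + ∫ ω, φ (fieldSum X ω) ∂μ := by
      have e : ∀ ω, f (fieldSum X ω) = c + L (fieldSum X ω) + φ (fieldSum X ω) := fun ω => hdec _
      have hcL : Integrable (fun ω => c + L (fieldSum X ω)) μ := (integrable_const c).add hLi
      simp only [e]
      rw [integral_add hcL hφi, integral_add (integrable_const c) hLi]
      simp
    have hfi : Integrable (fun ω => f (fieldSum X ω)) μ :=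
      integrable_comp_of_bounded hWm (C := 1) fun k => by rw [abs_of_nonneg (hf0 k)]; exact hf1 k
    rw [hMf]
    constructor
    · have hE : ∫ ω, f (fieldSum X ω) ∂μ - c = ∫ ω, (f (fieldSum X ω) - c) ∂μ := by
        rw [integral_sub hfi (integrable_const _)]
        simp
      have h5 : |∫ ω, (f (fieldSum X ω) - c) ∂μ| ≤ κ := abs_integral_le_of_bounded fun ω => hfc _
      have h6 : κ * (7 / 2 * Real.exp (-((1 - p) * x / 5))) ≤ κ * (7 / 2 * 1) := by
        gcongr
        rw [Real.exp_le_one_iff]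
        have : 0 ≤ (1 - p) * x / 5 := by positivity
        linarith
      rw [← sub_sub, hE]
      refine (abs_sub _ _).trans ?_
      linarith
    · have h5 := abs_integral_operator_le hX hint hdep hgd (A := G) (v := -p) (w := 1 - p)
        (η := lam * p) (by ring) (by rw [← h2, ← h3]; ring)
        (by rw [abs_neg, abs_of_pos hp]; exact hp1.le)
        (by rw [show -p - (1 - p) = -1 by ring, abs_neg, abs_one])
      have h6 : (-p - (1 - p)) * Gam2 μ (fieldSum X) + -p * G + lam * p = δ * p ^ 2 := by
        linear_combination p * h1 + h2
      have h7 : |δ * p ^ 2| ≤ 1 := by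
        rw [abs_of_nonneg (by positivity)]
        have : p ^ 2 ≤ 1 := pow_le_one₀ hp.le hp1.le
        nlinarith
      have h8 : |∫ ω, L (fieldSum X ω) ∂μ| ≤
          1 / (A - 2 * |lam * p|) * (totalErrorThree μ X m + totalErrorTwo μ X m + 1) := by
        refine h5.trans ?_
        rw [h6]
        gcongr
      have h9 : |∫ ω, φ (fieldSum X ω) ∂μ| ≤ κ * (3 / 2) / ((1 - p) * G) := by
        have ht : 0 < G * (1 - p) / p := by positivity
        refine (abs_integral_le_of_tail hX hint ht hφκ fun k hk => hφ0 k ?_).trans ?_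
        · have e : G + G * (1 - p) / p = x := by rw [← hpx]; field_simp; ring
          rw [← hG, e] at hk
          have : (k : ℝ) < (N + 1 : ℕ) := by push_cast; linarith
          have : k < N + 1 := by exact_mod_cast this
          omega
        · rw [mul_div_assoc κ]
          exact mul_le_mul_of_nonneg_left (div_sq_le_of_le hp hp1 hG0 hvar) hκ0.le
      have h10 : κ * (7 / 2 * Real.exp (-((1 - p) * x / 5))) ≤ κ * (35 / 2) / ((1 - p) * G) := by
        rw [mul_div_assoc κ]
        exact mul_le_mul_of_nonneg_left (exp_neg_le_div hq hG0 hGx) hκ0.le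
      have hsum : κ * (3 / 2) / ((1 - p) * G) + κ * (35 / 2) / ((1 - p) * G) =
          19 * κ / ((1 - p) * G) := by ring
      have e : ∫ ω, f (fieldSum X ω) ∂μ - (c + ∑' k, M1Weight n p lam k * φ k) =
          ∫ ω, L (fieldSum X ω) ∂μ + ∫ ω, φ (fieldSum X ω) ∂μ -
            ∑' k, M1Weight n p lam k * φ k := by rw [hWf]; ring
      rw [e]
      refine (abs_sub _ _).trans ((add_le_add_left (abs_add_le _ _) _).trans ?_)
      linarith
  exact ⟨dTV_le_of_forall hWm fun f h0 h1 => (key f h0 h1).1,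
    dTV_le_of_forall hWm fun f h0 h1 => (key f h0 h1).2⟩

end BinomialPoisson

/-! ### Bounds in terms of the cumulants -/

section Approximation

variable {d : ℕ} {J : Finset (Fin d → ℤ)} {Ω : Type*} [MeasurableSpace Ω] {μ : Measure Ω}
  [IsProbabilityMeasure μ] {X : J → Ω → ℕ} {m : ℕ}

/-- The negative binomial bound with `m^{3d} |J| S` in place of the errors. If the mean is at most
this term, the trivial bound of order `1 / (1 - 2 θ₂)` suffices. -/
lemma dTV_M2_le_smoothness (hX : ∀ i, Measurable (X i))
    (hint : ∀ i, Integrable (fun ω => (X i ω : ℝ) ^ 4) μ) (hdep : IsMDependent m X μ)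
    (hm : 1 ≤ m) {r p lam : ℝ}
    (hM : MatchM2 (Gam1 μ (fieldSum X)) (Gam2 μ (fieldSum X)) (Gam3 μ (fieldSum X)) r p lam)
    (hH : H2 r p lam) :
    0 < 1 - 2 * theta2 r p lam ∧ 0 < Gam1 μ (fieldSum X) ∧
    dTV μ (fieldSum X) (M2Weight r p lam) ≤
      2 * (72 * 4913 ^ d * ((m : ℝ) ^ (3 * d) * J.card * supFourthSmooth m X μ)) /
        ((1 - 2 * theta2 r p lam) * (p * Gam1 μ (fieldSum X))) := by
  obtain ⟨-, hp, hp1, h1, h2, h3⟩ := hM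
  have hq : 0 < 1 - p := by linarith
  unfold H2 at hH
  obtain ⟨A, hA⟩ : ∃ A, A = r * (1 - p) + lam * p := ⟨_, rfl⟩
  have hlam : 2 * (|lam| * (1 - p)) < A := by rw [hA]; linarith
  have hA0 : 0 < A := lt_of_le_of_lt (by positivity) hlam
  obtain ⟨ha, hb⟩ := dTV_M2_le hX hint hdep hp hp1 hA hlam h1 h2 h3
  have hAG : A = p * Gam1 μ (fieldSum X) := by rw [hA, ← h1]; field_simp
  set G := Gam1 μ (fieldSum X) with hG
  have hG0 : 0 < G := by rw [hAG] at hA0; exact pos_of_mul_pos_right hA0 hp.le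
  set T := 1 - 2 * theta2 r p lam with hT
  have hTA : A - 2 * (|lam| * (1 - p)) = A * T := by
    rw [hT, theta2, ← hA]; field_simp
  have hT0 : 0 < T := by
    have : 0 < A * T := by rw [← hTA]; linarith
    exact pos_of_mul_pos_right this hA0.le
  refine ⟨hT0, hG0, ?_⟩
  rw [hTA] at ha hb
  set V := 72 * 4913 ^ d * ((m : ℝ) ^ (3 * d) * J.card * supFourthSmooth m X μ) with hV
  rcases errors_dichotomy hX hint hdep hm with h | ⟨h3, h2, -⟩
  · refine ha.trans ?_
    have hAV : A ≤ V := by rw [hAG]; nlinarith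
    rw [← hAG, mul_comm A T]
    gcongr
  · refine hb.trans ?_
    rw [← hAG, mul_comm T A, div_mul_eq_mul_div, one_mul]
    gcongr
    linarith

/-- The binomial bound with `m^{3d} |J| S` in place of the errors. The tails and the effect of the
fractional part `δ` are of order `1 / (q E W)`, and are absorbed because `m^{3d} |J| S` is bounded below. -/
lemma dTV_M1_le_smoothness (hX : ∀ i, Measurable (X i))
    (hint : ∀ i, Integrable (fun ω => (X i ω : ℝ) ^ 4) μ) (hdep : IsMDependent m X μ)
    (hm : 1 ≤ m) {n : ℕ} {p lam : ℝ}
    (hM : MatchM1 (Gam1 μ (fieldSum X)) (Gam2 μ (fieldSum X)) (Gam3 μ (fieldSum X)) n p lam)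
    (hH : H1 n p lam) :
    0 < 1 - 2 * theta1 n p lam ∧ 0 < Gam1 μ (fieldSum X) ∧
    dTV μ (fieldSum X) (M1Weight n p lam) ≤
      44 * (72 * 4913 ^ d * ((m : ℝ) ^ (3 * d) * J.card * supFourthSmooth m X μ)) /
        ((1 - 2 * theta1 n p lam) * ((1 - p) * Gam1 μ (fieldSum X))) := by
  obtain ⟨hp, hp1, δ, hδ0, hδ1, h1, h2, h3⟩ := hM
  have hq : 0 < 1 - p := by linarith
  unfold H1 at hH
  have hfl : 0 < ⌊(n : ℝ) + lam / p⌋ := by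
    have h0 : 0 ≤ |lam| * p / (1 - p) := by positivity
    have h4 : 0 < p / 2 * (⌊(n : ℝ) + lam / p⌋ : ℝ) := h0.trans_lt hH
    exact_mod_cast pos_of_mul_pos_right h4 (by positivity)
  obtain ⟨N, hN⟩ := Int.eq_ofNat_of_zero_le hfl.le
  have hNR : ((⌊(n : ℝ) + lam / p⌋ : ℤ) : ℝ) = N := by rw [hN]; simp
  have hN1 : (1 : ℝ) ≤ N := by
    have : 1 ≤ N := by omega
    exact_mod_cast this
  have hNx : (N : ℝ) ≤ n + lam / p := by rw [← hNR]; exact Int.floor_le _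
  have hxN : n + lam / p ≤ N + 1 := by rw [← hNR]; exact (Int.lt_floor_add_one _).le
  rw [hNR] at hH
  obtain ⟨A, hA⟩ : ∃ A, A = N * p * (1 - p) := ⟨_, rfl⟩
  have hA0 : 0 < A := by rw [hA]; positivity
  have hlam : 2 * (|lam| * p) < A := by
    rw [div_lt_iff₀ hq] at hH
    rw [hA]; linarith
  obtain ⟨ha, hb⟩ := dTV_M1_le hX hint hdep hp hp1 hδ0 hδ1 hNx hxN hA hlam h1 h2 h3
  have hpx : p * (n + lam / p) = Gam1 μ (fieldSum X) := by rw [← h1]; field_simp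
  set G := Gam1 μ (fieldSum X) with hG
  have hG0 : 0 < G := by
    rw [← hpx]; exact mul_pos hp (by linarith)
  set T := 1 - 2 * theta1 n p lam with hT
  have hTA : A - 2 * (|lam| * p) = A * T := by
    rw [hT, theta1, hNR, hA]; field_simp
  have hT0 : 0 < T := by
    have : 0 < A * T := by rw [← hTA]; linarith
    exact pos_of_mul_pos_right this hA0.le
  refine ⟨hT0, hG0, ?_⟩
  have hκ : 2 * A / (A * T) = 2 / T := by field_simp
  rw [hTA, hκ] at ha hb
  set V := 72 * 4913 ^ d * ((m : ℝ) ^ (3 * d) * J.card * supFourthSmooth m X μ) with hV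
  -- the floor costs at most a factor two
  have hAq : (1 - p) * G / 2 ≤ A := by
    have h5 : n + lam / p ≤ 2 * N := by linarith
    rw [← hpx, hA]
    nlinarith [mul_le_mul_of_nonneg_left h5 (mul_pos hp hq).le]
  have hqG : 0 < (1 - p) * G := by positivity
  rcases errors_dichotomy hX hint hdep hm with h | ⟨h3, h2, h1'⟩
  · refine ha.trans ?_
    have hV0 : 0 < V := hG0.trans_le h
    have h6 : (1 - p) * G ≤ V := by nlinarith
    calc 9 / 2 * (2 / T) = 9 * 1 / T := by ring
      _ ≤ 9 * (V / ((1 - p) * G)) / T := by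
        gcongr
        exact (one_le_div hqG).2 h6
      _ = 9 * V / (T * ((1 - p) * G)) := by field_simp
      _ ≤ _ := by gcongr; norm_num
  · refine hb.trans ?_
    have hV0 : 0 < V := one_pos.trans_le h1'
    calc 1 / (A * T) * (totalErrorThree μ X m + totalErrorTwo μ X m + 1) +
          19 * (2 / T) / ((1 - p) * G)
        ≤ 1 / ((1 - p) * G / 2 * T) * (V + V + V) + 19 * (2 / T) / ((1 - p) * G) * V := by
          have h7 : 0 ≤ 19 * (2 / T) / ((1 - p) * G) := by positivity
          refine add_le_add ?_ (le_mul_of_one_le_right h7 h1')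
          have h8 : totalErrorThree μ X m + totalErrorTwo μ X m + 1 ≤ V + V + V := by linarith
          refine (mul_le_mul_of_nonneg_left h8 (by positivity)).trans ?_
          gcongr
      _ = _ := by field_simp; ring

/-- Rearranges the bounds when `n / G` and `1 / q` are bounded. -/
lemma bound_of_comparable {a c M n s G q T K L : ℝ} (ha : 0 ≤ a) (hc : 0 ≤ c) (hM : 0 ≤ M)
    (hn : 0 ≤ n) (hs : 0 ≤ s) (hG : 0 < G) (hq : 0 < q) (hT : 0 < T) (hK : n / G ≤ K)
    (hL : 1 / q ≤ L) :
    a * (c * (M * n * s)) / (T * (q * G)) ≤ a * c * (K * L) * M / T * s := by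
  have h0 : 0 ≤ K := le_trans (by positivity) hK
  have e : a * (c * (M * n * s)) / (T * (q * G)) = a * c * (n / G * (1 / q)) * M / T * s := by
    field_simp
  rw [e]
  gcongr

/-- The matching equations determine `p`: since `Γ₃ / Γ₂ = (1 - p) / p`, `p (Γ₂ + Γ₃) = Γ₂`. -/
lemma MatchM2.pos {G₁ G₂ G₃ r p lam : ℝ} (h : MatchM2 G₁ G₂ G₃ r p lam) :
    0 < p ∧ 0 < G₂ ∧ p * (G₂ + G₃) = G₂ := by
  obtain ⟨hr, hp, hp1, -, h2, h3⟩ := h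
  have hq : 0 < 1 - p := by linarith
  refine ⟨hp, by rw [← h2]; positivity, ?_⟩
  rw [← h2, ← h3]; field_simp; ring

/-- The matching equations determine `p`: since `Γ₃ / Γ₂ = -p`, `Γ₂ + Γ₃ = (1 - p) Γ₂`. -/
lemma MatchM1.neg {G₁ G₂ G₃ p lam : ℝ} {n : ℕ} (h : MatchM1 G₁ G₂ G₃ n p lam) (hneg : G₂ < 0) :
    0 < 1 - p ∧ |G₂ + G₃| = (1 - p) * |G₂| ∧ G₂ + G₃ < 0 := by
  obtain ⟨hp, hp1, δ, -, -, -, h2, h3⟩ := h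
  have e : G₂ + G₃ = (1 - p) * G₂ := by rw [← h2, ← h3]; ring
  have hq : 0 < 1 - p := by linarith
  exact ⟨hq, by rw [e, abs_mul, abs_of_pos hq], by rw [e]; exact mul_neg_of_pos_of_neg hq hneg⟩

lemma gam2_neg (hX : ∀ i, Measurable (X i)) (hint : ∀ i, Integrable (fun ω => (X i ω : ℝ) ^ 4) μ)
    (hvar : ProbabilityTheory.variance (fun ω => (fieldSum X ω : ℝ)) μ
      < ∫ ω, (fieldSum X ω : ℝ) ∂μ) : Gam2 μ (fieldSum X) < 0 := by
  rw [variance_fieldSum hX hint, ← factMoment_one] at hvar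
  have : Gam1 μ (fieldSum X) = factMoment μ (fieldSum X) 1 := rfl
  linarith

/-- By `MatchM2.pos`, `1 / p = (Γ₂ + Γ₃) / Γ₂` for the negative binomial parameter `p`, which is at most
`2 (Γ₂ ∨ Γ₃) / Γ₂`. -/
lemma bound_M2_general {G₁ G₂ G₃ p T c M n s : ℝ} (hp : 0 < p) (hG1 : 0 < G₁) (hG2 : 0 < G₂)
    (hpG : p * (G₂ + G₃) = G₂) (hT : 0 < T) (hc : 0 ≤ c) (hM : 0 ≤ M) (hn : 0 ≤ n) (hs : 0 ≤ s) :
    2 * (c * (M * n * s)) / (T * (p * G₁)) ≤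
      44 * c * M * n * max G₂ G₃ / (T * G₁ * G₂) * s := by
  have hmax : 1 / p ≤ 2 * (max G₂ G₃ / G₂) := by
    have : 1 / p = (G₂ + G₃) / G₂ := by
      rw [div_eq_div_iff hp.ne' hG2.ne']; linarith
    rw [this, ← mul_div_assoc]
    gcongr
    linarith [le_max_left G₂ G₃, le_max_right G₂ G₃]
  have hmax0 : 0 < max G₂ G₃ := lt_max_of_lt_left hG2
  clear hpG
  calc 2 * (c * (M * n * s)) / (T * (p * G₁)) = 2 * (c * (M * n * s)) / (T * G₁) * (1 / p) := by
        field_simp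
    _ ≤ 2 * (c * (M * n * s)) / (T * G₁) * (2 * (max G₂ G₃ / G₂)) := by gcongr
    _ = 4 * c * M * n * max G₂ G₃ / (T * G₁ * G₂) * s := by field_simp; ring
    _ ≤ _ := by gcongr; norm_num

/-- By `MatchM1.neg`, `1 / (1 - p) = |Γ₂| / |Γ₂ + Γ₃|` for the binomial parameter `p`. The term with
`Γ₃²` is nonnegative, since `Γ₂` and `Γ₂ + Γ₃` have the same sign. -/
lemma bound_M1_general {G₁ G₂ G₃ q T c M n s : ℝ} (hq : 0 < q) (hG1 : 0 < G₁) (hG2 : G₂ < 0)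
    (hqG : |G₂ + G₃| = q * |G₂|) (hsum : G₂ + G₃ < 0) (hT : 0 < T) (hc : 0 ≤ c) (hM : 0 ≤ M)
    (hn : 0 ≤ n) (hs : 0 ≤ s) :
    44 * (c * (M * n * s)) / (T * (q * G₁)) ≤
      44 * c * M * n * max |G₂| |G₃| / (T * G₁ * |G₂ + G₃|) * s +
        G₃ ^ 2 / (T * G₁ * G₂ * (G₂ + G₃)) := by
  have h2 : 0 ≤ G₃ ^ 2 / (T * G₁ * G₂ * (G₂ + G₃)) := by
    have : 0 < G₂ * (G₂ + G₃) := mul_pos_of_neg_of_neg hG2 hsum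
    have h3 : 0 < T * G₁ * G₂ * (G₂ + G₃) := by rw [mul_assoc (T * G₁)]; positivity
    positivity
  refine le_trans ?_ (le_add_of_nonneg_right h2)
  have hG2' : 0 < |G₂| := abs_pos.2 hG2.ne
  rw [hqG]
  clear hqG h2
  calc 44 * (c * (M * n * s)) / (T * (q * G₁))
      = 44 * c * M * n * |G₂| / (T * G₁ * (q * |G₂|)) * s := by field_simp
    _ ≤ _ := by gcongr; exact le_max_left _ _

lemma one_div_le_of_comparable_M2 {G₂ G₃ p n K : ℝ} (hK : 0 < K) (hp : 0 < p) (hG2 : 0 < G₂)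
    (hpG : p * (G₂ + G₃) = G₂) (h2 : |G₂| ≤ K * n) (h3 : |G₃| ≤ K * n) (hn : n ≤ K * |G₂|) :
    1 / p ≤ 2 * K ^ 2 := by
  rw [abs_of_pos hG2] at hn h2
  rw [div_le_iff₀ hp]
  have h4 : G₃ ≤ K * n := (le_abs_self _).trans h3
  refine le_of_mul_le_mul_right ?_ hG2
  calc 1 * G₂ = p * (G₂ + G₃) := by rw [one_mul, hpG]
    _ ≤ p * (2 * K * n) := by gcongr; linarith
    _ ≤ p * (2 * K * (K * G₂)) := by gcongr
    _ = _ := by ring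

lemma one_div_le_of_comparable_M1 {G₂ G₃ q n K : ℝ} (hK : 0 < K) (hq : 0 < q) (hG2 : G₂ < 0)
    (hqG : |G₂ + G₃| = q * |G₂|) (h2 : |G₂| ≤ K * n) (hn : n ≤ K * |G₂ + G₃|) :
    1 / q ≤ K ^ 2 := by
  rw [div_le_iff₀ hq]
  rw [hqG] at hn
  refine le_of_mul_le_mul_right ?_ (abs_pos.2 hG2.ne)
  calc 1 * |G₂| ≤ K * n := by rw [one_mul]; exact h2
    _ ≤ K * (K * (q * |G₂|)) := by gcongr
    _ = _ := by ring

end Approximation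

theorem theorem2 (d : ℕ) (hd : 1 ≤ d) :
    -- the general bounds, with a constant depending only on the dimension
    (∃ C : ℝ, 0 < C ∧
      ∀ (m : ℕ), 1 ≤ m → ∀ (J : Finset (Fin d → ℤ))
        (Ω : Type u) [MeasurableSpace Ω] (μ : Measure Ω) [IsProbabilityMeasure μ]
        (X : J → Ω → ℕ), (∀ i, Measurable (X i)) →
        (∀ i, Integrable (fun ω => (X i ω : ℝ) ^ 4) μ) → IsMDependent m X μ →
        ∀ (G₁ G₂ G₃ : ℝ), G₁ = Gam1 μ (fieldSum X) → G₂ = Gam2 μ (fieldSum X) →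
          G₃ = Gam3 μ (fieldSum X) →
        (∫ ω, (fieldSum X ω : ℝ) ∂μ
              < ProbabilityTheory.variance (fun ω => (fieldSum X ω : ℝ)) μ →
          ∀ r pbar lam : ℝ, MatchM2 G₁ G₂ G₃ r pbar lam → H2 r pbar lam →
            dTV μ (fieldSum X) (M2Weight r pbar lam) ≤
              C * (m : ℝ) ^ (3 * d) * (J.card : ℝ) * max G₂ G₃
                / ((1 - 2 * theta2 r pbar lam) * G₁ * G₂) * supFourthSmooth m X μ) ∧
        (ProbabilityTheory.variance (fun ω => (fieldSum X ω : ℝ)) μ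
              < ∫ ω, (fieldSum X ω : ℝ) ∂μ →
          ∀ (n : ℕ) (p lam : ℝ), MatchM1 G₁ G₂ G₃ n p lam → H1 n p lam →
            dTV μ (fieldSum X) (M1Weight n p lam) ≤
              C * (m : ℝ) ^ (3 * d) * (J.card : ℝ) * max |G₂| |G₃|
                / ((1 - 2 * theta1 n p lam) * G₁ * |G₂ + G₃|) * supFourthSmooth m X μ
              + G₃ ^ 2 / ((1 - 2 * theta1 n p lam) * G₁ * G₂ * (G₂ + G₃)))) ∧
    -- the bounds when the cumulants are of order `|J|`, with implied constant `K`
    (∀ K : ℝ, 0 < K → ∃ C : ℝ, 0 < C ∧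
      ∀ (m : ℕ), 1 ≤ m → ∀ (J : Finset (Fin d → ℤ))
        (Ω : Type u) [MeasurableSpace Ω] (μ : Measure Ω) [IsProbabilityMeasure μ]
        (X : J → Ω → ℕ), (∀ i, Measurable (X i)) →
        (∀ i, Integrable (fun ω => (X i ω : ℝ) ^ 4) μ) → IsMDependent m X μ →
        ∀ (G₁ G₂ G₃ : ℝ), G₁ = Gam1 μ (fieldSum X) → G₂ = Gam2 μ (fieldSum X) →
          G₃ = Gam3 μ (fieldSum X) →
        |G₁| ≤ K * (J.card : ℝ) → |G₂| ≤ K * (J.card : ℝ) → |G₃| ≤ K * (J.card : ℝ) →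
        (J.card : ℝ) ≤ K * |G₁| →
        (∫ ω, (fieldSum X ω : ℝ) ∂μ
              < ProbabilityTheory.variance (fun ω => (fieldSum X ω : ℝ)) μ →
          (J.card : ℝ) ≤ K * |G₂| →
          ∀ r pbar lam : ℝ, MatchM2 G₁ G₂ G₃ r pbar lam → H2 r pbar lam →
            dTV μ (fieldSum X) (M2Weight r pbar lam) ≤
              C * (m : ℝ) ^ (3 * d) / (1 - 2 * theta2 r pbar lam) * supFourthSmooth m X μ) ∧
        (ProbabilityTheory.variance (fun ω => (fieldSum X ω : ℝ)) μ
              < ∫ ω, (fieldSum X ω : ℝ) ∂μ →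
          (J.card : ℝ) ≤ K * |G₂ + G₃| →
          ∀ (n : ℕ) (p lam : ℝ), MatchM1 G₁ G₂ G₃ n p lam → H1 n p lam →
            dTV μ (fieldSum X) (M1Weight n p lam) ≤
              C * (m : ℝ) ^ (3 * d) / (1 - 2 * theta1 n p lam) * supFourthSmooth m X μ
              + 1 / ((1 - 2 * theta1 n p lam) * (J.card : ℝ)))) := by
  have hc0 : (0 : ℝ) < 72 * 4913 ^ d := by positivity
  refine ⟨⟨44 * (72 * 4913 ^ d), by positivity, ?_⟩, fun K hK =>
    ⟨88 * (72 * 4913 ^ d) * K ^ 3, by positivity, ?_⟩⟩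
  · rintro m hm J Ω _ μ _ X hX hint hdep G₁ G₂ G₃ rfl rfl rfl
    refine ⟨fun _ r p lam hM hH => ?_, fun hvar n p lam hM hH => ?_⟩
    · obtain ⟨hp, hG2, hpG⟩ := hM.pos
      obtain ⟨hT, hG1, hb⟩ := dTV_M2_le_smoothness hX hint hdep hm hM hH
      exact hb.trans (bound_M2_general hp hG1 hG2 hpG hT hc0.le (by positivity) (by positivity)
        supFourthSmooth_nonneg)
    · have hG2 := gam2_neg hX hint hvar
      obtain ⟨hq, hqG, hsum⟩ := hM.neg hG2
      obtain ⟨hT, hG1, hb⟩ := dTV_M1_le_smoothness hX hint hdep hm hM hH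
      exact hb.trans (bound_M1_general hq hG1 hG2 hqG hsum hT hc0.le (by positivity)
        (by positivity) supFourthSmooth_nonneg)
  · rintro m hm J Ω _ μ _ X hX hint hdep G₁ G₂ G₃ rfl rfl rfl hK1 hK2 hK3 hJ1
    refine ⟨fun _ hJ2 r p lam hM hH => ?_, fun hvar hJ2 n p lam hM hH => ?_⟩
    · obtain ⟨hp, hG2, hpG⟩ := hM.pos
      obtain ⟨hT, hG1, hb⟩ := dTV_M2_le_smoothness hX hint hdep hm hM hH
      rw [abs_of_pos hG1] at hJ1
      refine hb.trans ((bound_of_comparable two_pos.le hc0.le (by positivity) (by positivity)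
        supFourthSmooth_nonneg hG1 hp hT ((div_le_iff₀ hG1).2 hJ1)
        (one_div_le_of_comparable_M2 hK hp hG2 hpG hK2 hK3 hJ2)).trans ?_)
      refine mul_le_mul_of_nonneg_right ?_ supFourthSmooth_nonneg
      refine div_le_div_of_nonneg_right (mul_le_mul_of_nonneg_right ?_ (by positivity)) hT.le
      have : 0 < 72 * 4913 ^ d * K ^ 3 := by positivity
      linarith
    · have hG2 := gam2_neg hX hint hvar
      obtain ⟨hq, hqG, hsum⟩ := hM.neg hG2
      obtain ⟨hT, hG1, hb⟩ := dTV_M1_le_smoothness hX hint hdep hm hM hH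
      rw [abs_of_pos hG1] at hJ1
      refine hb.trans ((bound_of_comparable (by norm_num) hc0.le (by positivity) (by positivity)
        supFourthSmooth_nonneg hG1 hq hT ((div_le_iff₀ hG1).2 hJ1)
        (one_div_le_of_comparable_M1 hK hq hG2 hqG hK2 hJ2)).trans ?_)
      refine le_trans (mul_le_mul_of_nonneg_right ?_ supFourthSmooth_nonneg)
        (le_add_of_nonneg_right (by positivity))
      refine div_le_div_of_nonneg_right (mul_le_mul_of_nonneg_right ?_ (by positivity)) hT.le
      have : 0 < 72 * 4913 ^ d * K ^ 3 := by positivity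
      linarith
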